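/- Let $d\ge 1$, $H\in(0,\frac1d)$, $T\in(0,\infty)$, and let $Z=(Z_t)_{t\in[0,T]}$ be an $\mathbb R^d$-valued process with almost surely continuous paths. (a) Suppose that $Z=(Z^1,\dots,Z^d)$ is a centered Gaussian process such that (i) there are constants $0<C_-$ and $C_+$ with $C_-|t-s|^{2H}\le \mathbb E(Z^l_t-Z^l_s)^2\le C_+|t-s|^{2H}$ for all $s,t\in[0,T]$ and $1\le l\le d$; (ii) (local nondeterminism) there is a constant $C>0$ such that $$\mathbb E\Big|\sum_{k=1}^m\langle \xi_k,Z_{t_k}-Z_{t_{k-1}}\rangle\Big|^2\ \ge\ C\max_{1\le l\le d}\ \max_{1\le k\le m}\ \xi_{k,l}^2\,\mathbb E(Z^l_{t_k}-Z^l_{t_{k-1}})^2$$ for all $m\in\mathbb N$, all $\xi_1,\dots,\xi_m\in\mathbb R^d$ and all $0=t_0<t_1<\dots<t_m\le T$. Then the following hold with $\alpha=H$, $\theta=0$, $\iota=\frac12$. Here $\|\cdot\|$ is the Euclidean norm, and all time intervals are intersected with $[0,T]$. 1. There is $C>0$ such that $\mathbb E\|Z_t-Z_s\|^p\le C^pp^{p\iota}|t-s|^{p\alpha}$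 for all $p\ge1$ and $0\le s\le t\le T$. 2. Almost surely, for every Borel set $B\subseteq[0,T]$ the occupation measure $A\mapsto\lambda(B\cap Z^{-1}(A))$ is absolutely continuous with respect to Lebesgue measure on $\mathbb R^d$, and its density (the local time) $L(x,B)$ can be chosen so that $(x,t)\mapsto L(x,[0,t])$ is jointly continuous on $\mathbb R^d\times[0,T]$. 3. There are deterministic finite constants $C_1,C_2$ such that, for every $s\in[0,T]$, almost surely $$\limsup_{r\to0}\frac{\sup_{x\in\mathbb R^d}L(x,[s-r,s+r])}{r^{1-\alpha d}(\log\log r^{-1})^{\alpha(d+\theta)}}\le C_1,$$ and almost surely $$\limsup_{r\to0}\sup_{s\in[0,T]}\sup_{x\in\mathbb R^d}\frac{L(x,[s-r,s+r])}{r^{1-\alpha d}(\log r^{-1})^{\alpha(d+\theta)}}\le C_2.$$ 4. There are deterministic finite constants $C_1,C_2$, not depending on $x$ and $t$, such that for every $t\in[0,T]$ and $x\in\mathbb R^d$, almost surely $$\limsup_{r\to0}\frac{L(x,[t-r,t+r])}{r^{1-\alpha d}(\log\log r^{-1})^{\alpha(d+\theta)}}\le C_1,$$ and for every $x\in\mathbb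 R^d$, almost surely $$\limsup_{r\to0}\sup_{t\in[0,T]}\frac{L(x,[t-r,t+r])}{r^{1-\alpha d}(\log r^{-1})^{\alpha(d+\theta)}}\le C_2.$$ 5. There is a deterministic constant $C\in(0,\infty)$ such that for every $s\in[0,T]$, almost surely $$\liminf_{r\to0}\sup_{t\in(s-r,s+r)}\frac{\|Z_t-Z_s\|}{r^{\alpha d}(\log\log r^{-1})^{-\alpha(d+\theta)}}\ge C,$$ and almost surely $$\liminf_{r\to0}\inf_{s\in[0,T]}\sup_{t\in(s-r,s+r)}\frac{\|Z_t-Z_s\|}{r^{\alpha d}(\log r^{-1})^{-\alpha(d+\theta)}}\ge C.$$ 6. Almost surely, $t\mapsto Z_t$ is nowhere differentiable on $[0,T]$. (b) If $Z$ is a $d$-dimensional fractional Brownian motion with Hurst index $H$ (independent centered Gaussian components, each with covariance $\frac12(s^{2H}+t^{2H}-|t-s|^{2H})$), then $Z$ satisfies (i) and (ii), and hence 1.–6. -/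

import Mathlib

open MeasureTheory ProbabilityTheory Filter Set Topology
open scoped ENNReal NNReal

noncomputable section

namespace GaussianLocalTime

/-- The state space `ℝ^d` with its Euclidean norm and Lebesgue measure. -/
abbrev E (d : ℕ) : Type := EuclideanSpace ℝ (Fin d)

/-! ### Local times of a path on `[0, T]` -/

/-- The occupation measure `A ↦ λ (B ∩ f⁻¹ A)` of the path `f` over a time set `B`. -/
def occupationMeasure {d : ℕ} (f : ℝ → E d) (B : Set ℝ) : Measure (E d) :=
  (volume.restrict B).map f

/-- `L` is the jointly continuous local time of the path `f` on `[0, T]`: all occupation measures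
are absolutely continuous, `(x, t) ↦ L x t` is continuous on `ℝ^d × [0, T]`, and `x ↦ L x t` is a
density of the occupation measure over `[0, t]`.  So `L x t` is `L(x, [0, t])`. -/
structure IsContinuousLocalTime {d : ℕ} (T : ℝ) (f : ℝ → E d) (L : E d → ℝ → ℝ) : Prop where
  absolutelyContinuous : ∀ B : Set ℝ, MeasurableSet B → B ⊆ Icc 0 T →
    occupationMeasure f B ≪ volume
  continuousOn : ContinuousOn (fun p : E d × ℝ => L p.1 p.2) (univ ×ˢ Icc 0 T)
  nonneg : ∀ x : E d, ∀ t ∈ Icc 0 T, 0 ≤ L x t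
  density : ∀ t ∈ Icc 0 T,
    occupationMeasure f (Icc 0 t) = volume.withDensity (fun x => ENNReal.ofReal (L x t))

/-- The local time `L(x, [s - r, s + r] ∩ [0, T])` of a window, as the increment
`L(x, [0, b]) - L(x, [0, a])` between the end points `a ≤ b` of the window. -/
def windowLocalTime {d : ℕ} (T : ℝ) (L : E d → ℝ → ℝ) (x : E d) (s r : ℝ) : ℝ≥0∞ :=
  ENNReal.ofReal (L x (min (s + r) T) - L x (max (s - r) 0))

/-- The oscillation `sup {‖f t - f s‖ : t ∈ (s - r, s + r) ∩ [0, T]}`. -/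
def oscillation {d : ℕ} (T : ℝ) (f : ℝ → E d) (s r : ℝ) : ℝ≥0∞ :=
  ⨆ t ∈ Ioo (s - r) (s + r) ∩ Icc 0 T, ‖f t - f s‖ₑ

/-- `r ^ (1 - α d) (log log r⁻¹) ^ (α (d + θ))` -/
def loglogGauge (d : ℕ) (α θ r : ℝ) : ℝ≥0∞ :=
  ENNReal.ofReal (r ^ (1 - α * d) * Real.log (Real.log r⁻¹) ^ (α * (d + θ)))

/-- `r ^ (1 - α d) (log r⁻¹) ^ (α (d + θ))` -/
def logGauge (d : ℕ) (α θ r : ℝ) : ℝ≥0∞ :=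
  ENNReal.ofReal (r ^ (1 - α * d) * Real.log r⁻¹ ^ (α * (d + θ)))

/-- `r ^ (α d) (log log r⁻¹) ^ (-α (d + θ))` -/
def loglogOscGauge (d : ℕ) (α θ r : ℝ) : ℝ≥0∞ :=
  ENNReal.ofReal (r ^ (α * d) * Real.log (Real.log r⁻¹) ^ (-(α * (d + θ))))

/-- `r ^ (α d) (log r⁻¹) ^ (-α (d + θ))` -/
def logOscGauge (d : ℕ) (α θ r : ℝ) : ℝ≥0∞ :=
  ENNReal.ofReal (r ^ (α * d) * Real.log r⁻¹ ^ (-(α * (d + θ))))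

/-! ### The assertions about a process `Z = (Z_t)_{t ∈ [0, T]}`

Only the values `Z t` with `t ∈ [0, T]` matter.  All suprema, limits superior and limits inferior
are taken in `[0, ∞]`. -/

section Assertions

variable {Ω : Type*} [MeasurableSpace Ω] {d : ℕ}

/-- Bounds for the local time, uniform over the space variable. -/
def UniformLocalTimeBounds (P : Measure Ω) (T α θ : ℝ) (L : Ω → E d → ℝ → ℝ) : Prop :=
  ∃ C₁ C₂ : ℝ≥0,
    (∀ s ∈ Icc 0 T, ∀ᵐ ω ∂P,
      limsup (fun r => (⨆ x, windowLocalTime T (L ω) x s r) / loglogGauge d α θ r)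
        (𝓝[>] (0 : ℝ)) ≤ C₁) ∧
    (∀ᵐ ω ∂P,
      limsup (fun r => ⨆ s ∈ Icc 0 T, ⨆ x, windowLocalTime T (L ω) x s r / logGauge d α θ r)
        (𝓝[>] (0 : ℝ)) ≤ C₂)

/-- Bounds for the local time at a fixed level, with constants not depending on the level. -/
def PointwiseLocalTimeBounds (P : Measure Ω) (T α θ : ℝ) (L : Ω → E d → ℝ → ℝ) : Prop :=
  ∃ C₁ C₂ : ℝ≥0,
    (∀ t ∈ Icc 0 T, ∀ x : E d, ∀ᵐ ω ∂P,
      limsup (fun r => windowLocalTime T (L ω) x t r / loglogGauge d α θ r)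
        (𝓝[>] (0 : ℝ)) ≤ C₁) ∧
    (∀ x : E d, ∀ᵐ ω ∂P,
      limsup (fun r => ⨆ t ∈ Icc 0 T, windowLocalTime T (L ω) x t r / logGauge d α θ r)
        (𝓝[>] (0 : ℝ)) ≤ C₂)

/-- Lower bounds for the oscillation of the paths. -/
def OscillationBounds (P : Measure Ω) (T α θ : ℝ) (Z : ℝ → Ω → E d) : Prop :=
  ∃ C : ℝ≥0, 0 < C ∧
    (∀ s ∈ Icc 0 T, ∀ᵐ ω ∂P,
      (C : ℝ≥0∞) ≤ liminf (fun r => oscillation T (Z · ω) s r / loglogOscGauge d α θ r)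
        (𝓝[>] (0 : ℝ))) ∧
    (∀ᵐ ω ∂P,
      (C : ℝ≥0∞) ≤ liminf (fun r => ⨅ s ∈ Icc 0 T,
        oscillation T (Z · ω) s r / logOscGauge d α θ r) (𝓝[>] (0 : ℝ)))

/-- Almost every path is differentiable at no point of `[0, T]` (one-sidedly at the ends). -/
def NowhereDifferentiable (P : Measure Ω) (T : ℝ) (Z : ℝ → Ω → E d) : Prop :=
  ∀ᵐ ω ∂P, ∀ s ∈ Icc 0 T, ¬ DifferentiableWithinAt ℝ (Z · ω) (Icc 0 T) s

/-- `E ‖Z_t - Z_s‖ ^ p ≤ C ^ p p ^ (p ι) |t - s| ^ (p α)` for all `p ≥ 1`. -/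
def IncrementMomentBounds (P : Measure Ω) (T α ι : ℝ) (Z : ℝ → Ω → E d) : Prop :=
  ∃ C : ℝ, 0 < C ∧ ∀ p : ℝ, 1 ≤ p → ∀ s t : ℝ, 0 ≤ s → s ≤ t → t ≤ T →
    ∫⁻ ω, ‖Z t ω - Z s ω‖ₑ ^ p ∂P ≤
      ENNReal.ofReal (C ^ p * p ^ (p * ι) * |t - s| ^ (p * α))

/-- All the conclusions, with parameters `α`, `θ`, `ι`.  The local time in question is
determined by the path up to a null set of `ω`. -/
def LocalTimeAssertions (P : Measure Ω) (T α θ ι : ℝ) (Z : ℝ → Ω → E d) : Prop :=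
  IncrementMomentBounds P T α ι Z ∧
  (∃ L : Ω → E d → ℝ → ℝ,
    (∀ᵐ ω ∂P, IsContinuousLocalTime T (Z · ω) (L ω)) ∧
    UniformLocalTimeBounds P T α θ L ∧
    PointwiseLocalTimeBounds P T α θ L) ∧
  OscillationBounds P T α θ Z ∧
  NowhereDifferentiable P T Z

/-! ### The hypotheses -/

/-- `(Z_t)_{t ∈ [0, T]}` is a centered Gaussian process with values in `ℝ^d`. -/
structure IsCenteredGaussian (P : Measure Ω) (T : ℝ) (Z : ℝ → Ω → E d) : Prop where
  gaussian : IsGaussianProcess (fun t : Icc (0 : ℝ) T => Z t) P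
  centered : ∀ t ∈ Icc 0 T, ∫ ω, Z t ω ∂P = 0

/-- `C₋ |t - s| ^ (2H) ≤ E (Z^l_t - Z^l_s) ^ 2 ≤ C₊ |t - s| ^ (2H)` for every component. -/
def IncrementVarianceBounds (P : Measure Ω) (T H : ℝ) (Z : ℝ → Ω → E d) : Prop :=
  ∃ Cm Cp : ℝ, 0 < Cm ∧ ∀ s ∈ Icc 0 T, ∀ t ∈ Icc 0 T, ∀ l : Fin d,
    Cm * |t - s| ^ (2 * H) ≤ ∫ ω, (Z t ω l - Z s ω l) ^ 2 ∂P ∧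
    ∫ ω, (Z t ω l - Z s ω l) ^ 2 ∂P ≤ Cp * |t - s| ^ (2 * H)

/-- Local nondeterminism: with one constant `C > 0` for all `m`, all `ξ_1, …, ξ_m ∈ ℝ^d` and all
`0 = t_0 < t_1 < ⋯ < t_m ≤ T`,
`E |∑_k ⟨ξ_k, Z_{t_k} - Z_{t_{k-1}}⟩|² ≥ C max_{k, l} ξ_{k,l}² E (Z^l_{t_k} - Z^l_{t_{k-1}})²`. -/
def LocallyNondeterministic (P : Measure Ω) (T : ℝ) (Z : ℝ → Ω → E d) : Prop :=
  ∃ C : ℝ, 0 < C ∧ ∀ (m : ℕ) (ξ : Fin m → E d) (t : Fin (m + 1) → ℝ),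
    StrictMono t → t 0 = 0 → t (Fin.last m) ≤ T →
    ∀ (k : Fin m) (l : Fin d),
      C * (ξ k l ^ 2 * ∫ ω, (Z (t k.succ) ω l - Z (t k.castSucc) ω l) ^ 2 ∂P) ≤
        ∫ ω, (∑ j : Fin m, inner ℝ (ξ j) (Z (t j.succ) ω - Z (t j.castSucc) ω)) ^ 2 ∂P

/-- `d`-dimensional fractional Brownian motion on `[0, T]` with Hurst index `H`: a centered
Gaussian process with uncorrelated (hence independent) components, each with covariance
`(s ^ (2H) + t ^ (2H) - |t - s| ^ (2H)) / 2`. -/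
structure IsFractionalBrownianMotion (P : Measure Ω) (T H : ℝ) (Z : ℝ → Ω → E d) : Prop
    extends IsCenteredGaussian P T Z where
  covariance : ∀ s ∈ Icc 0 T, ∀ t ∈ Icc 0 T, ∀ i j : Fin d,
    ∫ ω, Z s ω i * Z t ω j ∂P =
      if i = j then (s ^ (2 * H) + t ^ (2 * H) - |t - s| ^ (2 * H)) / 2 else 0

end Assertions

end GaussianLocalTime

end

noncomputable section

namespace GaussianLocalTime

/-! ### Gaussian regression -/

/-! Local nondeterminism says that the increment of the process over a time gap keeps, after the
best linear prediction from earlier increments, a variance of order gap^(2H) in every direction. For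
Gaussian variables the prediction error is independent of the past, so the conditional
characteristic function of the later value is at most exp(-c gap^(2H) |u|²); this is
`ConditionalDecay`, and everything about local times is deduced from it. By Fourier inversion the
conditional expectation of a Gaussian kernel is O(gap^(-Hd)) uniformly in its width ε and its
centre. This is integrable in time because Hd < 1. Replacing ε by ε/2 gains a factor ε^γ at the
price gap^(-H(d+γ)), still integrable for small γ > 0.

The local time is the limit of the mollified local times ∫ `kernel` ε (X_s - x) ds along ε = 2⁻ⁿ.
Discretized in time, these are sums of adapted variables with controlled conditional means. A
John–Nirenberg inequality gives exponential tails for the change from one scale to the next.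
Khasminskii's lemma over N blocks of length r/N gives the tail e⁻ᴺ at the level N (r/N)^(1-Hd) =
N^(Hd) r^(1-Hd); this is where the power Hd of the logarithms comes from. Suprema over x need no
chaining: the tail bounds are integrated over all y, which is finite because the expected occupation
measure has finite mass, and a large value at one x forces large values on a small ball since
mollified local times are Lipschitz. Summing over scales gives
`ConditionalDecay.exists_measure_limitDensity_le`, and Borel–Cantelli along dyadic radii turns it
into the moduli of continuity.

A path that stays in a small ball for a time r has a large local time somewhere in that ball, so
upper bounds on local times are lower bounds on oscillations. The bound that is uniform in time
exceeds every multiple of r, which excludes differentiability.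

For fractional Brownian motion the variance of a combination of increments is a weighted L² norm of
the Fourier transform of a step function. Pairing the step function with a smooth bump inside one of
its intervals and using Cauchy–Schwarz bounds this norm below by the coefficient on that interval.
-/

theorem exists_sub_sum_inner_eq_zero {V ι : Type*} [NormedAddCommGroup V] [InnerProductSpace ℝ V]
    [Fintype ι] (e : ι → V) (x : V) :
    ∃ c : ι → ℝ, ∀ j, inner ℝ (x - ∑ i, c i • e i) (e j) = 0 := by
  have : FiniteDimensional ℝ (Submodule.span ℝ (range e)) :=
    FiniteDimensional.span_of_finite ℝ (finite_range e)
  obtain ⟨c, hc⟩ := (Submodule.mem_span_range_iff_exists_fun ℝ).1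
    ((Submodule.span ℝ (range e)).starProjection_apply_mem x)
  refine ⟨c, fun j => ?_⟩
  rw [hc]
  exact (Submodule.mem_orthogonal' _ _).1
    ((Submodule.span ℝ (range e)).sub_starProjection_mem_orthogonal x) _
    (Submodule.subset_span (mem_range_self j))

variable {Ω : Type*} [mΩ : MeasurableSpace Ω] {P : Measure Ω}

/-- Least-squares regression, that is, orthogonal projection in L². For jointly Gaussian variables
the orthogonality of the residual becomes independence. -/
theorem exists_integral_sub_sum_mul_eq_zero {ι : Type*} [Fintype ι] {U : Ω → ℝ} {V : ι → Ω → ℝ}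
    (hU : MemLp U 2 P) (hV : ∀ i, MemLp (V i) 2 P) :
    ∃ c : ι → ℝ, ∀ j, ∫ ω, (U ω - ∑ i, c i * V i ω) * V j ω ∂P = 0 := by
  obtain ⟨c, hc⟩ := exists_sub_sum_inner_eq_zero (fun i => (hV i).toLp (V i)) (hU.toLp U)
  refine ⟨c, fun j => ?_⟩
  have hsum : MemLp (fun ω => U ω - ∑ i, c i * V i ω) 2 P :=
    hU.sub (memLp_finsetSum _ fun i _ => (hV i).const_mul (c i))
  have h : (hU.toLp U - ∑ i, c i • (hV i).toLp (V i)) = hsum.toLp _ := by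
    have h1 : ∀ i, c i • (hV i).toLp (V i) = ((hV i).const_smul (c i)).toLp _ := fun i => rfl
    have h2 : ∑ i, c i • (hV i).toLp (V i) =
        (memLp_finsetSum Finset.univ fun i _ => (hV i).const_mul (c i)).toLp
          (fun ω => ∑ i, c i * V i ω) := by
      apply Lp.ext
      refine (Lp.coeFn_finsetSum Finset.univ _).trans ?_
      refine EventuallyEq.trans ?_ (MemLp.coeFn_toLp _).symm
      have h3 : ∀ᵐ ω ∂P, ∀ i, (c i • (hV i).toLp (V i) : Lp ℝ 2 P) ω = c i * V i ω := by
        rw [ae_all_iff]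
        intro i
        filter_upwards [Lp.coeFn_smul (c i) ((hV i).toLp (V i)), (hV i).coeFn_toLp] with ω h1 h2
        rw [h1, Pi.smul_apply, h2, smul_eq_mul]
      filter_upwards [h3] with ω hω
      simp [hω]
    rw [h2, ← MemLp.toLp_sub]
    rfl
  have := hc j
  rw [h, L2.inner_def] at this
  rw [← this]
  refine integral_congr_ae ?_
  filter_upwards [hsum.coeFn_toLp, (hV j).coeFn_toLp] with ω h1 h2
  rw [h1, h2]
  simp [mul_comm]

theorem norm_integral_cexp_of_hasGaussianLaw {R : Ω → ℝ} (hR : HasGaussianLaw R P)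
    (h0 : ∫ ω, R ω ∂P = 0) :
    ‖∫ ω, Complex.exp (Complex.I * R ω) ∂P‖ = Real.exp (-(∫ ω, R ω ^ 2 ∂P) / 2) := by
  have hp := hR.isProbabilityMeasure
  have h := hR.charFun_map_eq 1
  rw [charFun_apply, integral_map hR.aemeasurable (by fun_prop)] at h
  have e1 : (fun ω => inner ℝ (1 : ℝ) (R ω)) = R := by
    ext ω; simp
  rw [e1, h0, variance_of_integral_eq_zero hR.aemeasurable h0] at h
  have e2 : ∫ ω, Complex.exp (Complex.I * R ω) ∂P =
      ∫ ω, Complex.exp (inner ℝ (R ω) (1 : ℝ) * Complex.I) ∂P := by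
    congr 1; ext ω; simp [mul_comm]
  rw [e2, h, Complex.norm_exp]
  congr 1
  have : ((∫ ω, R ω ^ 2 ∂P : ℝ) : ℂ) / 2 = ((∫ ω, R ω ^ 2 ∂P) / 2 : ℝ) := by push_cast; rfl
  simp only [this]
  simp [neg_div]

/-- If the residual variance of the Gaussian variable `U` on the variables `V i` is at least `v`,
the conditional characteristic function of `U` given the `V i` is at most `exp (-v / 2)`. -/
theorem norm_integral_mul_cexp_le {ι : Type*} [Fintype ι] {U : Ω → ℝ} {V : ι → Ω → ℝ}
    (hUV : HasGaussianLaw (fun ω => (U ω, fun i => V i ω)) P)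
    (hVm : ∀ i, Measurable (V i)) (hUm : Measurable U)
    (hU0 : ∫ ω, U ω ∂P = 0) (hV0 : ∀ i, ∫ ω, V i ω ∂P = 0) {v : ℝ}
    (hv : ∀ c : ι → ℝ, v ≤ ∫ ω, (U ω - ∑ i, c i * V i ω) ^ 2 ∂P)
    {g Y : Ω → ℝ} (hg : Measurable[MeasurableSpace.comap (fun ω i => V i ω) inferInstance] g)
    (hY : Measurable[MeasurableSpace.comap (fun ω i => V i ω) inferInstance] Y) :
    ‖∫ ω, (g ω : ℂ) * Complex.exp (Complex.I * ((Y ω + U ω : ℝ) : ℂ)) ∂P‖ ≤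
      Real.exp (-v / 2) * ∫ ω, |g ω| ∂P := by
  have hp := hUV.isProbabilityMeasure
  have hUL : MemLp U 2 P := hUV.fst.memLp_two
  have hVG : HasGaussianLaw (fun ω i => V i ω) P := hUV.snd
  have hVL : ∀ i, MemLp (V i) 2 P := fun i => (hVG.eval i).memLp_two
  obtain ⟨c, hc⟩ := exists_integral_sub_sum_mul_eq_zero hUL hVL
  -- The prediction error. It has variance at least `v` by `hv c`, and it turns out to be
  -- independent of the vector `W`.
  set R : Ω → ℝ := fun ω => U ω - ∑ i, c i * V i ω with hRdef
  set W : Ω → ι → ℝ := fun ω i => V i ω with hWdef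
  have hWm : Measurable W := measurable_pi_iff.2 hVm
  have hRm : Measurable R := hUm.sub (Finset.measurable_sum _ fun i _ => (hVm i).const_mul _)
  have hRV : HasGaussianLaw (fun ω => (R ω, W ω)) P := by
    let A : ℝ × (ι → ℝ) →L[ℝ] ℝ × (ι → ℝ) :=
      ContinuousLinearMap.prod
        (ContinuousLinearMap.fst ℝ ℝ (ι → ℝ) -
          (∑ i, c i • ContinuousLinearMap.proj (R := ℝ) (φ := fun _ : ι => ℝ) i).comp
            (ContinuousLinearMap.snd ℝ ℝ (ι → ℝ)))
        (ContinuousLinearMap.snd ℝ ℝ (ι → ℝ))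
    have := hUV.map_fun A
    refine this.congr (Eventually.of_forall fun ω => ?_)
    simp [A, hRdef, hWdef]
  have hR0 : ∫ ω, R ω ∂P = 0 := by
    rw [hRdef, integral_sub (hUL.integrable (by norm_num)), hU0, integral_finsetSum]
    · simp [integral_const_mul, hV0]
    · exact fun i _ => ((hVL i).integrable (by norm_num)).const_mul _
    · exact integrable_finsetSum _ fun i _ => ((hVL i).integrable (by norm_num)).const_mul _
  have hRL : MemLp R 2 P := hRV.fst.memLp_two
  -- Vanishing covariances give independence of jointly Gaussian families, so `R` is treated as a
  -- family indexed by `Unit`.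
  have hind : IndepFun (fun ω (_ : Unit) => R ω) W P := by
    refine HasGaussianLaw.indepFun_of_covariance_eval (X := fun _ : Unit => R) (Y := V) ?_ ?_
    · let A : ℝ × (ι → ℝ) →L[ℝ] (Unit → ℝ) × (ι → ℝ) :=
        ContinuousLinearMap.prod
          (ContinuousLinearMap.pi fun _ => ContinuousLinearMap.fst ℝ ℝ (ι → ℝ))
          (ContinuousLinearMap.snd ℝ ℝ (ι → ℝ))
      exact (hRV.map_fun A).congr (Eventually.of_forall fun ω => by simp [A, hWdef])
    · intro _ j
      rw [covariance_eq_sub hRL (hVL j), hV0 j, mul_zero, sub_zero]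
      exact hc j
  have hind2 : IndepFun R W P := hind.comp (φ := fun f : Unit → ℝ => f ()) (ψ := id)
    (measurable_pi_apply _) measurable_id
  -- the part measurable with respect to the past
  let G : Ω → ℂ := fun ω => (g ω : ℂ) *
    Complex.exp (Complex.I * ((Y ω + ∑ i, c i * V i ω : ℝ) : ℂ))
  have hVc : ∀ i, Measurable[MeasurableSpace.comap W inferInstance] (V i) := fun i =>
    (measurable_pi_apply i).comp (comap_measurable W)
  have hGm : Measurable[MeasurableSpace.comap W inferInstance] G := by
    have h1 : Measurable[MeasurableSpace.comap W inferInstance]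
        (fun ω => Y ω + ∑ i, c i * V i ω) :=
      Measurable.add hY (Finset.measurable_sum _ fun i _ => (hVc i).const_mul _)
    exact (Complex.measurable_ofReal.comp hg).mul (Complex.measurable_exp.comp
      ((Complex.measurable_ofReal.comp h1).const_mul _))
  let K : Ω → ℂ := fun ω => Complex.exp (Complex.I * (R ω : ℂ))
  have hKm : Measurable K := by fun_prop
  have hWle : MeasurableSpace.comap W inferInstance ≤ mΩ := hWm.comap_le
  have hGK : IndepFun G K P := by
    rw [IndepFun_iff_Indep]
    refine indep_of_indep_of_le_right (indep_of_indep_of_le_left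
      ((IndepFun_iff_Indep _ _ _).1 hind2.symm) hGm.comap_le) ?_
    have : K = (fun x : ℝ => Complex.exp (Complex.I * (x : ℂ))) ∘ R := rfl
    rw [this, ← MeasurableSpace.comap_comp]
    refine MeasurableSpace.comap_mono ?_
    exact Measurable.comap_le (by fun_prop)
  -- The linear prediction is moved into the past factor `G`, which has modulus `|g|`; only `R`
  -- remains in `K`, and the integral factors.
  have hprod : ∫ ω, (g ω : ℂ) * Complex.exp (Complex.I * ((Y ω + U ω : ℝ) : ℂ)) ∂P =
      (∫ ω, G ω ∂P) * ∫ ω, K ω ∂P := by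
    rw [← hGK.integral_mul_eq_mul_integral (hGm.mono hWle le_rfl).aestronglyMeasurable
      hKm.aestronglyMeasurable]
    refine integral_congr_ae (Eventually.of_forall fun ω => ?_)
    simp only [Pi.mul_apply, G, K, mul_assoc, ← Complex.exp_add, hRdef]
    congr 2
    push_cast
    ring
  rw [hprod, norm_mul, mul_comm]
  have hK : ‖∫ ω, K ω ∂P‖ = Real.exp (-(∫ ω, R ω ^ 2 ∂P) / 2) :=
    norm_integral_cexp_of_hasGaussianLaw hRV.fst hR0
  rw [hK]
  gcongr
  · exact hv c
  · refine (norm_integral_le_integral_norm _).trans (le_of_eq ?_)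
    congr 1; ext ω
    simp only [G, norm_mul, Complex.norm_real, Real.norm_eq_abs]
    rw [Complex.norm_exp]
    simp

end GaussianLocalTime

end


noncomputable section

namespace GaussianLocalTime

variable {Ω : Type*} [mΩ : MeasurableSpace Ω] {P : Measure Ω} {d : ℕ}

/-! ### A measurable modification started at the origin -/

/-- Outside a measurable null set the path is continuous on [0, T] and agrees with measurable
versions at a dense sequence of times, so each value is a pointwise limit of measurable functions.
Clamping time to [0, T] gives paths continuous on the whole line, and subtracting the value at 0
makes the process a function of its increments. -/
theorem exists_continuous_modification {T : ℝ} (hT : 0 < T) {Z : ℝ → Ω → E d}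
    (hZ : ∀ t ∈ Icc 0 T, AEMeasurable (Z t) P)
    (hcont : ∀ᵐ ω ∂P, ContinuousOn (fun t => Z t ω) (Icc 0 T)) :
    ∃ X : ℝ → Ω → E d, (∀ t, Measurable (X t)) ∧ (∀ ω, Continuous fun t => X t ω) ∧
      (∀ ω, X 0 ω = 0) ∧ ∀ᵐ ω ∂P, ∀ t ∈ Icc 0 T, X t ω = Z t ω - Z 0 ω := by
  classical
  have h0 : (0 : ℝ) ∈ Icc 0 T := ⟨le_rfl, hT.le⟩
  have hne : Nonempty (Icc (0 : ℝ) T) := ⟨⟨0, h0⟩⟩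
  let q : ℕ → Icc (0 : ℝ) T := TopologicalSpace.denseSeq _
  have hq : DenseRange q := TopologicalSpace.denseRange_denseSeq _
  have hgood : ∀ᵐ ω ∂P, ContinuousOn (fun t => Z t ω) (Icc 0 T) ∧
      (∀ n, Z (q n) ω = (hZ (q n) (q n).2).mk _ ω) ∧ Z 0 ω = (hZ 0 h0).mk _ ω :=
    hcont.and ((ae_all_iff.2 fun n => (hZ (q n) (q n).2).ae_eq_mk).and (hZ 0 h0).ae_eq_mk)
  obtain ⟨S, hSsub, hSm, hSnull⟩ := exists_measurable_superset_of_null (ae_iff.1 hgood)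
  have hS : ∀ ω ∉ S, ContinuousOn (fun t => Z t ω) (Icc 0 T) ∧
      (∀ n, Z (q n) ω = (hZ (q n) (q n).2).mk _ ω) ∧ Z 0 ω = (hZ 0 h0).mk _ ω := by
    intro ω hω
    by_contra hc
    exact hω (hSsub hc)
  let X : ℝ → Ω → E d := fun t => Sᶜ.indicator fun ω => Z (projIcc 0 T hT.le t) ω - Z 0 ω
  have hXq : ∀ t : Icc (0 : ℝ) T, Measurable (X t) := by
    intro t
    obtain ⟨s, hs, hst⟩ := mem_closure_iff_seq_limit.1 (hq t)
    choose n hn using hs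
    let f : ℕ → Ω → E d := fun k => Sᶜ.indicator fun ω =>
      (hZ (q (n k)) (q (n k)).2).mk _ ω - (hZ 0 h0).mk _ ω
    have hf : ∀ k, Measurable (f k) := fun k =>
      ((hZ (q (n k)) (q (n k)).2).measurable_mk.sub (hZ 0 h0).measurable_mk).indicator hSm.compl
    refine measurable_of_tendsto_metrizable hf (tendsto_pi_nhds.2 fun ω => ?_)
    by_cases hω : ω ∈ Sᶜ
    · obtain ⟨h1, h2, h3⟩ := hS ω hω
      simp only [f, X, indicator_of_mem hω, projIcc_val]
      rw [h3]
      refine Tendsto.sub ?_ tendsto_const_nhds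
      have : ∀ k, (hZ (q (n k)) (q (n k)).2).mk _ ω = Z (s k) ω := fun k => by
        rw [← h2, hn]
      simp only [this]
      exact (continuousOn_iff_continuous_domRestrict.1 h1).continuousAt.tendsto.comp hst
    · simp only [f, X, indicator_of_notMem hω]
      exact tendsto_const_nhds
  refine ⟨X, ?_, ?_, ?_, ?_⟩
  · intro t
    have := hXq (projIcc 0 T hT.le t)
    simpa only [X, projIcc_val] using this
  · intro ω
    by_cases hω : ω ∈ Sᶜ
    · simp only [X, indicator_of_mem hω]
      refine Continuous.sub ?_ continuous_const
      exact (continuousOn_iff_continuous_domRestrict.1 (hS ω hω).1).comp continuous_projIcc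
    · simp only [X, indicator_of_notMem hω]
      exact continuous_const
  · intro ω
    by_cases hω : ω ∈ Sᶜ
    · simp [X, indicator_of_mem hω, projIcc_left]
    · simp only [X, indicator_of_notMem hω]
  · have : ∀ᵐ ω ∂P, ω ∈ Sᶜ := compl_mem_ae_iff.2 hSnull
    filter_upwards [this] with ω hω t ht
    simp only [X, indicator_of_mem hω, projIcc_of_mem hT.le ht]

/-! ### The conditional characteristic function of the increments -/

theorem measurable_of_coord {α : Type*} {m : MeasurableSpace α} {f : α → E d}
    (h : ∀ l, Measurable fun a => f a l) : Measurable f :=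
  (WithLp.measurable_toLp 2 (Fin d → ℝ)).comp (measurable_pi_iff.2 h)

/-- The `σ`-algebra generated by the first `k` increments of `X` along the times `τ`. -/
@[reducible] def incrementSigma (X : ℝ → Ω → E d) (τ : ℕ → ℝ) (k : ℕ) : MeasurableSpace Ω :=
  MeasurableSpace.comap
    (fun ω (p : Fin k × Fin d) => (X (τ (p.1 + 1)) ω - X (τ p.1) ω) p.2) inferInstance

/-- The conditional characteristic function of `X (τ j)` given the increments up to `τ k` decays
like that of a Gaussian vector with variance of order `(τ j - τ k) ^ (2H)`. -/
def ConditionalDecay (P : Measure Ω) (X : ℝ → Ω → E d) (T H c : ℝ) : Prop :=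
  ∀ τ : ℕ → ℝ, StrictMono τ → τ 0 = 0 → ∀ k j : ℕ, k < j → τ j ≤ T →
    ∀ g : Ω → ℝ, Measurable[incrementSigma X τ k] g → ∀ u : E d,
      ‖∫ ω, (g ω : ℂ) * Complex.exp (Complex.I * (inner ℝ u (X (τ j) ω) : ℝ)) ∂P‖ ≤
        Real.exp (-(c * (τ j - τ k) ^ (2 * H) * ‖u‖ ^ 2)) * ∫ ω, |g ω| ∂P

theorem measurable_incrementSigma_coord {Ω : Type*} (X : ℝ → Ω → E d) (τ : ℕ → ℝ) {i k : ℕ} (hi : i < k)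
    (l : Fin d) :
    Measurable[incrementSigma X τ k] fun ω => (X (τ (i + 1)) ω - X (τ i) ω) l :=
  (measurable_pi_apply ((⟨i, hi⟩, l) : Fin k × Fin d)).comp
    (comap_measurable fun ω (p : Fin k × Fin d) => (X (τ (p.1 + 1)) ω - X (τ p.1) ω) p.2)

/-- Telescoping from `X 0 = 0`; this is the reason for recentring the process. -/
theorem measurable_incrementSigma {Ω : Type*} {X : ℝ → Ω → E d} (hX0 : ∀ ω, X 0 ω = 0) {τ : ℕ → ℝ}
    (hτ : τ 0 = 0) (k i : ℕ) (hi : i ≤ k) : Measurable[incrementSigma X τ k] (X (τ i)) := by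
  induction i with
  | zero =>
    have : X (τ 0) = fun _ => 0 := by ext1 ω; rw [hτ, hX0]
    rw [this]; exact measurable_const
  | succ i ih =>
    have h1 : Measurable[incrementSigma X τ k] fun ω => X (τ (i + 1)) ω - X (τ i) ω :=
      measurable_of_coord fun l => measurable_incrementSigma_coord X τ hi l
    have h3 := h1.add (ih (by omega))
    have h4 : X (τ (i + 1)) = fun ω => (X (τ (i + 1)) ω - X (τ i) ω) + X (τ i) ω := by
      ext1 ω; simp
    rw [h4]; exact h3

theorem incrementSigma_mono {Ω : Type*} (X : ℝ → Ω → E d) (τ : ℕ → ℝ) {k k' : ℕ} (h : k ≤ k') :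
    incrementSigma X τ k ≤ incrementSigma X τ k' := by
  refine Measurable.comap_le ?_
  refine @measurable_pi_lambda _ _ _ (incrementSigma X τ k') _ _ fun p => ?_
  exact measurable_incrementSigma_coord X τ (lt_of_lt_of_le p.1.2 h) p.2

theorem incrementSigma_le {X : ℝ → Ω → E d} (hX : ∀ t, Measurable (X t)) (τ : ℕ → ℝ) (k : ℕ) :
    incrementSigma X τ k ≤ mΩ := by
  refine Measurable.comap_le (measurable_pi_iff.2 fun p => ?_)
  exact (measurable_pi_apply p.2).comp
    ((WithLp.measurable_ofLp 2 (Fin d → ℝ)).comp ((hX _).sub (hX _)))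

/-- Local nondeterminism with free coefficients on the earlier increments is a lower bound for the
residual variance of the last increment, which is what the Gaussian regression bound needs. -/
theorem conditionalDecay_of_locallyNondeterministic {T H : ℝ}
    (hd : 0 < d) {Z X : ℝ → Ω → E d} (hG : IsCenteredGaussian P T Z)
    (hV : IncrementVarianceBounds P T H Z) (hL : LocallyNondeterministic P T Z)
    (hXm : ∀ t, Measurable (X t)) (hX0 : ∀ ω, X 0 ω = 0)
    (hXZ : ∀ᵐ ω ∂P, ∀ t ∈ Icc 0 T, X t ω = Z t ω - Z 0 ω) :
    ∃ c, 0 < c ∧ ConditionalDecay P X T H c := by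
  have hprob := hG.gaussian.isProbabilityMeasure
  obtain ⟨Cm, Cp, hCm, hVb⟩ := hV
  obtain ⟨C, hC, hLb⟩ := hL
  have hd' : (0 : ℝ) < d := by exact_mod_cast hd
  -- The division by `d` comes from summing the bounds over the `d` coordinates, each of which
  -- bounds the same variance; the division by 2 is the one in exp (-v / 2).
  refine ⟨C * Cm / d / 2, by positivity, fun τ hτ hτ0 k j hkj hjT g hg u => ?_⟩
  -- The indices strictly between `k` and `j` are skipped, so the last increment is `X (τ j) - X (τ
  -- k)`.
  let σ : Fin (k + 2) → ℕ := fun i => if (i : ℕ) ≤ k then i else j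
  have hσ : StrictMono σ := by
    intro a b hab
    have hab' : (a : ℕ) < b := hab
    have := b.2
    simp only [σ]; split_ifs <;> omega
  let t : Fin (k + 2) → ℝ := fun i => τ (σ i)
  have ht : StrictMono t := hτ.comp hσ
  have ht0 : t 0 = 0 := by simp [t, σ, hτ0]
  have htl : t (Fin.last (k + 1)) = τ j := by simp [t, σ]
  have htk : t (Fin.last k).castSucc = τ k := by simp [t, σ]
  have htc : ∀ i : Fin k, t i.castSucc.castSucc = τ i := fun i => by simp [t, σ, i.2.le]
  have hts : ∀ i : Fin k, t i.castSucc.succ = τ (i + 1) := fun i => by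
    simp [t, σ]
  have htI : ∀ i, t i ∈ Icc 0 T := fun i =>
    ⟨ht0 ▸ ht.monotone (Fin.zero_le i), (ht.monotone (Fin.le_last i)).trans (htl ▸ hjT)⟩
  -- the vector of increments
  have hinc : HasGaussianLaw
      (fun ω (i : Fin (k + 1)) => X (t i.succ) ω - X (t i.castSucc) ω) P := by
    have h := hG.gaussian.hasGaussianLaw_increments (t := fun i => (⟨t i, htI i⟩ : Icc (0 : ℝ) T))
    refine h.congr ?_
    filter_upwards [hXZ] with ω hω
    ext1 i
    simp [hω _ (htI _)]
  let U : Ω → ℝ := fun ω => inner ℝ u (X (τ j) ω - X (τ k) ω)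
  let V : Fin k × Fin d → Ω → ℝ := fun p ω => (X (τ (p.1 + 1)) ω - X (τ p.1) ω) p.2
  have hUV : HasGaussianLaw (fun ω => (U ω, fun p => V p ω)) P := by
    let A : (Fin (k + 1) → E d) →L[ℝ] ℝ × (Fin k × Fin d → ℝ) :=
      ContinuousLinearMap.prod
        ((innerSL ℝ u).comp (ContinuousLinearMap.proj (Fin.last k)))
        (ContinuousLinearMap.pi fun p =>
          (EuclideanSpace.proj p.2 : E d →L[ℝ] ℝ).comp (ContinuousLinearMap.proj p.1.castSucc))
    refine (hinc.map_fun A).congr (Eventually.of_forall fun ω => ?_)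
    simp only [A, U, V, ContinuousLinearMap.prod_apply, ContinuousLinearMap.comp_apply,
      ContinuousLinearMap.proj_apply, innerSL_apply_apply, Fin.succ_last, htl, htk]
    congr 1
    ext p
    simp [htc, hts]
  have hmean : ∀ s ∈ Icc 0 T, ∀ s' ∈ Icc 0 T, ∀ w : E d,
      ∫ ω, inner ℝ w (X s ω - X s' ω) ∂P = 0 := by
    intro s hs s' hs' w
    have h1 : Integrable (Z s) P := (hG.gaussian.hasGaussianLaw_eval ⟨s, hs⟩).integrable
    have h2 : Integrable (Z s') P := (hG.gaussian.hasGaussianLaw_eval ⟨s', hs'⟩).integrable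
    have h3 : ∫ ω, inner ℝ w (X s ω - X s' ω) ∂P = ∫ ω, inner ℝ w (Z s ω - Z s' ω) ∂P := by
      refine integral_congr_ae ?_
      filter_upwards [hXZ] with ω hω
      simp [hω s hs, hω s' hs']
    rw [h3, integral_inner (f := fun ω => Z s ω - Z s' ω) (h1.sub h2), integral_sub h1 h2,
      hG.centered s hs, hG.centered s' hs']
    simp
  have hτI : ∀ i, i ≤ j → τ i ∈ Icc 0 T := fun i hi =>
    ⟨hτ0 ▸ hτ.monotone (Nat.zero_le i), (hτ.monotone hi).trans hjT⟩
  have hU0 : ∫ ω, U ω ∂P = 0 := hmean _ (hτI j le_rfl) _ (hτI k hkj.le) u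
  have hV0 : ∀ p, ∫ ω, V p ω ∂P = 0 := by
    intro p
    have := hmean _ (hτI (p.1 + 1) (by omega)) _ (hτI p.1 (by omega)) (EuclideanSpace.single p.2 1)
    simpa [V, EuclideanSpace.inner_single_left] using this
  have hUm : Measurable U := by
    have := (hXm (τ j)).sub (hXm (τ k))
    exact Measurable.const_inner this
  have hVm : ∀ p, Measurable (V p) := fun p => (measurable_pi_apply p.2).comp
    ((WithLp.measurable_ofLp 2 (Fin d → ℝ)).comp ((hXm _).sub (hXm _)))
  have hv : ∀ c : Fin k × Fin d → ℝ, C * Cm / d * (τ j - τ k) ^ (2 * H) * ‖u‖ ^ 2 ≤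
      ∫ ω, (U ω - ∑ p, c p * V p ω) ^ 2 ∂P := by
    intro c
    -- The last coefficient is the direction `u`; the earlier ones encode an arbitrary linear
    -- predictor with a minus sign.
    let ξ : Fin (k + 1) → E d :=
      Fin.snoc (fun i => WithLp.toLp 2 fun l => -c (i, l)) u
    have h1 : ∀ l : Fin d, C * Cm * (τ j - τ k) ^ (2 * H) * u l ^ 2 ≤
        ∫ ω, (∑ i : Fin (k + 1), inner ℝ (ξ i) (Z (t i.succ) ω - Z (t i.castSucc) ω)) ^ 2 ∂P := by
      intro l
      refine le_trans ?_ (hLb (k + 1) ξ t ht ht0 (htl ▸ hjT) (Fin.last k) l)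
      have h2 := (hVb (τ k) (hτI k hkj.le) (τ j) (hτI j le_rfl) l).1
      rw [abs_of_nonneg (sub_nonneg.2 (hτ.monotone hkj.le))] at h2
      have h3 : ξ (Fin.last k) = u := Fin.snoc_last _ _
      rw [h3, Fin.succ_last, htl, htk]
      calc C * Cm * (τ j - τ k) ^ (2 * H) * u l ^ 2
          = C * (u l ^ 2 * (Cm * (τ j - τ k) ^ (2 * H))) := by ring
        _ ≤ _ := by gcongr
    have h4 : ∫ ω, (∑ i : Fin (k + 1), inner ℝ (ξ i) (Z (t i.succ) ω - Z (t i.castSucc) ω)) ^ 2 ∂P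
        = ∫ ω, (U ω - ∑ p, c p * V p ω) ^ 2 ∂P := by
      refine integral_congr_ae ?_
      filter_upwards [hXZ] with ω hω
      have h5 : ∀ i : Fin (k + 1), Z (t i.succ) ω - Z (t i.castSucc) ω =
          X (t i.succ) ω - X (t i.castSucc) ω := fun i => by simp [hω _ (htI _)]
      simp only [h5]
      congr 1
      rw [Fin.sum_univ_castSucc]
      simp only [ξ, Fin.snoc_castSucc, Fin.snoc_last, Fin.succ_last, htl, htk, htc, hts, U, V]
      rw [Fintype.sum_prod_type, add_comm, sub_eq_add_neg (inner ℝ u _), ← Finset.sum_neg_distrib]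
      congr 1
      refine Finset.sum_congr rfl fun i _ => ?_
      rw [PiLp.inner_apply, ← Finset.sum_neg_distrib]
      refine Finset.sum_congr rfl fun l _ => ?_
      simp; ring
    rw [h4] at h1
    have h6 : ‖u‖ ^ 2 = ∑ l, u l ^ 2 := by
      rw [EuclideanSpace.norm_sq_eq]; simp
    have h7 := Finset.sum_le_sum fun l (_ : l ∈ Finset.univ) => h1 l
    rw [← Finset.mul_sum, ← h6, Finset.sum_const, Finset.card_univ, Fintype.card_fin,
      nsmul_eq_mul] at h7
    rw [div_mul_eq_mul_div, div_mul_eq_mul_div, div_le_iff₀ hd', mul_comm (∫ _, _ ∂P)]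
    exact h7
  -- `X (τ j)` splits into its past part `X (τ k)` and the increment `U`; the former only
  -- contributes a phase.
  have hYm : Measurable[incrementSigma X τ k] fun ω => (inner ℝ u (X (τ k) ω) : ℝ) :=
    Measurable.const_inner (measurable_incrementSigma hX0 hτ0 k k le_rfl)
  have key := norm_integral_mul_cexp_le hUV hVm hUm hU0 hV0 hv hg hYm
  have e1 : ∀ ω, (inner ℝ u (X (τ k) ω) : ℝ) + U ω = inner ℝ u (X (τ j) ω) := fun ω => by
    simp [U, inner_sub_right]
  simp only [e1] at key
  refine key.trans (le_of_eq ?_)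
  congr 2
  ring

end GaussianLocalTime

end


/-! ### Tail inequalities for sums of adapted variables -/

noncomputable section

namespace GaussianLocalTime

/-! ### Bounded measurable functions -/

/-- `f` is bounded and measurable with respect to `m`. -/
structure BddMeas {Ω : Type*} (m : MeasurableSpace Ω) (f : Ω → ℝ) : Prop where
  measurable : Measurable[m] f
  bdd : ∃ C, ∀ ω, |f ω| ≤ C

namespace BddMeas

variable {Ω : Type*} {m m' : MeasurableSpace Ω} {f g : Ω → ℝ}

theorem mono (hf : BddMeas m f) (h : m ≤ m') : BddMeas m' f := ⟨hf.1.mono h le_rfl, hf.2⟩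

theorem const (c : ℝ) : BddMeas m fun _ => c := ⟨measurable_const, |c|, fun _ => le_rfl⟩

theorem mul (hf : BddMeas m f) (hg : BddMeas m g) : BddMeas m fun ω => f ω * g ω := by
  obtain ⟨C, hC⟩ := hf.2
  obtain ⟨D, hD⟩ := hg.2
  refine ⟨hf.1.mul hg.1, C * D, fun ω => ?_⟩
  rw [abs_mul]
  exact mul_le_mul (hC ω) (hD ω) (abs_nonneg _) ((abs_nonneg _).trans (hC ω))

theorem add (hf : BddMeas m f) (hg : BddMeas m g) : BddMeas m fun ω => f ω + g ω := by
  obtain ⟨C, hC⟩ := hf.2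
  obtain ⟨D, hD⟩ := hg.2
  exact ⟨hf.1.add hg.1, C + D, fun ω => (abs_add_le _ _).trans (add_le_add (hC ω) (hD ω))⟩

theorem neg (hf : BddMeas m f) : BddMeas m fun ω => -f ω := by
  obtain ⟨C, hC⟩ := hf.2
  exact ⟨hf.1.neg, C, fun ω => by rw [abs_neg]; exact hC ω⟩

theorem sub (hf : BddMeas m f) (hg : BddMeas m g) : BddMeas m fun ω => f ω - g ω := by
  simpa only [sub_eq_add_neg] using hf.add hg.neg

theorem abs (hf : BddMeas m f) : BddMeas m fun ω => |f ω| := by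
  obtain ⟨C, hC⟩ := hf.2
  exact ⟨hf.1.abs, C, fun ω => by rw [abs_abs]; exact hC ω⟩

theorem finsetSum {ι : Type*} {s : Finset ι} {f : ι → Ω → ℝ} (hf : ∀ i ∈ s, BddMeas m (f i)) :
    BddMeas m fun ω => ∑ i ∈ s, f i ω := by
  classical
  induction s using Finset.induction_on with
  | empty => simpa using const (m := m) 0
  | insert i s hi ih =>
    simp only [Finset.sum_insert hi]
    exact (hf i (Finset.mem_insert_self i s)).add
      (ih fun j hj => hf j (Finset.mem_insert_of_mem hj))

theorem finsetProd {ι : Type*} {s : Finset ι} {f : ι → Ω → ℝ} (hf : ∀ i ∈ s, BddMeas m (f i)) :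
    BddMeas m fun ω => ∏ i ∈ s, f i ω := by
  classical
  induction s using Finset.induction_on with
  | empty => simpa using const (m := m) 1
  | insert i s hi ih =>
    simp only [Finset.prod_insert hi]
    exact (hf i (Finset.mem_insert_self i s)).mul
      (ih fun j hj => hf j (Finset.mem_insert_of_mem hj))

theorem measurableSet_lt (hf : BddMeas m f) (c : ℝ) : MeasurableSet[m] {ω | c < f ω} :=
  _root_.measurableSet_lt measurable_const hf.1

theorem measurableSet_le (hf : BddMeas m f) (c : ℝ) : MeasurableSet[m] {ω | f ω ≤ c} :=
  _root_.measurableSet_le hf.1 measurable_const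

theorem indicator_one {s : Set Ω} (hs : MeasurableSet[m] s) :
    BddMeas m (s.indicator (1 : Ω → ℝ)) := by
  refine ⟨measurable_one.indicator hs, 1, fun ω => ?_⟩
  by_cases h : ω ∈ s <;> simp [h]

theorem integrable [mΩ : MeasurableSpace Ω] {P : Measure Ω} [IsFiniteMeasure P] (hm : m ≤ mΩ)
    (hf : BddMeas m f) : Integrable f P := by
  obtain ⟨C, hC⟩ := hf.2
  exact Integrable.of_bound (hf.1.mono hm le_rfl).aestronglyMeasurable C
    (Eventually.of_forall fun ω => hC ω)

end BddMeas

/-! ### A John–Nirenberg inequality for sums of adapted variables -/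

section JohnNirenberg

variable {Ω : Type*} [mΩ : MeasurableSpace Ω] {P : Measure Ω} [IsProbabilityMeasure P]
  {F : ℕ → MeasurableSpace Ω} {a b : ℕ → Ω → ℝ} {N : ℕ} {κ M β : ℝ}

/-- Testing against all bounded `F k`-measurable weights `g` expresses conditional expectations:
given `F k`, the remaining sum of the `a i` has mean at most `κ` in absolute value and that of the
`b i` has mean at most `M`. The square of the remaining sum splits into diagonal terms, each at most
`β * b i`, and terms `a i` times the sum after `i`, whose conditional mean is at most `κ`. -/
theorem integral_mul_sq_sub_le (hF : Monotone F) (hFle : ∀ k, F k ≤ mΩ)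
    (ha : ∀ i < N, BddMeas (F (i + 1)) (a i)) (hb : ∀ i < N, BddMeas (F (i + 1)) (b i))
    (hab : ∀ i < N, ∀ ω, |a i ω| ≤ b i ω) (hbβ : ∀ i < N, ∀ ω, b i ω ≤ β) (hκ : 0 ≤ κ)
    (hβ : 0 ≤ β)
    (h1 : ∀ k ≤ N, ∀ g, BddMeas (F k) g →
      |∫ ω, g ω * ∑ i ∈ Finset.Ico k N, a i ω ∂P| ≤ κ * ∫ ω, |g ω| ∂P)
    (h2 : ∀ k ≤ N, ∀ g, BddMeas (F k) g → (∀ ω, 0 ≤ g ω) →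
      ∫ ω, g ω * ∑ i ∈ Finset.Ico k N, b i ω ∂P ≤ M * ∫ ω, g ω ∂P)
    {k : ℕ} (hk : k ≤ N) {g : Ω → ℝ} (hg : BddMeas (F k) g) (hg0 : ∀ ω, 0 ≤ g ω) :
    ∫ ω, g ω * (∑ i ∈ Finset.Ico k N, a i ω) ^ 2 ∂P ≤ (2 * κ + β) * M * ∫ ω, g ω ∂P := by
  have hFm : ∀ {i j}, i ≤ j → F i ≤ F j := fun h => hF h
  have aN : ∀ i < N, BddMeas mΩ (a i) := fun i hi => (ha i hi).mono (hFle _)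
  have bN : ∀ i < N, BddMeas mΩ (b i) := fun i hi => (hb i hi).mono (hFle _)
  have gN : BddMeas mΩ g := hg.mono (hFle _)
  have tele : ∀ p k, k + p = N → ∀ ω, (∑ i ∈ Finset.Ico k N, a i ω) ^ 2 =
      ∑ i ∈ Finset.Ico k N, (a i ω ^ 2 + 2 * (a i ω * ∑ l ∈ Finset.Ico (i + 1) N, a l ω)) := by
    intro p
    induction p with
    | zero => intro k hk ω; simp [← hk]
    | succ p ih =>
      intro k hk ω
      have hkN : k < N := by omega
      rw [Finset.sum_eq_sum_Ico_succ_bot hkN, Finset.sum_eq_sum_Ico_succ_bot hkN,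
        ← ih (k + 1) (by omega) ω]
      ring
  have hT : ∀ i < N, BddMeas mΩ fun ω => ∑ l ∈ Finset.Ico (i + 1) N, a l ω := fun i _ =>
    BddMeas.finsetSum fun l hl => aN l (Finset.mem_Ico.1 hl).2
  have e1 : ∀ ω, g ω * (∑ i ∈ Finset.Ico k N, a i ω) ^ 2 = ∑ i ∈ Finset.Ico k N,
      (g ω * a i ω ^ 2 + 2 * ((g ω * a i ω) * ∑ l ∈ Finset.Ico (i + 1) N, a l ω)) := by
    intro ω
    rw [tele (N - k) k (by omega) ω, Finset.mul_sum]
    exact Finset.sum_congr rfl fun i _ => by ring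
  have i1 : ∀ i < N, Integrable (fun ω => g ω * a i ω ^ 2) P := fun i hi => by
    simpa [pow_two] using (gN.mul ((aN i hi).mul (aN i hi))).integrable le_rfl
  have i2 : ∀ i < N, Integrable
      (fun ω => (g ω * a i ω) * ∑ l ∈ Finset.Ico (i + 1) N, a l ω) P := fun i hi =>
    ((gN.mul (aN i hi)).mul (hT i hi)).integrable le_rfl
  have i3 : ∀ i < N, Integrable (fun ω => g ω * b i ω) P := fun i hi =>
    (gN.mul (bN i hi)).integrable le_rfl
  simp only [e1]
  have i4 : ∀ i ∈ Finset.Ico k N, Integrable (fun ω => g ω * a i ω ^ 2 +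
      2 * ((g ω * a i ω) * ∑ l ∈ Finset.Ico (i + 1) N, a l ω)) P := fun i hi =>
    (i1 i (Finset.mem_Ico.1 hi).2).add ((i2 i (Finset.mem_Ico.1 hi).2).const_mul 2)
  rw [integral_finsetSum _ i4]
  have step : ∀ i ∈ Finset.Ico k N, ∫ ω, (g ω * a i ω ^ 2 +
      2 * ((g ω * a i ω) * ∑ l ∈ Finset.Ico (i + 1) N, a l ω)) ∂P ≤
      (2 * κ + β) * ∫ ω, g ω * b i ω ∂P := by
    intro i hi
    obtain ⟨hki, hiN⟩ := Finset.mem_Ico.1 hi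
    rw [integral_add (i1 i hiN) ((i2 i hiN).const_mul 2), integral_const_mul]
    have s1 : ∫ ω, g ω * a i ω ^ 2 ∂P ≤ β * ∫ ω, g ω * b i ω ∂P := by
      rw [← integral_const_mul]
      refine integral_mono (i1 i hiN) ((i3 i hiN).const_mul β) fun ω => ?_
      have : a i ω ^ 2 ≤ β * b i ω := by
        rw [← sq_abs, pow_two]
        exact mul_le_mul ((hab i hiN ω).trans (hbβ i hiN ω)) (hab i hiN ω) (abs_nonneg _) hβ
      calc g ω * a i ω ^ 2 ≤ g ω * (β * b i ω) := mul_le_mul_of_nonneg_left this (hg0 ω)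
        _ = β * (g ω * b i ω) := by ring
    -- `g * a i` is measurable at time `i + 1`, hence an admissible weight for the tail that starts
    -- there.
    have s2 : ∫ ω, (g ω * a i ω) * ∑ l ∈ Finset.Ico (i + 1) N, a l ω ∂P ≤
        κ * ∫ ω, g ω * b i ω ∂P := by
      refine (le_abs_self _).trans ((h1 (i + 1) hiN _
        ((hg.mono (hFm (by omega))).mul (ha i hiN))).trans ?_)
      refine mul_le_mul_of_nonneg_left (integral_mono
        ((gN.mul (aN i hiN)).abs.integrable le_rfl) (i3 i hiN) fun ω => ?_) hκ
      simp only [abs_mul, abs_of_nonneg (hg0 ω)]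
      exact mul_le_mul_of_nonneg_left (hab i hiN ω) (hg0 ω)
    linarith
  refine (Finset.sum_le_sum step).trans ?_
  rw [← Finset.mul_sum, ← integral_finsetSum _ fun i hi => i3 i (Finset.mem_Ico.1 hi).2]
  have h3 := h2 k hk g hg hg0
  simp only [Finset.mul_sum] at h3
  calc (2 * κ + β) * ∫ ω, ∑ i ∈ Finset.Ico k N, g ω * b i ω ∂P
      ≤ (2 * κ + β) * (M * ∫ ω, g ω ∂P) := mul_le_mul_of_nonneg_left h3 (by positivity)
    _ = _ := by ring

/-- The set where some partial sum of the `a i` with at most `N` terms exceeds `l` in absolute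
value. -/
def maxExceeds (a : ℕ → Ω → ℝ) (N : ℕ) (l : ℝ) : Set Ω :=
  {ω | ∃ k ≤ N, l < |∑ i ∈ Finset.range k, a i ω|}

/-- `k` is the first time when the partial sum exceeds `l` in absolute value. -/
def firstExceeds (a : ℕ → Ω → ℝ) (l : ℝ) (k : ℕ) : Set Ω :=
  {ω | l < |∑ i ∈ Finset.range k, a i ω|} ∩
    ⋂ j ∈ Finset.range k, {ω | |∑ i ∈ Finset.range j, a i ω| ≤ l}

omit mΩ in
theorem maxExceeds_eq_biUnion (a : ℕ → Ω → ℝ) (N : ℕ) (l : ℝ) :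
    maxExceeds a N l = ⋃ k ∈ Finset.range (N + 1), firstExceeds a l k := by
  classical
  ext ω
  simp only [maxExceeds, firstExceeds, mem_ofPred_eq, mem_iUnion, Finset.mem_range, mem_inter_iff,
    mem_iInter, exists_prop]
  constructor
  · intro h
    have h' : ∃ k, l < |∑ i ∈ Finset.range k, a i ω| := by
      obtain ⟨k, _, hk⟩ := h; exact ⟨k, hk⟩
    refine ⟨Nat.find h', ?_, Nat.find_spec h', fun j hj => not_lt.1 (Nat.find_min h' hj)⟩
    obtain ⟨k, hkN, hk⟩ := h
    exact Nat.lt_succ_of_le ((Nat.find_min' h' hk).trans hkN)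
  · rintro ⟨k, hk, h1, _⟩
    exact ⟨k, by omega, h1⟩

omit mΩ in
theorem pairwiseDisjoint_firstExceeds (a : ℕ → Ω → ℝ) (l : ℝ) (s : Set ℕ) :
    s.PairwiseDisjoint (firstExceeds a l) := by
  have key : ∀ i j, i < j → Disjoint (firstExceeds a l i) (firstExceeds a l j) := by
    intro i j hij
    rw [Set.disjoint_left]
    rintro ω ⟨h1, _⟩ ⟨_, h2⟩
    simp only [mem_iInter, Finset.mem_range, mem_ofPred_eq] at h1 h2
    exact absurd (h2 i hij) (not_le.2 h1)
  intro i _ j _ hij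
  rcases lt_or_gt_of_ne hij with h | h
  · exact key i j h
  · exact (key j i h).symm

omit mΩ in
theorem measurableSet_firstExceeds (hF : Monotone F) (ha : ∀ i < N, BddMeas (F (i + 1)) (a i))
    (l : ℝ) {k : ℕ} (hk : k ≤ N) : MeasurableSet[F k] (firstExceeds a l k) := by
  have hS : ∀ j ≤ k, BddMeas (F k) fun ω => |∑ i ∈ Finset.range j, a i ω| := fun j hj =>
    (BddMeas.finsetSum (m := F k) (s := Finset.range j) (f := a) fun i hi =>
      (ha i (by have := Finset.mem_range.1 hi; omega)).mono
        (hF (by have := Finset.mem_range.1 hi; omega))).abs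
  refine MeasurableSet.inter ((hS k le_rfl).measurableSet_lt l) ?_
  refine Finset.measurableSet_biInter _ fun j hj => ?_
  exact (hS j (Finset.mem_range.1 hj).le).measurableSet_le l

/-- By Chebyshev with the conditional second moment `K ^ 2`, after the first exceedance of a level
the sum moves by more than `2 * K` with conditional probability at most 1/4. If the higher level is
reached, then either the sum moves that far after reaching it, or its final value is still so large
that it moved that far after the first exceedance of `l`. With p and p' for the two exceedance
probabilities, p' ≤ p'/4 + p/4, more than enough for p' ≤ p/2. -/
theorem measureReal_maxExceeds_le (hF : Monotone F) (hFle : ∀ k, F k ≤ mΩ)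
    (ha : ∀ i < N, BddMeas (F (i + 1)) (a i)) (hb : ∀ i < N, BddMeas (F (i + 1)) (b i))
    (hab : ∀ i < N, ∀ ω, |a i ω| ≤ b i ω) (hbβ : ∀ i < N, ∀ ω, b i ω ≤ β) (hκ : 0 ≤ κ)
    (hβ : 0 ≤ β)
    (h1 : ∀ k ≤ N, ∀ g, BddMeas (F k) g →
      |∫ ω, g ω * ∑ i ∈ Finset.Ico k N, a i ω ∂P| ≤ κ * ∫ ω, |g ω| ∂P)
    (h2 : ∀ k ≤ N, ∀ g, BddMeas (F k) g → (∀ ω, 0 ≤ g ω) →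
      ∫ ω, g ω * ∑ i ∈ Finset.Ico k N, b i ω ∂P ≤ M * ∫ ω, g ω ∂P)
    {K : ℝ} (hK : 0 < K) (hKM : (2 * κ + β) * M ≤ K ^ 2) {l : ℝ} (hl : 0 ≤ l) :
    P.real (maxExceeds a N (l + β + 4 * K)) ≤ 1 / 2 * P.real (maxExceeds a N l) := by
  let S : ℕ → Ω → ℝ := fun k ω => ∑ i ∈ Finset.range k, a i ω
  have hsub : ∀ k ≤ N, ∀ ω, S N ω - S k ω = ∑ i ∈ Finset.Ico k N, a i ω := fun k hk ω =>
    (Finset.sum_Ico_eq_sub _ hk).symm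
  have aN : ∀ i < N, BddMeas mΩ (a i) := fun i hi => (ha i hi).mono (hFle _)
  -- Decomposing by the first exceedance time makes the Chebyshev weight, an indicator, measurable
  -- with respect to `F k`.
  let D : ℝ → Set Ω := fun l => ⋃ k ∈ Finset.range (N + 1),
    firstExceeds a l k ∩ {ω | 2 * K < |S N ω - S k ω|}
  have hfm : ∀ l, ∀ k ∈ Finset.range (N + 1), MeasurableSet (firstExceeds a l k) := fun l k hk =>
    hFle k _ (measurableSet_firstExceeds hF ha l (by have := Finset.mem_range.1 hk; omega))
  have hA : ∀ l, P.real (maxExceeds a N l) =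
      ∑ k ∈ Finset.range (N + 1), P.real (firstExceeds a l k) := fun l => by
    rw [maxExceeds_eq_biUnion, measureReal_biUnion_finset (pairwiseDisjoint_firstExceeds a l _)
      (hfm l)]
  have hD : ∀ l, P.real (D l) ≤ 1 / 4 * P.real (maxExceeds a N l) := by
    intro l
    rw [hA, Finset.mul_sum]
    refine (measureReal_biUnion_finset_le _ _).trans (Finset.sum_le_sum fun k hk => ?_)
    have hkN : k ≤ N := by have := Finset.mem_range.1 hk; omega
    have hE := measurableSet_firstExceeds hF ha l hkN
    have hEm := hfm l k hk
    have hg := BddMeas.indicator_one hE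
    have key := integral_mul_sq_sub_le hF hFle ha hb hab hbβ hκ hβ h1 h2 hkN hg fun ω =>
      indicator_nonneg (fun _ _ => zero_le_one) ω
    rw [integral_indicator_one hEm] at key
    have hYb : BddMeas mΩ fun ω => S N ω - S k ω := by
      simp only [hsub k hkN]
      exact BddMeas.finsetSum fun i hi => aN i (Finset.mem_Ico.1 hi).2
    have hY := hYb.measurable
    have hBm : MeasurableSet (firstExceeds a l k ∩ {ω | 2 * K < |S N ω - S k ω|}) :=
      hEm.inter (measurableSet_lt measurable_const hY.abs)
    have h4 : (4 * K ^ 2) * P.real (firstExceeds a l k ∩ {ω | 2 * K < |S N ω - S k ω|}) ≤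
        K ^ 2 * P.real (firstExceeds a l k) := by
      refine le_trans ?_ (key.trans (mul_le_mul_of_nonneg_right hKM measureReal_nonneg))
      rw [← integral_indicator_one hBm, ← integral_const_mul]
      refine integral_mono ((BddMeas.indicator_one hBm).integrable le_rfl |>.const_mul _) ?_
        fun ω => ?_
      · have := ((hg.mono (hFle k)).mul (hYb.mul hYb)).integrable (P := P) le_rfl
        simpa only [hsub k hkN, ← pow_two] using this
      · by_cases hω : ω ∈ firstExceeds a l k ∩ {ω | 2 * K < |S N ω - S k ω|}
        · rw [indicator_of_mem hω]
          dsimp only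
          rw [indicator_of_mem hω.1, Pi.one_apply, one_mul, ← hsub k hkN, mul_one, ← sq_abs (S N ω - S k ω)]
          have : 2 * K < |S N ω - S k ω| := hω.2
          nlinarith
        · rw [indicator_of_notMem hω, mul_zero]
          exact mul_nonneg (indicator_nonneg (fun _ _ => zero_le_one) ω) (sq_nonneg _)
    have hK2 : 0 < K ^ 2 := by positivity
    have h5 : K ^ 2 * (4 * P.real (firstExceeds a l k ∩ {ω | 2 * K < |S N ω - S k ω|})) ≤
        K ^ 2 * P.real (firstExceeds a l k) := by linarith
    have := le_of_mul_le_mul_left h5 hK2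
    linarith
  -- At the first exceedance the sum is at most `l + β`, since one step is at most `β`; index 0 is
  -- excluded because the empty sum is 0 and `l` is nonnegative.
  have hB : {ω | l + β + 2 * K < |S N ω|} ⊆ D l := by
    intro ω hω
    have hω' : l + β + 2 * K < |S N ω| := hω
    have : ω ∈ maxExceeds a N l := ⟨N, le_rfl, by
      change l < |S N ω|; linarith⟩
    rw [maxExceeds_eq_biUnion] at this
    obtain ⟨k, hk, hkω⟩ := mem_iUnion₂.1 this
    refine mem_iUnion₂.2 ⟨k, hk, hkω, ?_⟩
    have hSk : |S k ω| ≤ l + β := by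
      obtain ⟨h3, h4⟩ := hkω
      rcases k with _ | k
      · simp at h3; linarith
      · have h5 : |S k ω| ≤ l := by
          have := mem_iInter₂.1 h4 k (Finset.mem_range.2 (Nat.lt_succ_self k))
          exact this
        have h6 : S (k + 1) ω = S k ω + a k ω := Finset.sum_range_succ _ _
        have hkN : k < N := by have := Finset.mem_range.1 hk; omega
        rw [h6]
        exact (abs_add_le _ _).trans (add_le_add h5 ((hab k hkN ω).trans (hbβ k hkN ω)))
    have : |S N ω| ≤ |S N ω - S k ω| + |S k ω| := by
      simpa using abs_add_le (S N ω - S k ω) (S k ω)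
    change 2 * K < |S N ω - S k ω|
    linarith
  have hC : maxExceeds a N (l + β + 4 * K) ⊆
      D (l + β + 4 * K) ∪ {ω | l + β + 2 * K < |S N ω|} := by
    intro ω hω
    rw [maxExceeds_eq_biUnion] at hω
    obtain ⟨k, hk, hkω⟩ := mem_iUnion₂.1 hω
    by_cases hS : 2 * K < |S N ω - S k ω|
    · exact Or.inl (mem_iUnion₂.2 ⟨k, hk, hkω, hS⟩)
    · right
      have h3 : l + β + 4 * K < |S k ω| := hkω.1
      have : |S k ω| ≤ |S N ω - S k ω| + |S N ω| := by
        have := abs_sub_abs_le_abs_sub (S k ω) (S N ω)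
        rw [abs_sub_comm] at this
        linarith
      change l + β + 2 * K < |S N ω|
      linarith [not_lt.1 hS]
  have h6 : P.real (maxExceeds a N (l + β + 4 * K)) ≤
      P.real (D (l + β + 4 * K)) + P.real (D l) :=
    (measureReal_mono hC).trans ((measureReal_union_le _ _).trans
      (add_le_add le_rfl (measureReal_mono hB (measure_ne_top _ _))))
  have := hD l
  have := hD (l + β + 4 * K)
  have := measureReal_nonneg (μ := P) (s := maxExceeds a N l)
  linarith

/-- **John–Nirenberg inequality**: exponential tails for the maximum of the partial sums. -/
theorem measureReal_maxExceeds_le_pow (hF : Monotone F) (hFle : ∀ k, F k ≤ mΩ)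
    (ha : ∀ i < N, BddMeas (F (i + 1)) (a i)) (hb : ∀ i < N, BddMeas (F (i + 1)) (b i))
    (hab : ∀ i < N, ∀ ω, |a i ω| ≤ b i ω) (hbβ : ∀ i < N, ∀ ω, b i ω ≤ β) (hκ : 0 ≤ κ)
    (hβ : 0 ≤ β)
    (h1 : ∀ k ≤ N, ∀ g, BddMeas (F k) g →
      |∫ ω, g ω * ∑ i ∈ Finset.Ico k N, a i ω ∂P| ≤ κ * ∫ ω, |g ω| ∂P)
    (h2 : ∀ k ≤ N, ∀ g, BddMeas (F k) g → (∀ ω, 0 ≤ g ω) →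
      ∫ ω, g ω * ∑ i ∈ Finset.Ico k N, b i ω ∂P ≤ M * ∫ ω, g ω ∂P)
    {K B : ℝ} (hK : 0 < K) (hKM : (2 * κ + β) * M ≤ K ^ 2) (hB : β + 4 * K ≤ B) (j : ℕ) :
    P.real (maxExceeds a N ((j + 1) * B)) ≤
      (1 / 2) ^ j * (B⁻¹ * ∫ ω, ∑ i ∈ Finset.range N, b i ω ∂P) := by
  have hB0 : 0 < B := by linarith
  -- The base case is Markov's inequality instead of the trivial bound 1: the factor `∫ ∑ b i` is
  -- what makes the estimate integrable over the space variable.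
  induction j with
  | zero =>
    have hbN : BddMeas mΩ fun ω => ∑ i ∈ Finset.range N, b i ω := BddMeas.finsetSum fun i hi =>
      (hb i (Finset.mem_range.1 hi)).mono (hFle _)
    have hb0 : ∀ i < N, ∀ ω, 0 ≤ b i ω := fun i hi ω => (abs_nonneg _).trans (hab i hi ω)
    have hsub : maxExceeds a N B ⊆ {ω | B ≤ ∑ i ∈ Finset.range N, b i ω} := by
      rintro ω ⟨k, hk, hkω⟩
      refine hkω.le.trans ((Finset.abs_sum_le_sum_abs _ _).trans ?_)
      refine (Finset.sum_le_sum fun i hi => hab i ?_ ω).trans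
        (Finset.sum_le_sum_of_subset_of_nonneg (Finset.range_mono hk) fun i hi _ =>
          hb0 i (Finset.mem_range.1 hi) ω)
      have := Finset.mem_range.1 hi; omega
    have hmk := mul_meas_ge_le_integral_of_nonneg (μ := P)
      (Eventually.of_forall fun ω => Finset.sum_nonneg fun i hi =>
        hb0 i (Finset.mem_range.1 hi) ω) (hbN.integrable le_rfl) B
    simp only [CharP.cast_eq_zero, zero_add, one_mul, pow_zero]
    rw [le_inv_mul_iff₀ hB0]
    exact (mul_le_mul_of_nonneg_left (measureReal_mono hsub) hB0.le).trans hmk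
  | succ j ih =>
    have h3 := measureReal_maxExceeds_le hF hFle ha hb hab hbβ hκ hβ h1 h2 hK hKM
      (l := (j + 1) * B) (by positivity)
    have hsub : maxExceeds a N (((j + 1 : ℕ) + 1) * B) ⊆
        maxExceeds a N ((j + 1) * B + β + 4 * K) := by
      rintro ω ⟨k, hk, hkω⟩
      refine ⟨k, hk, lt_of_le_of_lt ?_ hkω⟩
      push_cast
      linarith
    refine (measureReal_mono hsub).trans (h3.trans ?_)
    rw [pow_succ]
    linarith

end JohnNirenberg

/-! ### Exponential moments of additive functionals -/

section Khasminskii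

/-- Expansion according to the smallest index at which the term `y i` is chosen. -/
theorem prod_Ico_one_add_eq (y : ℕ → ℝ) (p k : ℕ) :
    ∏ i ∈ Finset.Ico k (k + p), (1 + y i) =
      1 + ∑ i ∈ Finset.Ico k (k + p), y i * ∏ l ∈ Finset.Ico (i + 1) (k + p), (1 + y l) := by
  induction p generalizing k with
  | zero => simp
  | succ p ih =>
    have hk : k < k + (p + 1) := by omega
    have e : k + (p + 1) = (k + 1) + p := by omega
    rw [Finset.prod_eq_prod_Ico_succ_bot hk, Finset.sum_eq_sum_Ico_succ_bot hk, e, ih (k + 1)]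
    ring

variable {Ω : Type*} [mΩ : MeasurableSpace Ω] {P : Measure Ω} [IsProbabilityMeasure P]
  {F : ℕ → MeasurableSpace Ω} {x : ℕ → Ω → ℝ} {n G : ℕ} {M l : ℝ}

/-- Inside one block: after the first chosen factor the remaining product has conditional mean at
most 2 by induction, so the total is at most 1 + 2 l M ≤ 2. -/
theorem integral_mul_prod_le_two_mul (hF : Monotone F) (hFle : ∀ k, F k ≤ mΩ)
    (hx : ∀ i < n, BddMeas (F (i + 1)) (x i)) (hx0 : ∀ i < n, ∀ ω, 0 ≤ x i ω) (hl : 0 ≤ l)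
    (hlM : l * M ≤ 1 / 2)
    (h : ∀ k p, p ≤ G → k + p ≤ n → ∀ g, BddMeas (F k) g → (∀ ω, 0 ≤ g ω) →
      ∫ ω, g ω * ∑ i ∈ Finset.Ico k (k + p), x i ω ∂P ≤ M * ∫ ω, g ω ∂P)
    (p : ℕ) (hp : p ≤ G) (k : ℕ) (hk : k + p ≤ n) {g : Ω → ℝ} (hg : BddMeas (F k) g)
    (hg0 : ∀ ω, 0 ≤ g ω) :
    ∫ ω, g ω * ∏ i ∈ Finset.Ico k (k + p), (1 + l * x i ω) ∂P ≤ 2 * ∫ ω, g ω ∂P := by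
  induction p using Nat.strong_induction_on generalizing k g with
  | _ p ih =>
    have xN : ∀ i < n, BddMeas mΩ (x i) := fun i hi => (hx i hi).mono (hFle _)
    have gN := hg.mono (hFle k)
    have hprod : ∀ i, BddMeas mΩ fun ω => ∏ j ∈ Finset.Ico i (k + p), (1 + l * x j ω) :=
      fun i => BddMeas.finsetProd fun j hj => (BddMeas.const 1).add
        ((BddMeas.const l).mul (xN j (by have := Finset.mem_Ico.1 hj; omega)))
    have e : ∀ ω, g ω * ∏ i ∈ Finset.Ico k (k + p), (1 + l * x i ω) = g ω +
        ∑ i ∈ Finset.Ico k (k + p),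
          l * ((g ω * x i ω) * ∏ j ∈ Finset.Ico (i + 1) (k + p), (1 + l * x j ω)) := by
      intro ω
      rw [prod_Ico_one_add_eq (fun i => l * x i ω), mul_add, mul_one, Finset.mul_sum]
      congr 1
      exact Finset.sum_congr rfl fun i _ => by ring
    have i1 : ∀ i ∈ Finset.Ico k (k + p), Integrable (fun ω =>
        l * ((g ω * x i ω) * ∏ j ∈ Finset.Ico (i + 1) (k + p), (1 + l * x j ω))) P := fun i hi =>
      (((gN.mul (xN i (by have := Finset.mem_Ico.1 hi; omega))).mul
        (hprod (i + 1))).integrable le_rfl).const_mul l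
    simp only [e]
    rw [integral_add (gN.integrable le_rfl) (integrable_finsetSum _ i1), integral_finsetSum _ i1]
    have step : ∀ i ∈ Finset.Ico k (k + p), ∫ ω,
        l * ((g ω * x i ω) * ∏ j ∈ Finset.Ico (i + 1) (k + p), (1 + l * x j ω)) ∂P ≤
        2 * l * ∫ ω, g ω * x i ω ∂P := by
      intro i hi
      obtain ⟨hki, hip⟩ := Finset.mem_Ico.1 hi
      rw [integral_const_mul]
      have hq := ih (k + p - (i + 1)) (by omega) (by omega) (i + 1) (by omega)
        ((hg.mono (hF (by omega : k ≤ i + 1))).mul (hx i (by omega)))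
        fun ω => mul_nonneg (hg0 ω) (hx0 i (by omega) ω)
      rw [show i + 1 + (k + p - (i + 1)) = k + p by omega] at hq
      calc l * _ ≤ l * (2 * ∫ ω, g ω * x i ω ∂P) := mul_le_mul_of_nonneg_left hq hl
        _ = _ := by ring
    have hsum := Finset.sum_le_sum step
    have h3 := h k p hp hk g hg hg0
    simp only [Finset.mul_sum] at h3
    rw [integral_finsetSum _ fun i hi => (gN.mul
      (xN i (by have := Finset.mem_Ico.1 hi; omega))).integrable le_rfl] at h3
    rw [← Finset.mul_sum] at hsum
    have h4 : 0 ≤ ∫ ω, g ω ∂P := integral_nonneg hg0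
    have h5 := mul_le_mul_of_nonneg_left h3 (by positivity : 0 ≤ 2 * l)
    have h6 := mul_le_mul_of_nonneg_right hlM h4
    nlinarith

/-- Each block costs a factor 2: the product over the first block times `g` is an admissible weight
for the following blocks. -/
theorem integral_mul_prod_le_two_pow (hF : Monotone F) (hFle : ∀ k, F k ≤ mΩ)
    (hx : ∀ i < n, BddMeas (F (i + 1)) (x i)) (hx0 : ∀ i < n, ∀ ω, 0 ≤ x i ω) (hl : 0 ≤ l)
    (hlM : l * M ≤ 1 / 2)
    (h : ∀ k p, p ≤ G → k + p ≤ n → ∀ g, BddMeas (F k) g → (∀ ω, 0 ≤ g ω) →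
      ∫ ω, g ω * ∑ i ∈ Finset.Ico k (k + p), x i ω ∂P ≤ M * ∫ ω, g ω ∂P)
    (m p : ℕ) (hp : p ≤ m * G) (k : ℕ) (hk : k + p ≤ n) {g : Ω → ℝ} (hg : BddMeas (F k) g)
    (hg0 : ∀ ω, 0 ≤ g ω) :
    ∫ ω, g ω * ∏ i ∈ Finset.Ico k (k + p), (1 + l * x i ω) ∂P ≤ 2 ^ m * ∫ ω, g ω ∂P := by
  induction m generalizing p k g with
  | zero =>
    have : p = 0 := by omega
    subst this
    simp
  | succ m ih =>
    have h0 : 0 ≤ ∫ ω, g ω ∂P := integral_nonneg hg0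
    rcases le_total p G with hpG | hpG
    · refine (integral_mul_prod_le_two_mul hF hFle hx hx0 hl hlM h p hpG k hk hg hg0).trans ?_
      have : (1 : ℝ) ≤ 2 ^ m := one_le_pow₀ (by norm_num)
      rw [pow_succ]
      nlinarith
    · have hg1 : BddMeas (F (k + G))
          fun ω => g ω * ∏ i ∈ Finset.Ico k (k + G), (1 + l * x i ω) := by
        refine (hg.mono (hF (by omega))).mul (BddMeas.finsetProd fun j hj => ?_)
        have := Finset.mem_Ico.1 hj
        exact (BddMeas.const 1).add ((BddMeas.const l).mul
          ((hx j (by omega)).mono (hF (by omega))))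
      have h1 := ih (p - G) (by rw [Nat.succ_mul] at hp; omega) (k + G) (by omega) hg1 fun ω =>
        mul_nonneg (hg0 ω) (Finset.prod_nonneg fun i hi => by
          have := hx0 i (by have := Finset.mem_Ico.1 hi; omega) ω
          positivity)
      have h2 := integral_mul_prod_le_two_mul hF hFle hx hx0 hl hlM h G le_rfl k (by omega) hg hg0
      have e : ∀ ω, g ω * ∏ i ∈ Finset.Ico k (k + p), (1 + l * x i ω) =
          g ω * (∏ i ∈ Finset.Ico k (k + G), (1 + l * x i ω)) *
            ∏ i ∈ Finset.Ico (k + G) (k + G + (p - G)), (1 + l * x i ω) := by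
        intro ω
        rw [mul_assoc, Finset.prod_Ico_consecutive _ (by omega) (by omega),
          show k + G + (p - G) = k + p by omega]
      simp only [e]
      refine h1.trans ?_
      rw [pow_succ, mul_assoc]
      exact mul_le_mul_of_nonneg_left h2 (by positivity)

/-- **Khasminskii's lemma**, over `m` blocks of length `G`, in the form of a tail bound. -/
theorem measureReal_lt_sum_le (hF : Monotone F) (hFle : ∀ k, F k ≤ mΩ)
    (hx : ∀ i < n, BddMeas (F (i + 1)) (x i)) (hx0 : ∀ i < n, ∀ ω, 0 ≤ x i ω) (hl : 0 < l)
    (hlM : l * M ≤ 1 / 2) (hlx : ∀ i < n, ∀ ω, l * x i ω ≤ 1)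
    (h : ∀ k p, p ≤ G → k + p ≤ n → ∀ g, BddMeas (F k) g → (∀ ω, 0 ≤ g ω) →
      ∫ ω, g ω * ∑ i ∈ Finset.Ico k (k + p), x i ω ∂P ≤ M * ∫ ω, g ω ∂P)
    {m : ℕ} (hm : 1 ≤ m) (hn : n ≤ m * G) :
    P.real {ω | 4 * m / l < ∑ i ∈ Finset.range n, x i ω} ≤
      2 * l * Real.exp (-m) * ∫ ω, ∑ i ∈ Finset.range n, x i ω ∂P := by
  have xN : ∀ i < n, BddMeas mΩ (x i) := fun i hi => (hx i hi).mono (hFle _)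
  have hprod : ∀ i, BddMeas mΩ fun ω => ∏ j ∈ Finset.Ico i n, (1 + l * x j ω) :=
    fun i => BddMeas.finsetProd fun j hj => (BddMeas.const 1).add
      ((BddMeas.const l).mul (xN j (by have := Finset.mem_Ico.1 hj; omega)))
  -- Subtracting 1 from the product keeps the expectation of the sum as a factor, needed for
  -- integration over space.
  have e : ∀ ω, ∏ i ∈ Finset.Ico 0 n, (1 + l * x i ω) - 1 =
      ∑ i ∈ Finset.Ico 0 n, l * (x i ω * ∏ j ∈ Finset.Ico (i + 1) n, (1 + l * x j ω)) := by
    intro ω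
    have := prod_Ico_one_add_eq (fun i => l * x i ω) n 0
    rw [zero_add] at this
    rw [this, add_sub_cancel_left]
    exact Finset.sum_congr rfl fun i _ => by ring
  have i1 : ∀ i ∈ Finset.Ico 0 n, Integrable (fun ω =>
      l * (x i ω * ∏ j ∈ Finset.Ico (i + 1) n, (1 + l * x j ω))) P := fun i hi =>
    (((xN i (Finset.mem_Ico.1 hi).2).mul (hprod (i + 1))).integrable le_rfl).const_mul l
  have hE : ∫ ω, (∏ i ∈ Finset.Ico 0 n, (1 + l * x i ω) - 1) ∂P ≤
      l * 2 ^ m * ∫ ω, ∑ i ∈ Finset.range n, x i ω ∂P := by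
    simp only [e]
    rw [integral_finsetSum _ i1, integral_finsetSum _ fun i hi =>
      (xN i (Finset.mem_range.1 hi)).integrable le_rfl, Finset.mul_sum, Finset.range_eq_Ico]
    refine Finset.sum_le_sum fun i hi => ?_
    have hin := (Finset.mem_Ico.1 hi).2
    rw [integral_const_mul, mul_assoc]
    have := integral_mul_prod_le_two_pow hF hFle hx hx0 hl.le hlM h m (n - (i + 1)) (by omega)
      (i + 1) (by omega) (hx i hin) (hx0 i hin)
    rw [show i + 1 + (n - (i + 1)) = n by omega] at this
    exact mul_le_mul_of_nonneg_left this hl.le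
  have hone : ∀ ω, 0 ≤ ∏ i ∈ Finset.Ico 0 n, (1 + l * x i ω) - 1 := by
    intro ω
    rw [e]
    refine Finset.sum_nonneg fun i hi => mul_nonneg hl.le
      (mul_nonneg (hx0 i (Finset.mem_Ico.1 hi).2 ω) (Finset.prod_nonneg fun j hj => ?_))
    have := hx0 j (Finset.mem_Ico.1 hj).2 ω
    positivity
  -- Since `l * x i ≤ 1`, exp (l x / 2) ≤ 1 + l x. A sum above 4m / l thus makes the product at
  -- least e^(2m), and after subtracting 1 at least half of that remains.
  have hsub : {ω | 4 * m / l < ∑ i ∈ Finset.range n, x i ω} ⊆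
      {ω | Real.exp (2 * m) / 2 ≤ ∏ i ∈ Finset.Ico 0 n, (1 + l * x i ω) - 1} := by
    intro ω hω
    have hω' : 4 * m / l < ∑ i ∈ Finset.range n, x i ω := hω
    rw [div_lt_iff₀ hl] at hω'
    have h3 : Real.exp (∑ i ∈ Finset.Ico 0 n, l * x i ω / 2) ≤
        ∏ i ∈ Finset.Ico 0 n, (1 + l * x i ω) := by
      rw [Real.exp_sum]
      refine Finset.prod_le_prod (fun i _ => (Real.exp_pos _).le) fun i hi => ?_
      have hi' := (Finset.mem_Ico.1 hi).2
      have h4 := mul_nonneg hl.le (hx0 i hi' ω)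
      have h5 := hlx i hi' ω
      have h6 := Real.abs_exp_sub_one_sub_id_le (x := l * x i ω / 2)
        (by rw [abs_of_nonneg (by linarith)]; linarith)
      have := (abs_le.1 h6).2
      nlinarith
    have h4 : (2 * m : ℝ) ≤ ∑ i ∈ Finset.Ico 0 n, l * x i ω / 2 := by
      rw [← Finset.sum_div, ← Finset.mul_sum, ← Finset.range_eq_Ico]
      linarith
    have h5 := (Real.exp_le_exp.2 h4).trans h3
    have h6 : 2 ≤ Real.exp (2 * m) := by
      have : (1 : ℝ) ≤ m := by exact_mod_cast hm
      have := Real.add_one_le_exp (2 * m : ℝ)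
      linarith
    change Real.exp (2 * m) / 2 ≤ _
    linarith
  have hmk := mul_meas_ge_le_integral_of_nonneg (μ := P) (Eventually.of_forall hone)
    (((hprod 0).sub (BddMeas.const 1)).integrable le_rfl) (Real.exp (2 * m) / 2)
  have h7 := (mul_le_mul_of_nonneg_left (measureReal_mono (μ := P) hsub)
    (by positivity : 0 ≤ Real.exp (2 * m) / 2)).trans (hmk.trans hE)
  -- The 2^m from the `m` blocks is at most e^m, which leaves e^(-m) out of e^(-2m).
  have h8 : (2 : ℝ) ^ m ≤ Real.exp m := by
    have h9 : (2 : ℝ) ≤ Real.exp 1 := by have := Real.add_one_le_exp (1 : ℝ); linarith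
    calc (2 : ℝ) ^ m ≤ Real.exp 1 ^ m := pow_le_pow_left₀ (by norm_num) h9 m
      _ = Real.exp m := by rw [← Real.exp_nat_mul, mul_one]
  have hI : 0 ≤ ∫ ω, ∑ i ∈ Finset.range n, x i ω ∂P := integral_nonneg fun ω =>
    Finset.sum_nonneg fun i hi => hx0 i (Finset.mem_range.1 hi) ω
  have h10 : Real.exp (2 * m) = Real.exp m * Real.exp m := by rw [← Real.exp_add]; ring_nf
  rw [h10] at h7
  rw [Real.exp_neg]
  have hem := Real.exp_pos (m : ℝ)
  have h11 : Real.exp m * Real.exp m / 2 *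
      P.real {ω | 4 * m / l < ∑ i ∈ Finset.range n, x i ω} ≤
      l * Real.exp m * ∫ ω, ∑ i ∈ Finset.range n, x i ω ∂P := by
    refine h7.trans (mul_le_mul_of_nonneg_right (mul_le_mul_of_nonneg_left h8 hl.le) hI)
  have h12 : Real.exp m * (Real.exp m *
      P.real {ω | 4 * m / l < ∑ i ∈ Finset.range n, x i ω}) ≤
      Real.exp m * (2 * l * ∫ ω, ∑ i ∈ Finset.range n, x i ω ∂P) := by linarith
  have h13 := le_of_mul_le_mul_left h12 hem
  have h14 := (le_div_iff₀' hem).2 h13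
  refine h14.trans (le_of_eq ?_)
  rw [div_eq_mul_inv]; ring

end Khasminskii

end GaussianLocalTime

end


noncomputable section

namespace GaussianLocalTime

/-! ### The Gaussian kernel -/

section Kernel

variable {d : ℕ}

/-- The Gaussian probability density with characteristic function `exp (-ε² |v|²)`. -/
def kernel (ε : ℝ) (w : E d) : ℝ :=
  ((√(4 * Real.pi) * ε) ^ d)⁻¹ * Real.exp (-(‖w‖ / (2 * ε)) ^ 2)

theorem one_le_sqrt_four_mul_pi : 1 ≤ √(4 * Real.pi) := by
  rw [Real.one_le_sqrt]
  linarith [Real.pi_gt_three]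

theorem kernel_nonneg {ε : ℝ} (hε : 0 < ε) (w : E d) : 0 ≤ kernel ε w := by
  unfold kernel; positivity

theorem continuous_kernel (ε : ℝ) : Continuous (kernel ε : E d → ℝ) := by
  unfold kernel; fun_prop

theorem inv_pow_sqrt_mul_le {ε : ℝ} (hε : 0 < ε) : ((√(4 * Real.pi) * ε) ^ d)⁻¹ ≤ (ε ^ d)⁻¹ := by
  have : ε ≤ √(4 * Real.pi) * ε := le_mul_of_one_le_left hε.le one_le_sqrt_four_mul_pi
  gcongr

theorem kernel_le {ε : ℝ} (hε : 0 < ε) (w : E d) : kernel ε w ≤ (ε ^ d)⁻¹ := by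
  have h1 : Real.exp (-(‖w‖ / (2 * ε)) ^ 2) ≤ 1 := Real.exp_le_one_iff.2 (by
    have := sq_nonneg (‖w‖ / (2 * ε)); linarith)
  calc kernel ε w ≤ ((√(4 * Real.pi) * ε) ^ d)⁻¹ * 1 := by unfold kernel; gcongr
    _ ≤ (ε ^ d)⁻¹ := by rw [mul_one]; exact inv_pow_sqrt_mul_le hε

theorem abs_exp_neg_sq_sub_le (s t : ℝ) : |Real.exp (-t ^ 2) - Real.exp (-s ^ 2)| ≤ |t - s| := by
  have hd : ∀ x ∈ (univ : Set ℝ), HasDerivWithinAt (fun x : ℝ => Real.exp (-x ^ 2))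
      (Real.exp (-x ^ 2) * (-(2 * x))) univ x := by
    intro x _
    have h1 : HasDerivAt (fun x : ℝ => -x ^ 2) (-(2 * x)) x := by
      simpa using HasDerivAt.fun_neg (hasDerivAt_pow 2 x)
    exact h1.exp.hasDerivWithinAt
  have hb : ∀ x ∈ (univ : Set ℝ), ‖Real.exp (-x ^ 2) * (-(2 * x))‖ ≤ 1 := by
    intro x _
    rw [norm_mul, Real.norm_eq_abs, Real.norm_eq_abs, abs_of_pos (Real.exp_pos _), abs_neg,
      Real.exp_neg, inv_mul_le_iff₀ (Real.exp_pos _), mul_one]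
    have := Real.add_one_le_exp (x ^ 2)
    refine le_trans ?_ this
    rw [abs_mul, abs_two, ← sq_abs x]
    nlinarith [sq_nonneg (|x| - 1)]
  have := convex_univ.norm_image_sub_le_of_norm_hasDerivWithin_le hd hb (mem_univ s) (mem_univ t)
  simpa using this

theorem abs_kernel_sub_le {ε : ℝ} (hε : 0 < ε) (w w' : E d) :
    |kernel ε w - kernel ε w'| ≤ (ε ^ (d + 1))⁻¹ * ‖w - w'‖ := by
  have h1 := abs_exp_neg_sq_sub_le (‖w'‖ / (2 * ε)) (‖w‖ / (2 * ε))
  have h2 : |‖w‖ / (2 * ε) - ‖w'‖ / (2 * ε)| ≤ ‖w - w'‖ / ε := by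
    rw [← sub_div, abs_div, abs_of_pos (by positivity : 0 < 2 * ε)]
    have := abs_norm_sub_norm_le w w'
    have h3 : |‖w‖ - ‖w'‖| / (2 * ε) ≤ ‖w - w'‖ / (2 * ε) := by gcongr
    refine h3.trans ?_
    gcongr
    linarith
  unfold kernel
  rw [← mul_sub, abs_mul, abs_of_nonneg (by positivity), pow_succ ε, mul_inv (ε ^ d), mul_assoc]
  refine mul_le_mul (inv_pow_sqrt_mul_le hε) ((h1.trans h2).trans (le_of_eq ?_)) (abs_nonneg _)
    (by positivity)
  rw [div_eq_inv_mul]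

theorem norm_div_sq_eq {ε : ℝ} (w : E d) : -(‖w‖ / (2 * ε)) ^ 2 = -(4 * ε ^ 2)⁻¹ * ‖w‖ ^ 2 := by
  rw [div_pow, div_eq_inv_mul]; ring

theorem sqrt_pow_eq {x : ℝ} (hx : 0 ≤ x) : x ^ ((d : ℝ) / 2) = √x ^ d := by
  rw [Real.sqrt_eq_rpow, ← Real.rpow_natCast, ← Real.rpow_mul hx]
  congr 1; ring

theorem integral_exp_neg_mul_sq {b : ℝ} (hb : 0 < b) :
    ∫ v : E d, Real.exp (-b * ‖v‖ ^ 2) = √(Real.pi / b) ^ d := by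
  rw [GaussianFourier.integral_rexp_neg_mul_sq_norm hb, finrank_euclideanSpace_fin,
    sqrt_pow_eq (by positivity)]

theorem integrable_exp_neg_mul_sq {b : ℝ} (hb : 0 < b) :
    Integrable fun v : E d => Real.exp (-b * ‖v‖ ^ 2) := by
  refine Integrable.of_integral_ne_zero ?_
  rw [integral_exp_neg_mul_sq hb]
  positivity

theorem integral_kernel {ε : ℝ} (hε : 0 < ε) : ∫ w : E d, kernel ε w = 1 := by
  unfold kernel
  rw [integral_const_mul]
  simp only [norm_div_sq_eq]
  rw [integral_exp_neg_mul_sq (by positivity)]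
  have : √(Real.pi / (4 * ε ^ 2)⁻¹) = √(4 * Real.pi) * ε := by
    rw [div_inv_eq_mul, show Real.pi * (4 * ε ^ 2) = (4 * Real.pi) * ε ^ 2 by ring,
      Real.sqrt_mul (by positivity), Real.sqrt_sq hε.le]
  rw [this]
  exact inv_mul_cancel₀ (by positivity)

theorem integrable_kernel {ε : ℝ} (hε : 0 < ε) : Integrable (kernel ε : E d → ℝ) :=
  Integrable.of_integral_ne_zero (by rw [integral_kernel hε]; exact one_ne_zero)

theorem lintegral_kernel_sub {ε : ℝ} (hε : 0 < ε) (z : E d) :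
    ∫⁻ y : E d, ENNReal.ofReal (kernel ε (z - y)) = 1 := by
  rw [lintegral_sub_left_eq_self (fun w : E d => ENNReal.ofReal (kernel ε w)) z,
    ← ofReal_integral_eq_lintegral_ofReal (integrable_kernel hε)
      (Eventually.of_forall fun w => kernel_nonneg hε w), integral_kernel hε, ENNReal.ofReal_one]

/-- Fourier inversion for the Gaussian; it turns bounds on characteristic functions into bounds on
kernel averages. -/
theorem ofReal_kernel_eq {ε : ℝ} (hε : 0 < ε) (w : E d) :
    (kernel ε w : ℂ) = (((2 * Real.pi) ^ d)⁻¹ : ℝ) *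
      ∫ v : E d, (Real.exp (-ε ^ 2 * ‖v‖ ^ 2) : ℂ) * Complex.exp (Complex.I * (inner ℝ v w : ℝ)) := by
  have hb : 0 < ((ε ^ 2 : ℝ) : ℂ).re := by rw [Complex.ofReal_re]; positivity
  have h := GaussianFourier.integral_cexp_neg_mul_sq_norm_add hb Complex.I w
  have h1 : ∀ v : E d, (Real.exp (-ε ^ 2 * ‖v‖ ^ 2) : ℂ) *
      Complex.exp (Complex.I * (inner ℝ v w : ℝ)) =
      Complex.exp (-((ε ^ 2 : ℝ) : ℂ) * ‖v‖ ^ 2 + Complex.I * (inner ℝ w v : ℝ)) := by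
    intro v
    rw [real_inner_comm, Complex.exp_add]
    push_cast
    rfl
  simp only [h1]
  rw [h, finrank_euclideanSpace_fin]
  have h2 : ((Real.pi : ℂ) / ((ε ^ 2 : ℝ) : ℂ)) ^ ((d : ℂ) / 2) =
      ((√(Real.pi / ε ^ 2) ^ d : ℝ) : ℂ) := by
    rw [← sqrt_pow_eq (by positivity), Complex.ofReal_cpow (by positivity)]
    push_cast; rfl
  have h3 : Complex.exp (Complex.I ^ 2 * (‖w‖ : ℂ) ^ 2 / (4 * ((ε ^ 2 : ℝ) : ℂ))) =
      ((Real.exp (-(‖w‖ / (2 * ε)) ^ 2) : ℝ) : ℂ) := by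
    rw [Complex.ofReal_exp]
    congr 1
    push_cast
    rw [Complex.I_sq, div_pow]
    ring
  rw [h2, h3, ← Complex.ofReal_mul, ← Complex.ofReal_mul]
  congr 1
  unfold kernel
  rw [← mul_assoc]
  congr 1
  rw [← inv_pow, ← inv_pow, ← mul_pow]
  congr 1
  rw [Real.sqrt_div' _ (sq_nonneg ε), Real.sqrt_sq hε.le, Real.sqrt_mul (by norm_num),
    show (4 : ℝ) = 2 ^ 2 by norm_num, Real.sqrt_sq (by norm_num)]
  have := Real.sqrt_pos.2 Real.pi_pos
  field_simp
  rw [Real.sq_sqrt Real.pi_pos.le]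

end Kernel

/-! ### Conditional kernel estimates -/

section Estimates

variable {Ω : Type*} [mΩ : MeasurableSpace Ω] {P : Measure Ω} [IsProbabilityMeasure P] {d : ℕ}

/-- By Fubini only the weighted characteristic function of `U` enters; the centre `y` contributes a
phase, so the bound is uniform in `y`. -/
theorem norm_integral_mul_fourier_le {U : Ω → E d} (hU : Measurable U) {g : Ω → ℝ}
    (hg : Integrable g P) {b A : ℝ}
    (h : ∀ u : E d, ‖∫ ω, (g ω : ℂ) * Complex.exp (Complex.I * (inner ℝ u (U ω) : ℝ)) ∂P‖ ≤
      Real.exp (-(b * ‖u‖ ^ 2)) * A)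
    {m : E d → ℝ} (hm : Integrable m)
    (hmb : Integrable fun v : E d => |m v| * Real.exp (-(b * ‖v‖ ^ 2))) (y : E d) :
    ‖∫ ω, (g ω : ℂ) * (∫ v : E d, (m v : ℂ) *
        Complex.exp (Complex.I * (inner ℝ v (U ω - y) : ℝ))) ∂P‖ ≤
      (∫ v : E d, |m v| * Real.exp (-(b * ‖v‖ ^ 2))) * A := by
  have hint : Integrable (Function.uncurry fun (ω : Ω) (v : E d) => (g ω : ℂ) * ((m v : ℂ) *
      Complex.exp (Complex.I * (inner ℝ v (U ω - y) : ℝ)))) (P.prod volume) := by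
    have h1 : Integrable (fun p : Ω × E d => (g p.1 : ℂ) * (m p.2 : ℂ)) (P.prod volume) :=
      Integrable.mul_prod (f := fun ω => (g ω : ℂ)) (g := fun v => (m v : ℂ)) hg.ofReal hm.ofReal
    have h2 : Measurable fun p : Ω × E d =>
        Complex.exp (Complex.I * (inner ℝ p.2 (U p.1 - y) : ℝ)) := by
      have : Measurable fun p : Ω × E d => (inner ℝ p.2 (U p.1 - y) : ℝ) :=
        Measurable.inner measurable_snd ((hU.comp measurable_fst).sub_const y)
      fun_prop
    have h3 := h1.mul_bdd (c := 1) h2.aestronglyMeasurable (Eventually.of_forall fun p => by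
      rw [Complex.norm_exp]; simp)
    refine h3.congr (Eventually.of_forall fun p => ?_)
    simp only [Function.uncurry, mul_assoc]
  simp only [← integral_const_mul]
  rw [integral_integral_swap hint, ← integral_mul_const]
  refine norm_integral_le_of_norm_le (hmb.mul_const A) (Eventually.of_forall fun v => ?_)
  have e : ∀ ω, (g ω : ℂ) * ((m v : ℂ) * Complex.exp (Complex.I * (inner ℝ v (U ω - y) : ℝ))) =
      ((m v : ℂ) * Complex.exp (-(Complex.I * (inner ℝ v y : ℝ)))) *
        ((g ω : ℂ) * Complex.exp (Complex.I * (inner ℝ v (U ω) : ℝ))) := by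
    intro ω
    rw [inner_sub_right]
    push_cast
    rw [mul_sub, sub_eq_add_neg, Complex.exp_add]
    ring
  simp only [e]
  rw [integral_const_mul, norm_mul, norm_mul, Complex.norm_real, Complex.norm_exp, mul_assoc]
  have : (-(Complex.I * ((inner ℝ v y : ℝ) : ℂ))).re = 0 := by simp
  rw [this, Real.exp_zero, one_mul, Real.norm_eq_abs, mul_assoc]
  exact mul_le_mul_of_nonneg_left (h v) (abs_nonneg _)

/-- The multiplier exp (-ε² |v|²) is at most 1, so the bound does not depend on `ε`: it is the bound
for a conditional density. -/
theorem abs_integral_mul_kernel_le {U : Ω → E d} (hU : Measurable U) {g : Ω → ℝ}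
    (hg : Integrable g P) {b A : ℝ} (hb : 0 < b) (hA : 0 ≤ A)
    (h : ∀ u : E d, ‖∫ ω, (g ω : ℂ) * Complex.exp (Complex.I * (inner ℝ u (U ω) : ℝ)) ∂P‖ ≤
      Real.exp (-(b * ‖u‖ ^ 2)) * A) {ε : ℝ} (hε : 0 < ε) (y : E d) :
    |∫ ω, g ω * kernel ε (U ω - y) ∂P| ≤ √(Real.pi / b) ^ d * A := by
  have hm := integrable_exp_neg_mul_sq (d := d) (b := ε ^ 2) (by positivity)
  have hbi := integrable_exp_neg_mul_sq (d := d) hb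
  have hle : ∀ v : E d, |Real.exp (-ε ^ 2 * ‖v‖ ^ 2)| * Real.exp (-(b * ‖v‖ ^ 2)) ≤
      Real.exp (-b * ‖v‖ ^ 2) := by
    intro v
    rw [abs_of_pos (Real.exp_pos _), neg_mul b]
    refine mul_le_of_le_one_left (Real.exp_pos _).le (Real.exp_le_one_iff.2 ?_)
    have : 0 ≤ ε ^ 2 * ‖v‖ ^ 2 := by positivity
    linarith
  have hmb : Integrable fun v : E d =>
      |Real.exp (-ε ^ 2 * ‖v‖ ^ 2)| * Real.exp (-(b * ‖v‖ ^ 2)) := by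
    refine hbi.mono' (by fun_prop) (Eventually.of_forall fun v => ?_)
    rw [Real.norm_of_nonneg (by positivity)]
    exact hle v
  have key := norm_integral_mul_fourier_le hU hg h hm hmb y
  have e : ((∫ ω, g ω * kernel ε (U ω - y) ∂P : ℝ) : ℂ) = (((2 * Real.pi) ^ d)⁻¹ : ℝ) *
      ∫ ω, (g ω : ℂ) * (∫ v : E d, (Real.exp (-ε ^ 2 * ‖v‖ ^ 2) : ℂ) *
        Complex.exp (Complex.I * (inner ℝ v (U ω - y) : ℝ))) ∂P := by
    rw [← integral_const_mul, ← integral_complex_ofReal]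
    congr 1
    ext ω
    push_cast
    rw [ofReal_kernel_eq hε]
    push_cast
    ring
  rw [← Real.norm_eq_abs, ← Complex.norm_real, e, norm_mul, Complex.norm_real]
  have h1 : ‖((2 * Real.pi) ^ d)⁻¹‖ ≤ 1 := by
    rw [norm_inv, norm_pow, Real.norm_of_nonneg (by positivity)]
    exact inv_le_one_of_one_le₀ (one_le_pow₀ (by linarith [Real.pi_gt_three]))
  refine (mul_le_of_le_one_left (norm_nonneg _) h1).trans (key.trans ?_)
  rw [← integral_exp_neg_mul_sq hb]
  exact mul_le_mul_of_nonneg_right (integral_mono hmb hbi hle) hA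

theorem rpow_half_mul_exp_le {γ x : ℝ} (hγ0 : 0 ≤ γ) (hγ : γ ≤ 1) (hx : 0 ≤ x) :
    x ^ (γ / 2) ≤ Real.exp (x / 2) := by
  have h0 := Real.add_one_le_exp (x / 2)
  rcases le_total x 1 with h | h
  · exact (Real.rpow_le_one hx h (by linarith)).trans (by linarith)
  · calc x ^ (γ / 2) ≤ x ^ (1 / 2 : ℝ) := Real.rpow_le_rpow_of_exponent_le h (by linarith)
      _ = √x := (Real.sqrt_eq_rpow x).symm
      _ ≤ x / 2 + 1 := by
        rw [Real.sqrt_le_left (by linarith)]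
        nlinarith [sq_nonneg x]
      _ ≤ _ := h0

/-- Interpolation between the Lipschitz bound, used for `a ≤ 1`, and the trivial bound 1. -/
theorem abs_exp_sub_exp_le {γ a : ℝ} (hγ0 : 0 < γ) (hγ : γ ≤ 1) (ha : 0 ≤ a) :
    |Real.exp (-a ^ 2) - Real.exp (-(a / 2) ^ 2)| ≤ a ^ γ := by
  have h1 := abs_exp_neg_sq_sub_le (a / 2) a
  rw [show a - a / 2 = a / 2 by ring, abs_of_nonneg (by linarith : 0 ≤ a / 2)] at h1
  rcases le_total a 1 with h | h
  · have : a ≤ a ^ γ := by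
      rcases ha.eq_or_lt with h0 | h0
      · rw [← h0, Real.zero_rpow hγ0.ne']
      · conv_lhs => rw [← Real.rpow_one a]
        exact Real.rpow_le_rpow_of_exponent_ge h0 h hγ
    linarith
  · have h2 : (1 : ℝ) ≤ a ^ γ := Real.one_le_rpow h hγ0.le
    have h3 : Real.exp (-a ^ 2) ≤ 1 := Real.exp_le_one_iff.2 (by nlinarith [sq_nonneg a])
    have h4 : Real.exp (-(a / 2) ^ 2) ≤ 1 := Real.exp_le_one_iff.2 (by nlinarith [sq_nonneg a])
    rw [abs_le]
    constructor <;> linarith [Real.exp_pos (-a ^ 2), Real.exp_pos (-(a / 2) ^ 2)]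

/-- The difference of the two multipliers is at most (ε |v|)^γ. Half of the Gaussian decay is spent
on absorbing |v|^γ, which yields `b ^ (-(γ / 2))` and leaves `b / 2` in the remaining integral. -/
theorem abs_integral_mul_kernel_sub_le {U : Ω → E d} (hU : Measurable U) {g : Ω → ℝ}
    (hg : Integrable g P) {b A γ : ℝ} (hb : 0 < b) (hA : 0 ≤ A) (hγ0 : 0 < γ) (hγ : γ ≤ 1)
    (h : ∀ u : E d, ‖∫ ω, (g ω : ℂ) * Complex.exp (Complex.I * (inner ℝ u (U ω) : ℝ)) ∂P‖ ≤
      Real.exp (-(b * ‖u‖ ^ 2)) * A) {ε : ℝ} (hε : 0 < ε) (y : E d) :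
    |∫ ω, g ω * (kernel ε (U ω - y) - kernel (ε / 2) (U ω - y)) ∂P| ≤
      ε ^ γ * b ^ (-(γ / 2)) * √(Real.pi / (b / 2)) ^ d * A := by
  let m : E d → ℝ := fun v => Real.exp (-ε ^ 2 * ‖v‖ ^ 2) - Real.exp (-(ε / 2) ^ 2 * ‖v‖ ^ 2)
  have hm1 := integrable_exp_neg_mul_sq (d := d) (b := ε ^ 2) (by positivity)
  have hm2 := integrable_exp_neg_mul_sq (d := d) (b := (ε / 2) ^ 2) (by positivity)
  have hm : Integrable m := hm1.sub hm2
  have hbi := (integrable_exp_neg_mul_sq (d := d) (half_pos hb)).const_mul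
    (ε ^ γ * b ^ (-(γ / 2)))
  have hle : ∀ v : E d, |m v| * Real.exp (-(b * ‖v‖ ^ 2)) ≤
      ε ^ γ * b ^ (-(γ / 2)) * Real.exp (-(b / 2) * ‖v‖ ^ 2) := by
    intro v
    have h1 : |m v| ≤ (ε * ‖v‖) ^ γ := by
      have := abs_exp_sub_exp_le hγ0 hγ (a := ε * ‖v‖) (by positivity)
      rw [show -(ε * ‖v‖) ^ 2 = -ε ^ 2 * ‖v‖ ^ 2 by ring,
        show -(ε * ‖v‖ / 2) ^ 2 = -(ε / 2) ^ 2 * ‖v‖ ^ 2 by ring] at this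
      exact this
    have h2 := rpow_half_mul_exp_le hγ0.le hγ (x := b * ‖v‖ ^ 2) (by positivity)
    have h3 : (b * ‖v‖ ^ 2) ^ (γ / 2) = b ^ (γ / 2) * ‖v‖ ^ γ := by
      rw [Real.mul_rpow hb.le (by positivity), ← Real.rpow_natCast, ← Real.rpow_mul (norm_nonneg v)]
      congr 2
      push_cast; ring
    have h4 : ‖v‖ ^ γ ≤ b ^ (-(γ / 2)) * Real.exp (b * ‖v‖ ^ 2 / 2) := by
      rw [h3] at h2
      rw [Real.rpow_neg hb.le, le_inv_mul_iff₀ (by positivity)]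
      exact h2
    calc |m v| * Real.exp (-(b * ‖v‖ ^ 2)) ≤ (ε * ‖v‖) ^ γ * Real.exp (-(b * ‖v‖ ^ 2)) := by
          gcongr
      _ = ε ^ γ * ‖v‖ ^ γ * Real.exp (-(b * ‖v‖ ^ 2)) := by
          rw [Real.mul_rpow hε.le (norm_nonneg v)]
      _ ≤ ε ^ γ * (b ^ (-(γ / 2)) * Real.exp (b * ‖v‖ ^ 2 / 2)) * Real.exp (-(b * ‖v‖ ^ 2)) := by
          gcongr
      _ = ε ^ γ * b ^ (-(γ / 2)) *
          (Real.exp (b * ‖v‖ ^ 2 / 2) * Real.exp (-(b * ‖v‖ ^ 2))) := by ring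
      _ = _ := by
          rw [← Real.exp_add]
          congr 2
          ring
  have hmb : Integrable fun v : E d => |m v| * Real.exp (-(b * ‖v‖ ^ 2)) := by
    refine hbi.mono' (by fun_prop) (Eventually.of_forall fun v => ?_)
    rw [Real.norm_of_nonneg (by positivity)]
    exact hle v
  have key := norm_integral_mul_fourier_le hU hg h hm hmb y
  have hexp : ∀ (a : ℝ) (w : E d), Integrable (fun v : E d => Real.exp (-a ^ 2 * ‖v‖ ^ 2)) →
      Integrable (fun v : E d => (Real.exp (-a ^ 2 * ‖v‖ ^ 2) : ℂ) *
        Complex.exp (Complex.I * (inner ℝ v w : ℝ))) := fun a w hi =>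
    hi.ofReal.mul_bdd (c := 1) (Measurable.aestronglyMeasurable (by fun_prop))
      (Eventually.of_forall fun p => by rw [Complex.norm_exp]; simp)
  have e : ((∫ ω, g ω * (kernel ε (U ω - y) - kernel (ε / 2) (U ω - y)) ∂P : ℝ) : ℂ) =
      (((2 * Real.pi) ^ d)⁻¹ : ℝ) * ∫ ω, (g ω : ℂ) * (∫ v : E d, (m v : ℂ) *
        Complex.exp (Complex.I * (inner ℝ v (U ω - y) : ℝ))) ∂P := by
    rw [← integral_const_mul, ← integral_complex_ofReal]
    congr 1
    ext ω
    rw [Complex.ofReal_mul, Complex.ofReal_sub, ofReal_kernel_eq hε, ofReal_kernel_eq (half_pos hε),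
      ← mul_sub, ← integral_sub (hexp _ _ hm1) (hexp _ _ hm2)]
    simp only [m, Complex.ofReal_sub, sub_mul]
    rw [mul_left_comm]
  rw [← Real.norm_eq_abs, ← Complex.norm_real, e, norm_mul, Complex.norm_real]
  have h1 : ‖((2 * Real.pi) ^ d)⁻¹‖ ≤ 1 := by
    rw [norm_inv, norm_pow, Real.norm_of_nonneg (by positivity)]
    exact inv_le_one_of_one_le₀ (one_le_pow₀ (by linarith [Real.pi_gt_three]))
  refine (mul_le_of_le_one_left (norm_nonneg _) h1).trans (key.trans ?_)
  rw [← integral_exp_neg_mul_sq (half_pos hb), ← integral_const_mul]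
  exact mul_le_mul_of_nonneg_right (integral_mono hmb hbi hle) hA

end Estimates

end GaussianLocalTime

end


noncomputable section

namespace GaussianLocalTime

/-! ### Riemann sums -/

/-- Comparison with the integral of x^(-β); the telescoping step is Bernoulli's inequality for the
exponent 1 - β at -1 / (p + 1). -/
theorem sum_range_rpow_neg_le {β : ℝ} (hβ0 : 0 ≤ β) (hβ : β < 1) (p : ℕ) :
    ∑ i ∈ Finset.range p, ((i + 1 : ℕ) : ℝ) ^ (-β) ≤ (p : ℝ) ^ (1 - β) / (1 - β) := by
  have h1β : 0 < 1 - β := by linarith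
  induction p with
  | zero => simp [Real.zero_rpow h1β.ne']
  | succ p ih =>
    rw [Finset.sum_range_succ]
    have hp : (0 : ℝ) < (p + 1 : ℕ) := by positivity
    have key : (p : ℝ) ^ (1 - β) ≤
        ((p + 1 : ℕ) : ℝ) ^ (1 - β) - (1 - β) * ((p + 1 : ℕ) : ℝ) ^ (-β) := by
      have hs : (-1 : ℝ) ≤ -(1 / ((p + 1 : ℕ) : ℝ)) := by
        rw [neg_le_neg_iff, div_le_one hp]
        push_cast; linarith [(Nat.cast_nonneg p : (0 : ℝ) ≤ p)]
      have hb := rpow_one_add_le_one_add_mul_self hs h1β.le (by linarith)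
      have e1 : (p : ℝ) = ((p + 1 : ℕ) : ℝ) * (1 + -(1 / ((p + 1 : ℕ) : ℝ))) := by
        field_simp; push_cast; ring
      have h0 : 0 ≤ 1 + -(1 / ((p + 1 : ℕ) : ℝ)) := by linarith
      conv_lhs => rw [e1]
      rw [Real.mul_rpow hp.le h0]
      refine (mul_le_mul_of_nonneg_left hb (by positivity)).trans (le_of_eq ?_)
      have e2 : ((p + 1 : ℕ) : ℝ) ^ (-β) = ((p + 1 : ℕ) : ℝ) ^ (1 - β) / ((p + 1 : ℕ) : ℝ) := by
        rw [show -β = (1 - β) - 1 by ring, Real.rpow_sub_one hp.ne']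
      rw [e2]
      field_simp
      ring
    rw [le_div_iff₀ h1β] at ih ⊢
    linarith

theorem sum_Ico_mul_rpow_neg_le {β h : ℝ} (hβ0 : 0 ≤ β) (hβ : β < 1) (hh : 0 < h) (k p : ℕ) :
    ∑ i ∈ Finset.Ico k (k + p), h * (((i + 1 - k : ℕ) : ℝ) * h) ^ (-β) ≤
      (p * h) ^ (1 - β) / (1 - β) := by
  rw [Finset.sum_Ico_eq_sum_range, Nat.add_sub_cancel_left]
  have e : ∀ i ∈ Finset.range p, h * (((k + i + 1 - k : ℕ) : ℝ) * h) ^ (-β) =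
      h ^ (1 - β) * ((i + 1 : ℕ) : ℝ) ^ (-β) := by
    intro i _
    rw [show k + i + 1 - k = i + 1 by omega, Real.mul_rpow (by positivity) hh.le,
      show 1 - β = 1 + -β by ring, Real.rpow_add hh, Real.rpow_one]
    ring
  rw [Finset.sum_congr rfl e, ← Finset.mul_sum, Real.mul_rpow (by positivity) hh.le, mul_comm,
    mul_div_right_comm]
  exact mul_le_mul_of_nonneg_right (sum_range_rpow_neg_le hβ0 hβ p) (by positivity)

/-- The mesh does not depend on `t`: integrals up to different `t` are limits of partial sums of the
same arrays, so a bound for the maximal partial sum controls all `t` at once. -/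
theorem exists_tendsto_riemannSum {f : ℝ → ℝ} (hf : Continuous f) {a r t : ℝ} (hr : 0 < r)
    (ht : t ∈ Icc a (a + r)) :
    ∃ k : ℕ → ℕ, (∀ N, k N ≤ N) ∧ Tendsto
      (fun N : ℕ => ∑ i ∈ Finset.range (k N), r / N * f (a + (i + 1 : ℕ) * (r / N))) atTop
      (𝓝 (∫ s in a..t, f s)) := by
  have hta : 0 ≤ t - a := by linarith [ht.1]
  refine ⟨fun N => ⌊N * ((t - a) / r)⌋₊, fun N => ?_, ?_⟩
  · refine Nat.floor_le_of_le ?_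
    exact mul_le_of_le_one_right (Nat.cast_nonneg N) ((div_le_one hr).2 (by linarith [ht.2]))
  obtain ⟨C, hC⟩ := (isCompact_Icc (a := a) (b := a + r)).exists_bound_of_continuousOn
    hf.continuousOn
  have hC0 : 0 ≤ C := (norm_nonneg _).trans (hC a ⟨le_rfl, by linarith⟩)
  rw [Metric.tendsto_atTop]
  intro δ hδ
  have huc := (isCompact_Icc (a := a) (b := a + r)).uniformContinuousOn_of_continuous
    hf.continuousOn
  obtain ⟨η, hη, hηf⟩ := Metric.uniformContinuousOn_iff_le.1 huc (δ / (4 * r)) (by positivity)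
  obtain ⟨N₀, hN₀⟩ := exists_nat_gt (max (r / η) (4 * r * (C + 1) / δ))
  refine ⟨max N₀ 1, fun N hN => ?_⟩
  have hN1 : 1 ≤ N := (le_max_right _ _).trans hN
  have hNpos : (0 : ℝ) < N := by exact_mod_cast hN1
  have hNN : (N₀ : ℝ) ≤ N := by exact_mod_cast (le_max_left _ _).trans hN
  set h : ℝ := r / N with hh
  have hhpos : 0 < h := by positivity
  have hhη : h ≤ η := by
    rw [hh, div_le_iff₀ hNpos, ← div_le_iff₀' hη]
    exact (le_max_left _ _).trans (hN₀.le.trans hNN)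
  have hhC : h * (C + 1) < δ / 2 := by
    have : 4 * r * (C + 1) / δ < N := (le_max_right _ _).trans_lt (hN₀.trans_le hNN)
    rw [div_lt_iff₀ hδ] at this
    rw [hh, div_mul_eq_mul_div, div_lt_iff₀ hNpos]
    nlinarith [mul_pos hr (by linarith : 0 < C + 1)]
  set k : ℕ := ⌊N * ((t - a) / r)⌋₊ with hk
  have hk1 : (k : ℝ) * h ≤ t - a := by
    have := Nat.floor_le (by positivity : 0 ≤ (N : ℝ) * ((t - a) / r))
    calc (k : ℝ) * h ≤ (N * ((t - a) / r)) * h := by gcongr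
      _ = t - a := by rw [hh]; field_simp
  have hk2 : t - a ≤ (k + 1) * h := by
    have := (Nat.lt_floor_add_one ((N : ℝ) * ((t - a) / r))).le
    calc t - a = (N * ((t - a) / r)) * h := by rw [hh]; field_simp
      _ ≤ _ := by gcongr
  have hint : ∀ x y, IntervalIntegrable f volume x y := fun x y => hf.intervalIntegrable x y
  have hsplit : ∫ s in a..t, f s = (∑ i ∈ Finset.range k,
      ∫ s in (a + (i : ℕ) * h)..(a + (i + 1 : ℕ) * h), f s) + ∫ s in (a + k * h)..t, f s := by
    rw [intervalIntegral.sum_integral_adjacent_intervals (a := fun i : ℕ => a + (i : ℕ) * h)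
      fun i _ => hint _ _]
    simp only [Nat.cast_zero, zero_mul, add_zero]
    exact (intervalIntegral.integral_add_adjacent_intervals (hint _ _) (hint _ _)).symm
  have hterm : ∀ i ∈ Finset.range k, |h * f (a + (i + 1 : ℕ) * h) -
      ∫ s in (a + (i : ℕ) * h)..(a + (i + 1 : ℕ) * h), f s| ≤ h * (δ / (4 * r)) := by
    intro i hi
    have hik : ((i + 1 : ℕ) : ℝ) ≤ k := by exact_mod_cast Finset.mem_range.1 hi
    have hi2 : ((i + 1 : ℕ) : ℝ) * h ≤ k * h := by gcongr
    have hlen : (a + (i + 1 : ℕ) * h) - (a + (i : ℕ) * h) = h := by push_cast; ring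
    have e : h * f (a + (i + 1 : ℕ) * h) =
        ∫ s in (a + (i : ℕ) * h)..(a + (i + 1 : ℕ) * h), f (a + (i + 1 : ℕ) * h) := by
      rw [intervalIntegral.integral_const, hlen, smul_eq_mul]
    rw [e, ← intervalIntegral.integral_sub (by simp) (hint _ _), ← Real.norm_eq_abs]
    have := intervalIntegral.norm_integral_le_of_norm_le_const
      (a := a + (i : ℕ) * h) (b := a + (i + 1 : ℕ) * h) (C := δ / (4 * r))
      (f := fun s => f (a + (i + 1 : ℕ) * h) - f s) ?_
    · rw [hlen, abs_of_pos hhpos, mul_comm (δ / (4 * r))] at this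
      exact this
    · intro s hs
      rw [uIoc_of_le (by linarith)] at hs
      have hi0 : 0 ≤ (i : ℝ) * h := by positivity
      refine hηf _ ⟨by push_cast at *; nlinarith, by linarith [ht.2]⟩ _
        ⟨by linarith [hs.1], by linarith [hs.2, ht.2]⟩ ?_
      rw [Real.dist_eq, abs_of_nonneg (by linarith [hs.2])]
      linarith [hs.1]
  have hlast : |∫ s in (a + k * h)..t, f s| ≤ h * C := by
    rw [← Real.norm_eq_abs]
    refine (intervalIntegral.norm_integral_le_of_norm_le_const (C := C) fun s hs => ?_).trans ?_
    · rw [uIoc_of_le (by linarith)] at hs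
      have : 0 ≤ (k : ℝ) * h := by positivity
      exact hC s ⟨by linarith [hs.1], by linarith [hs.2, ht.2]⟩
    · rw [abs_of_nonneg (by linarith), mul_comm]
      gcongr
      linarith
  rw [Real.dist_eq, hsplit, ← sub_sub, ← Finset.sum_sub_distrib]
  refine (abs_sub _ _).trans_lt ?_
  have hs1 := (Finset.abs_sum_le_sum_abs _ _).trans (Finset.sum_le_sum hterm)
  rw [Finset.sum_const, Finset.card_range, nsmul_eq_mul, ← mul_assoc] at hs1
  have hs2 : (k : ℝ) * h * (δ / (4 * r)) ≤ δ / 4 := by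
    calc (k : ℝ) * h * (δ / (4 * r)) ≤ r * (δ / (4 * r)) := by
          gcongr; linarith [ht.2]
      _ = δ / 4 := by field_simp
  have : h * C ≤ h * (C + 1) := by gcongr; linarith
  linarith

/-! ### Estimates along a grid -/

/-- The grid `0, a + h, a + 2 h, …`. -/
def grid (a h : ℝ) (i : ℕ) : ℝ := if i = 0 then 0 else a + i * h

theorem grid_zero (a h : ℝ) : grid a h 0 = 0 := by simp [grid]

theorem grid_succ (a h : ℝ) (i : ℕ) : grid a h (i + 1) = a + (i + 1 : ℕ) * h := by simp [grid]

/-- Only an inequality, because index 0 is the time 0 and the first gap is `a + h`. Starting at 0 is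
required by the increment σ-algebras; a larger gap only improves the decay. -/
theorem le_grid_sub_grid {a h : ℝ} (ha : 0 ≤ a) {k j : ℕ} (hkj : k < j) :
    ((j - k : ℕ) : ℝ) * h ≤ grid a h j - grid a h k := by
  have hj : j ≠ 0 := by omega
  rw [Nat.cast_sub hkj.le]
  unfold grid
  rw [if_neg hj]
  split_ifs with hk
  · subst hk; simp; linarith
  · ring_nf; exact le_rfl

theorem strictMono_grid {a h : ℝ} (ha : 0 ≤ a) (hh : 0 < h) : StrictMono (grid a h) := by
  intro k j hkj
  have h1 := le_grid_sub_grid (h := h) ha hkj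
  have h2 : (0 : ℝ) < (j - k : ℕ) := by exact_mod_cast Nat.sub_pos_of_lt hkj
  nlinarith [mul_pos h2 hh]

section Grid

variable {Ω : Type*} [mΩ : MeasurableSpace Ω] {P : Measure Ω} [IsProbabilityMeasure P] {d : ℕ}
  {X : ℝ → Ω → E d} {T H c : ℝ}

theorem ConditionalDecay.abs_integral_mul_kernel_le (hX : ConditionalDecay P X T H c) (hc : 0 < c)
    (hXm : ∀ t, Measurable (X t)) {a h : ℝ} (ha : 0 ≤ a) (hh : 0 < h) (hH : 0 < H) {k j : ℕ}
    (hkj : k < j) (hj : grid a h j ≤ T) {g : Ω → ℝ}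
    (hg : BddMeas (incrementSigma X (grid a h) k) g) {ε : ℝ} (hε : 0 < ε) (y : E d) :
    |∫ ω, g ω * kernel ε (X (grid a h j) ω - y) ∂P| ≤
      √(Real.pi / c) ^ d * (((j - k : ℕ) : ℝ) * h) ^ (-(H * d)) * ∫ ω, |g ω| ∂P := by
  have hmono := strictMono_grid (h := h) ha hh
  have hgap : 0 < grid a h j - grid a h k := sub_pos.2 (hmono hkj)
  have hjk : (0 : ℝ) < (j - k : ℕ) := by exact_mod_cast Nat.sub_pos_of_lt hkj
  have hA : 0 ≤ ∫ ω, |g ω| ∂P := integral_nonneg fun ω => abs_nonneg _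
  have key := GaussianLocalTime.abs_integral_mul_kernel_le (hXm (grid a h j))
    (hg.integrable (P := P) (incrementSigma_le hXm _ k))
    (b := c * (grid a h j - grid a h k) ^ (2 * H)) (by positivity) hA
    (fun u => hX (grid a h) hmono (grid_zero a h) k j hkj hj g hg.measurable u) hε y
  refine key.trans (mul_le_mul_of_nonneg_right ?_ hA)
  have e : √(Real.pi / (c * (grid a h j - grid a h k) ^ (2 * H))) =
      √(Real.pi / c) * (grid a h j - grid a h k) ^ (-H) := by
    rw [← div_div, Real.sqrt_div' _ (by positivity), div_eq_mul_inv, Real.rpow_neg hgap.le,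
      Real.sqrt_eq_rpow ((_ : ℝ) ^ _), ← Real.rpow_mul hgap.le]
    congr 3; ring
  rw [e, mul_pow]
  refine mul_le_mul_of_nonneg_left ?_ (by positivity)
  rw [← Real.rpow_natCast, ← Real.rpow_mul hgap.le, neg_mul]
  exact Real.rpow_le_rpow_of_nonpos (by positivity) (le_grid_sub_grid ha hkj)
    (by have : 0 ≤ H * d := by positivity
        linarith)

theorem ConditionalDecay.abs_integral_mul_kernel_sub_le (hX : ConditionalDecay P X T H c)
    (hc : 0 < c) (hXm : ∀ t, Measurable (X t)) {a h γ : ℝ} (ha : 0 ≤ a) (hh : 0 < h) (hH : 0 < H)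
    (hγ0 : 0 < γ) (hγ : γ ≤ 1) {k j : ℕ} (hkj : k < j) (hj : grid a h j ≤ T) {g : Ω → ℝ}
    (hg : BddMeas (incrementSigma X (grid a h) k) g) {ε : ℝ} (hε : 0 < ε) (y : E d) :
    |∫ ω, g ω * (kernel ε (X (grid a h j) ω - y) - kernel (ε / 2) (X (grid a h j) ω - y)) ∂P| ≤
      (c ^ (-(γ / 2)) * √(Real.pi / (c / 2)) ^ d * ε ^ γ) *
        (((j - k : ℕ) : ℝ) * h) ^ (-(H * (d + γ))) * ∫ ω, |g ω| ∂P := by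
  have hmono := strictMono_grid (h := h) ha hh
  have hgap : 0 < grid a h j - grid a h k := sub_pos.2 (hmono hkj)
  have hjk : (0 : ℝ) < (j - k : ℕ) := by exact_mod_cast Nat.sub_pos_of_lt hkj
  have hA : 0 ≤ ∫ ω, |g ω| ∂P := integral_nonneg fun ω => abs_nonneg _
  have key := GaussianLocalTime.abs_integral_mul_kernel_sub_le (hXm (grid a h j))
    (hg.integrable (P := P) (incrementSigma_le hXm _ k))
    (b := c * (grid a h j - grid a h k) ^ (2 * H)) (by positivity) hA hγ0 hγ
    (fun u => hX (grid a h) hmono (grid_zero a h) k j hkj hj g hg.measurable u) hε y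
  refine key.trans (mul_le_mul_of_nonneg_right ?_ hA)
  set D := grid a h j - grid a h k with hD
  have e : √(Real.pi / (c * D ^ (2 * H) / 2)) = √(Real.pi / (c / 2)) * D ^ (-H) := by
    rw [mul_div_right_comm, ← div_div, Real.sqrt_div' _ (by positivity), div_eq_mul_inv,
      Real.rpow_neg hgap.le, Real.sqrt_eq_rpow ((_ : ℝ) ^ _), ← Real.rpow_mul hgap.le]
    congr 3; ring
  have e2 : (c * D ^ (2 * H)) ^ (-(γ / 2)) = c ^ (-(γ / 2)) * D ^ (-(H * γ)) := by
    rw [Real.mul_rpow hc.le (by positivity), ← Real.rpow_mul hgap.le]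
    congr 2; ring
  have e3 : (D ^ (-H)) ^ d = D ^ (-(H * d)) := by
    rw [← Real.rpow_natCast, ← Real.rpow_mul hgap.le, neg_mul]
  have e4 : D ^ (-(H * γ)) * D ^ (-(H * d)) = D ^ (-(H * (d + γ))) := by
    rw [← Real.rpow_add hgap]; congr 1; ring
  rw [e, e2, mul_pow, e3]
  have h5 : D ^ (-(H * (d + γ))) ≤ (((j - k : ℕ) : ℝ) * h) ^ (-(H * (d + γ))) :=
    Real.rpow_le_rpow_of_nonpos (by positivity) (le_grid_sub_grid ha hkj)
      (by have : 0 ≤ H * (d + γ) := by positivity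
          linarith)
  calc ε ^ γ * (c ^ (-(γ / 2)) * D ^ (-(H * γ))) * (√(Real.pi / (c / 2)) ^ d * D ^ (-(H * d)))
      = (c ^ (-(γ / 2)) * √(Real.pi / (c / 2)) ^ d * ε ^ γ) *
          (D ^ (-(H * γ)) * D ^ (-(H * d))) := by ring
    _ ≤ _ := by rw [e4]; gcongr

theorem bddMeas_kernel (hX0 : ∀ ω, X 0 ω = 0) (a h : ℝ) {ε : ℝ} (hε : 0 < ε) (y : E d) (i : ℕ) :
    BddMeas (incrementSigma X (grid a h) i) fun ω => kernel ε (X (grid a h i) ω - y) := by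
  refine ⟨?_, (ε ^ d)⁻¹, fun ω => ?_⟩
  · exact (continuous_kernel ε).measurable.comp
      ((measurable_incrementSigma hX0 (grid_zero a h) i i le_rfl).sub_const y)
  · rw [abs_of_nonneg (kernel_nonneg hε _)]
    exact kernel_le hε _

/-- A mollified occupation time over a duration `p * h` has conditional mean of order (p h)^(1 -
Hd), since gap^(-Hd) is integrable in time. This supplies the constant `M` of both tail
inequalities. -/
theorem ConditionalDecay.integral_mul_sum_le (hX : ConditionalDecay P X T H c) (hc : 0 < c)
    (hXm : ∀ t, Measurable (X t)) (hX0 : ∀ ω, X 0 ω = 0) {a h : ℝ} (ha : 0 ≤ a) (hh : 0 < h)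
    (hH : 0 < H) (hHd : H * d < 1) {k p : ℕ} (hj : a + (k + p : ℕ) * h ≤ T) {g : Ω → ℝ}
    (hg : BddMeas (incrementSigma X (grid a h) k) g) (hg0 : ∀ ω, 0 ≤ g ω) {ε : ℝ} (hε : 0 < ε)
    (y : E d) :
    ∫ ω, g ω * ∑ i ∈ Finset.Ico k (k + p), h * kernel ε (X (grid a h (i + 1)) ω - y) ∂P ≤
      √(Real.pi / c) ^ d * ((p * h) ^ (1 - H * d) / (1 - H * d)) * ∫ ω, g ω ∂P := by
  have hle := fun i => incrementSigma_le hXm (grid a h) i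
  have hA : 0 ≤ ∫ ω, g ω ∂P := integral_nonneg hg0
  simp only [Finset.mul_sum]
  rw [integral_finsetSum _ fun i _ => ((hg.mono (hle k)).mul ((BddMeas.const h).mul
    ((bddMeas_kernel hX0 a h hε y (i + 1)).mono (hle _)))).integrable le_rfl]
  have hstep : ∀ i ∈ Finset.Ico k (k + p),
      ∫ ω, g ω * (h * kernel ε (X (grid a h (i + 1)) ω - y)) ∂P ≤
      (√(Real.pi / c) ^ d * ∫ ω, g ω ∂P) *
        (h * (((i + 1 - k : ℕ) : ℝ) * h) ^ (-(H * d))) := by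
    intro i hi
    obtain ⟨h1, h2⟩ := Finset.mem_Ico.1 hi
    have hgr : grid a h (i + 1) ≤ T := by
      rw [grid_succ]
      refine le_trans ?_ hj
      have : ((i + 1 : ℕ) : ℝ) ≤ (k + p : ℕ) := by exact_mod_cast h2
      gcongr
    have := hX.abs_integral_mul_kernel_le hc hXm ha hh hH (Nat.lt_succ_of_le h1) hgr hg hε y
    simp only [abs_of_nonneg (hg0 _)] at this
    have h3 := (le_abs_self _).trans this
    have e : ∀ ω, g ω * (h * kernel ε (X (grid a h (i + 1)) ω - y)) =
        h * (g ω * kernel ε (X (grid a h (i + 1)) ω - y)) := fun ω => by ring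
    simp only [e]
    rw [integral_const_mul]
    refine (mul_le_mul_of_nonneg_left h3 hh.le).trans (le_of_eq ?_)
    simp only [Nat.succ_eq_add_one]
    ring
  refine (Finset.sum_le_sum hstep).trans ?_
  rw [← Finset.mul_sum]
  refine (mul_le_mul_of_nonneg_left (sum_Ico_mul_rpow_neg_le (by positivity) hHd hh k p)
    (by positivity)).trans (le_of_eq ?_)
  ring

/-- The conditional mean of the change between two scales carries the small factor ε^γ; this
supplies the constant `κ` of the John–Nirenberg inequality. -/
theorem ConditionalDecay.abs_integral_mul_sum_sub_le (hX : ConditionalDecay P X T H c)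
    (hc : 0 < c) (hXm : ∀ t, Measurable (X t)) (hX0 : ∀ ω, X 0 ω = 0) {a h γ : ℝ} (ha : 0 ≤ a)
    (hh : 0 < h) (hH : 0 < H) (hγ0 : 0 < γ) (hγ : γ ≤ 1) (hHd : H * (d + γ) < 1) {k p : ℕ}
    (hj : a + (k + p : ℕ) * h ≤ T) {g : Ω → ℝ}
    (hg : BddMeas (incrementSigma X (grid a h) k) g) {ε : ℝ} (hε : 0 < ε) (y : E d) :
    |∫ ω, g ω * ∑ i ∈ Finset.Ico k (k + p), h * (kernel ε (X (grid a h (i + 1)) ω - y) -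
        kernel (ε / 2) (X (grid a h (i + 1)) ω - y)) ∂P| ≤
      (c ^ (-(γ / 2)) * √(Real.pi / (c / 2)) ^ d * ε ^ γ) *
        ((p * h) ^ (1 - H * (d + γ)) / (1 - H * (d + γ))) * ∫ ω, |g ω| ∂P := by
  have hle := fun i => incrementSigma_le hXm (grid a h) i
  have hA : 0 ≤ ∫ ω, |g ω| ∂P := integral_nonneg fun ω => abs_nonneg _
  simp only [Finset.mul_sum]
  rw [integral_finsetSum _ fun i _ => ((hg.mono (hle k)).mul ((BddMeas.const h).mul
    (((bddMeas_kernel hX0 a h hε y (i + 1)).mono (hle _)).sub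
      ((bddMeas_kernel hX0 a h (half_pos hε) y (i + 1)).mono (hle _))))).integrable le_rfl]
  have hstep : ∀ i ∈ Finset.Ico k (k + p),
      |∫ ω, g ω * (h * (kernel ε (X (grid a h (i + 1)) ω - y) -
        kernel (ε / 2) (X (grid a h (i + 1)) ω - y))) ∂P| ≤
      ((c ^ (-(γ / 2)) * √(Real.pi / (c / 2)) ^ d * ε ^ γ) * ∫ ω, |g ω| ∂P) *
        (h * (((i + 1 - k : ℕ) : ℝ) * h) ^ (-(H * (d + γ)))) := by
    intro i hi
    obtain ⟨h1, h2⟩ := Finset.mem_Ico.1 hi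
    have hgr : grid a h (i + 1) ≤ T := by
      rw [grid_succ]
      refine le_trans ?_ hj
      have : ((i + 1 : ℕ) : ℝ) ≤ (k + p : ℕ) := by exact_mod_cast h2
      gcongr
    have h3 := hX.abs_integral_mul_kernel_sub_le hc hXm ha hh hH hγ0 hγ (Nat.lt_succ_of_le h1)
      hgr hg hε y
    have e : ∀ ω, g ω * (h * (kernel ε (X (grid a h (i + 1)) ω - y) -
        kernel (ε / 2) (X (grid a h (i + 1)) ω - y))) =
        h * (g ω * (kernel ε (X (grid a h (i + 1)) ω - y) -
          kernel (ε / 2) (X (grid a h (i + 1)) ω - y))) := fun ω => by ring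
    simp only [e]
    rw [integral_const_mul, abs_mul, abs_of_pos hh]
    refine (mul_le_mul_of_nonneg_left h3 hh.le).trans (le_of_eq ?_)
    simp only [Nat.succ_eq_add_one]
    ring
  refine (Finset.abs_sum_le_sum_abs _ _).trans ((Finset.sum_le_sum hstep).trans ?_)
  rw [← Finset.mul_sum]
  refine (mul_le_mul_of_nonneg_left (sum_Ico_mul_rpow_neg_le (by positivity) hHd hh k p)
    (by positivity)).trans (le_of_eq ?_)
  ring

end Grid

end GaussianLocalTime

end


noncomputable section

namespace GaussianLocalTime

variable {Ω : Type*} [mΩ : MeasurableSpace Ω] {P : Measure Ω} [IsProbabilityMeasure P] {d : ℕ}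
  {X : ℝ → Ω → E d} {T H c : ℝ}

/-! ### From integrated tails to suprema over the space variable -/

/-- If for each `ω` in `Q` the events `S N` eventually hold on a whole ball of radius `ρ`, then the
probability of `Q` is controlled by the space integral of the probabilities of `S N`. -/
theorem measure_mul_volume_ball_le {S : ℕ → Set (Ω × E d)} (hS : ∀ N, MeasurableSet (S N))
    {D : ℝ≥0∞} (hD : ∀ᶠ N in atTop, ∫⁻ y, P {ω | (ω, y) ∈ S N} ≤ D) {Q : Set Ω} {ρ : ℝ}
    (hQ : ∀ ω ∈ Q, ∃ x, ∀ y ∈ Metric.ball x ρ, ∀ᶠ N in atTop, (ω, y) ∈ S N) :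
    volume (Metric.ball (0 : E d) ρ) * P Q ≤ D := by
  let f : ℕ → Ω × E d → ℝ≥0∞ := fun N => (S N).indicator 1
  have hf : ∀ N, Measurable (f N) := fun N => measurable_one.indicator (hS N)
  have hlim : Measurable fun p => liminf (fun N => f N p) atTop := .liminf hf
  -- On `Q` the space integral of the liminf of the indicators is at least the volume of a ball.
  -- Markov in `ω` and Fatou on the product then give the claim; `Q` itself need not be measurable.
  have hsub : Q ⊆ {ω | volume (Metric.ball (0 : E d) ρ) ≤
      ∫⁻ y, liminf (fun N => f N (ω, y)) atTop} := by
    intro ω hω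
    obtain ⟨x, hx⟩ := hQ ω hω
    have h1 : ∀ y, (Metric.ball x ρ).indicator (1 : E d → ℝ≥0∞) y ≤
        liminf (fun N => f N (ω, y)) atTop := by
      intro y
      by_cases hy : y ∈ Metric.ball x ρ
      · rw [indicator_of_mem hy]
        refine le_liminf_of_le (by isBoundedDefault) ?_
        filter_upwards [hx y hy] with N hN
        simp [f, hN]
      · rw [indicator_of_notMem hy]; exact zero_le
    have h2 := lintegral_mono (μ := (volume : Measure (E d))) h1
    rw [lintegral_indicator_one Metric.isOpen_ball.measurableSet] at h2
    have h3 : volume (Metric.ball x ρ) = volume (Metric.ball (0 : E d) ρ) :=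
      Measure.addHaar_ball_center volume x ρ
    rwa [h3] at h2
  have hmk := mul_meas_ge_le_lintegral (μ := P)
    (f := fun ω => ∫⁻ y, liminf (fun N => f N (ω, y)) atTop)
    (hlim.lintegral_prod_right' (ν := (volume : Measure (E d))))
    (volume (Metric.ball (0 : E d) ρ))
  refine (mul_le_mul_right (measure_mono hsub) _).trans (hmk.trans ?_)
  rw [← lintegral_prod _ hlim.aemeasurable]
  refine (lintegral_liminf_le hf).trans ?_
  refine liminf_le_of_frequently_le' (Eventually.frequently ?_)
  filter_upwards [hD] with N hN
  rw [lintegral_indicator_one (hS N), Measure.prod_apply_symm (hS N)]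
  exact hN

theorem lintegral_lintegral_kernel {U : Ω → E d} (hU : Measurable U) {ε : ℝ} (hε : 0 < ε) :
    ∫⁻ y, ∫⁻ ω, ENNReal.ofReal (kernel ε (U ω - y)) ∂P = 1 := by
  rw [lintegral_lintegral_swap]
  · simp [lintegral_kernel_sub hε]
  · refine Measurable.aemeasurable ?_
    exact ((continuous_kernel ε).measurable.comp
      ((hU.comp measurable_snd).sub measurable_fst)).ennreal_ofReal

theorem measurable_lintegral_kernel {U : Ω → E d} (hU : Measurable U) (ε : ℝ) :
    Measurable fun y => ∫⁻ ω, ENNReal.ofReal (kernel ε (U ω - y)) ∂P := by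
  refine Measurable.lintegral_prod_left' (f := fun p : Ω × E d =>
    ENNReal.ofReal (kernel ε (U p.1 - p.2))) ?_
  exact ((continuous_kernel ε).measurable.comp
    ((hU.comp measurable_fst).sub measurable_snd)).ennreal_ofReal

/-- Each kernel has mass one in `y`, so integrating over all of space returns the elapsed time. No
decay of the tail bounds in `y` is needed besides this. -/
theorem lintegral_ofReal_integral_sum_kernel (hXm : ∀ t, Measurable (X t)) {h ε : ℝ} (hh : 0 ≤ h)
    (hε : 0 < ε) (t : ℕ → ℝ) (n : ℕ) :
    ∫⁻ y, ENNReal.ofReal (∫ ω, ∑ i ∈ Finset.range n, h * kernel ε (X (t i) ω - y) ∂P) =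
      ENNReal.ofReal (n * h) := by
  have hk : ∀ y i, BddMeas mΩ fun ω => kernel ε (X (t i) ω - y) := fun y i =>
    ⟨(continuous_kernel ε).measurable.comp ((hXm _).sub_const y), (ε ^ d)⁻¹, fun ω => by
      rw [abs_of_nonneg (kernel_nonneg hε _)]; exact kernel_le hε _⟩
  have e : ∀ y, ENNReal.ofReal (∫ ω, ∑ i ∈ Finset.range n, h * kernel ε (X (t i) ω - y) ∂P) =
      ∑ i ∈ Finset.range n,
        ENNReal.ofReal h * ∫⁻ ω, ENNReal.ofReal (kernel ε (X (t i) ω - y)) ∂P := by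
    intro y
    rw [integral_finsetSum _ fun i _ => ((hk y i).integrable le_rfl).const_mul h,
      ENNReal.ofReal_sum_of_nonneg fun i _ => integral_nonneg fun ω =>
        mul_nonneg hh (kernel_nonneg hε _)]
    refine Finset.sum_congr rfl fun i _ => ?_
    rw [integral_const_mul, ENNReal.ofReal_mul hh, ofReal_integral_eq_lintegral_ofReal
      ((hk y i).integrable le_rfl) (Eventually.of_forall fun ω => kernel_nonneg hε _)]
  simp only [e]
  rw [lintegral_finsetSum _ fun i _ => (measurable_lintegral_kernel (hXm _) ε).const_mul _]
  have e2 : ∀ i ∈ Finset.range n, ∫⁻ y, ENNReal.ofReal h *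
      ∫⁻ ω, ENNReal.ofReal (kernel ε (X (t i) ω - y)) ∂P = ENNReal.ofReal h := fun i _ => by
    rw [lintegral_const_mul _ (measurable_lintegral_kernel (hXm _) ε),
      lintegral_lintegral_kernel (hXm _) hε, mul_one]
  rw [Finset.sum_congr rfl e2, Finset.sum_const, Finset.card_range, nsmul_eq_mul,
    ENNReal.ofReal_mul (Nat.cast_nonneg n), ENNReal.ofReal_natCast]

/-! ### Differences of mollified local times -/

/-- The mollified local time over `[a, t]`. -/
def mollified (f : ℝ → E d) (ε : ℝ) (x : E d) (a t : ℝ) : ℝ := ∫ s in a..t, kernel ε (f s - x)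

theorem abs_mollified_sub_le {f : ℝ → E d} (hf : Continuous f) {ε : ℝ} (hε : 0 < ε) (x y : E d)
    {a r t : ℝ} (ht : t ∈ Icc a (a + r)) :
    |mollified f ε x a t - mollified f ε y a t| ≤ r * (ε ^ (d + 1))⁻¹ * ‖x - y‖ := by
  have hk := continuous_kernel (d := d) ε
  unfold mollified
  rw [← intervalIntegral.integral_sub ((by fun_prop : Continuous _).intervalIntegrable _ _)
    ((by fun_prop : Continuous _).intervalIntegrable _ _), ← Real.norm_eq_abs]
  refine (intervalIntegral.norm_integral_le_of_norm_le_const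
    (C := (ε ^ (d + 1))⁻¹ * ‖x - y‖) fun s _ => ?_).trans ?_
  · refine (abs_kernel_sub_le hε _ _).trans (le_of_eq ?_)
    rw [show f s - x - (f s - y) = -(x - y) by abel, norm_neg]
  · rw [abs_of_nonneg (by linarith [ht.1])]
    have h1 : t - a ≤ r := by linarith [ht.2]
    calc (ε ^ (d + 1))⁻¹ * ‖x - y‖ * (t - a) ≤ (ε ^ (d + 1))⁻¹ * ‖x - y‖ * r := by gcongr
      _ = _ := by ring

/-- The John–Nirenberg inequality for each `y`, with differences of kernels as `a i` and their sums
as `b i`; two kernels explain the factor 2 in `hMdef` and in `2 * r`. The step bound tends to 0 with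
the mesh, so eventually β ≤ κ and β ≤ K, which gives (2κ + β) M ≤ 3κM = K² and β + 4K ≤ 5K. -/
theorem lintegral_measure_maxExceeds_le (hX : ConditionalDecay P X T H c) (hc : 0 < c)
    (hXm : ∀ t, Measurable (X t)) (hX0 : ∀ ω, X 0 ω = 0) {a r γ ε : ℝ} (ha : 0 ≤ a) (hr : 0 < r)
    (har : a + r ≤ T) (hH : 0 < H) (hγ0 : 0 < γ) (hγ : γ ≤ 1) (hHd : H * (d + γ) < 1)
    (hε : 0 < ε) {κ M : ℝ} (hM : 0 < M) (hκ : 0 < κ)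
    (hMdef : 2 * (√(Real.pi / c) ^ d * (r ^ (1 - H * d) / (1 - H * d))) ≤ M)
    (hκdef : (c ^ (-(γ / 2)) * √(Real.pi / (c / 2)) ^ d * ε ^ γ) *
        (r ^ (1 - H * (d + γ)) / (1 - H * (d + γ))) ≤ κ) (j : ℕ) :
    ∀ᶠ N : ℕ in atTop, ∫⁻ y, P (maxExceeds (fun i ω => r / N *
        (kernel ε (X (grid a (r / N) (i + 1)) ω - y) -
          kernel (ε / 2) (X (grid a (r / N) (i + 1)) ω - y))) N ((j + 1) * (5 * √(3 * κ * M)))) ≤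
      ENNReal.ofReal ((1 / 2) ^ j * ((5 * √(3 * κ * M))⁻¹ * (2 * r))) := by
  have hHd' : H * d < 1 := by
    have : H * d ≤ H * (d + γ) := by gcongr; linarith
    linarith
  set K := √(3 * κ * M) with hK
  have hK0 : 0 < K := Real.sqrt_pos.2 (by positivity)
  have hlim : Tendsto (fun N : ℕ => 2 * (r / N) * ((ε / 2) ^ d)⁻¹) atTop (𝓝 0) := by
    have := (tendsto_const_div_atTop_nhds_zero_nat r).const_mul 2 |>.mul_const ((ε / 2) ^ d)⁻¹
    simpa using this
  filter_upwards [hlim.eventually (ge_mem_nhds (lt_min hκ hK0)), eventually_ge_atTop 1]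
    with N hβ hN
  set h := r / N with hh
  have hNpos : (0 : ℝ) < N := by exact_mod_cast hN
  have hhpos : 0 < h := by positivity
  have hNh : N * h = r := by rw [hh]; field_simp
  set β := 2 * h * ((ε / 2) ^ d)⁻¹ with hβdef
  have hβ0 : 0 ≤ β := by positivity
  have hk1 : ∀ y i, BddMeas (incrementSigma X (grid a h) i)
      fun ω => kernel ε (X (grid a h i) ω - y) := fun y i => bddMeas_kernel hX0 a h hε y i
  have hk2 : ∀ y i, BddMeas (incrementSigma X (grid a h) i)
      fun ω => kernel (ε / 2) (X (grid a h i) ω - y) :=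
    fun y i => bddMeas_kernel hX0 a h (half_pos hε) y i
  have hph : ∀ p ≤ N, (p : ℝ) * h ≤ r := fun p hp => by
    have : (p : ℝ) ≤ N := by exact_mod_cast hp
    rw [← hNh]; gcongr
  have hpT : ∀ k p, k + p = N → a + (k + p : ℕ) * h ≤ T := fun k p hp => by
    rw [hp, hNh]; exact har
  have key : ∀ y, P (maxExceeds (fun i ω => h * (kernel ε (X (grid a h (i + 1)) ω - y) -
      kernel (ε / 2) (X (grid a h (i + 1)) ω - y))) N ((j + 1) * (5 * K))) ≤
      ENNReal.ofReal ((1 / 2) ^ j * (5 * K)⁻¹) *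
      (ENNReal.ofReal (∫ ω, ∑ i ∈ Finset.range N, h * kernel ε (X (grid a h (i + 1)) ω - y) ∂P) +
       ENNReal.ofReal
        (∫ ω, ∑ i ∈ Finset.range N, h * kernel (ε / 2) (X (grid a h (i + 1)) ω - y) ∂P)) := by
    intro y
    have hI : ∀ {η : ℝ}, 0 < η → Integrable (fun ω => ∑ i ∈ Finset.range N,
        h * kernel η (X (grid a h (i + 1)) ω - y)) P := fun hη =>
      (BddMeas.finsetSum fun i _ => (BddMeas.const h).mul
        ((bddMeas_kernel hX0 a h hη y (i + 1)).mono (incrementSigma_le hXm _ _))).integrable le_rfl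
    have hnn : ∀ {η : ℝ}, 0 < η → 0 ≤ ∫ ω, ∑ i ∈ Finset.range N,
        h * kernel η (X (grid a h (i + 1)) ω - y) ∂P := fun hη => integral_nonneg fun ω =>
      Finset.sum_nonneg fun i _ => mul_nonneg hhpos.le (kernel_nonneg hη _)
    have hJN := measureReal_maxExceeds_le_pow (P := P) (N := N) (F := incrementSigma X (grid a h))
      (a := fun i ω => h * (kernel ε (X (grid a h (i + 1)) ω - y) -
        kernel (ε / 2) (X (grid a h (i + 1)) ω - y)))
      (b := fun i ω => h * kernel ε (X (grid a h (i + 1)) ω - y) +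
        h * kernel (ε / 2) (X (grid a h (i + 1)) ω - y))
      (κ := κ) (M := M) (β := β) (K := K) (B := 5 * K)
      (fun _ _ hij => incrementSigma_mono X _ hij) (incrementSigma_le hXm _)
      (fun i _ => (BddMeas.const h).mul ((hk1 y (i + 1)).sub (hk2 y (i + 1))))
      (fun i _ => ((BddMeas.const h).mul (hk1 y (i + 1))).add
        ((BddMeas.const h).mul (hk2 y (i + 1)))) ?_ ?_ hκ.le hβ0 ?_ ?_ hK0 ?_ ?_ j
    · have e : ∀ ω, ∑ i ∈ Finset.range N, (h * kernel ε (X (grid a h (i + 1)) ω - y) +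
          h * kernel (ε / 2) (X (grid a h (i + 1)) ω - y)) =
          ∑ i ∈ Finset.range N, h * kernel ε (X (grid a h (i + 1)) ω - y) +
          ∑ i ∈ Finset.range N, h * kernel (ε / 2) (X (grid a h (i + 1)) ω - y) := fun ω =>
        Finset.sum_add_distrib
      simp only [e] at hJN
      rw [integral_add (hI hε) (hI (half_pos hε)), ← mul_assoc ((1 / 2 : ℝ) ^ j)] at hJN
      rw [← ENNReal.ofReal_add (hnn hε) (hnn (half_pos hε)), ← ENNReal.ofReal_mul (by positivity)]
      rw [← ofReal_measureReal]
      exact ENNReal.ofReal_le_ofReal hJN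
    · intro i _ ω
      have h1 := kernel_nonneg hε (X (grid a h (i + 1)) ω - y)
      have h2 := kernel_nonneg (half_pos hε) (X (grid a h (i + 1)) ω - y)
      rw [abs_mul, abs_of_pos hhpos, ← mul_add]
      refine mul_le_mul_of_nonneg_left ?_ hhpos.le
      rw [abs_le]; constructor <;> linarith
    · intro i _ ω
      have h1 := kernel_le hε (X (grid a h (i + 1)) ω - y)
      have h2 := kernel_le (half_pos hε) (X (grid a h (i + 1)) ω - y)
      have h3 : (ε ^ d)⁻¹ ≤ ((ε / 2) ^ d)⁻¹ := by
        gcongr; linarith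
      rw [hβdef, ← mul_add]
      nlinarith
    · intro k hk g hg
      obtain ⟨p, rfl⟩ := Nat.exists_eq_add_of_le hk
      refine (hX.abs_integral_mul_sum_sub_le hc hXm hX0 ha hhpos hH hγ0 hγ hHd
        (hpT k p rfl) hg hε y).trans ?_
      refine mul_le_mul_of_nonneg_right (le_trans ?_ hκdef) (integral_nonneg fun _ => abs_nonneg _)
      have h1 : 0 < 1 - H * (d + γ) := by linarith
      refine mul_le_mul_of_nonneg_left ?_ (by positivity)
      refine div_le_div_of_nonneg_right ?_ h1.le
      exact Real.rpow_le_rpow (by positivity) (hph p (by omega)) h1.le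
    · intro k hk g hg hg0
      obtain ⟨p, rfl⟩ := Nat.exists_eq_add_of_le hk
      have h1 : 0 < 1 - H * d := by linarith
      have hI2 : ∀ {η : ℝ}, 0 < η → Integrable (fun ω => g ω * ∑ i ∈ Finset.Ico k (k + p),
          h * kernel η (X (grid a h (i + 1)) ω - y)) P := fun hη =>
        ((hg.mono (incrementSigma_le hXm _ _)).mul
          (BddMeas.finsetSum fun i _ => (BddMeas.const h).mul
          ((bddMeas_kernel hX0 a h hη y (i + 1)).mono
            (incrementSigma_le hXm _ _)))).integrable le_rfl
      simp only [Finset.sum_add_distrib, mul_add]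
      rw [integral_add (hI2 hε) (hI2 (half_pos hε))]
      have s1 := hX.integral_mul_sum_le hc hXm hX0 ha hhpos hH hHd' (hpT k p rfl) hg hg0 hε y
      have s2 := hX.integral_mul_sum_le hc hXm hX0 ha hhpos hH hHd' (hpT k p rfl) hg hg0
        (half_pos hε) y
      have s3 : √(Real.pi / c) ^ d * ((p * h) ^ (1 - H * d) / (1 - H * d)) ≤
          √(Real.pi / c) ^ d * (r ^ (1 - H * d) / (1 - H * d)) := by
        refine mul_le_mul_of_nonneg_left ?_ (by positivity)
        refine div_le_div_of_nonneg_right ?_ h1.le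
        exact Real.rpow_le_rpow (by positivity) (hph p (by omega)) h1.le
      have hg' : 0 ≤ ∫ ω, g ω ∂P := integral_nonneg hg0
      have s4 := mul_le_mul_of_nonneg_right s3 hg'
      have s5 := mul_le_mul_of_nonneg_right hMdef hg'
      linarith
    · rw [Real.sq_sqrt (by positivity)]
      have : β ≤ κ := hβ.trans (min_le_left _ _)
      nlinarith
    · have : β ≤ K := hβ.trans (min_le_right _ _)
      linarith
  refine (lintegral_mono key).trans (le_of_eq ?_)
  have hmeas : ∀ {η : ℝ}, 0 < η → Measurable fun y => ENNReal.ofReal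
      (∫ ω, ∑ i ∈ Finset.range N, h * kernel η (X (grid a h (i + 1)) ω - y) ∂P) := by
    intro η hη
    refine Measurable.ennreal_ofReal (StronglyMeasurable.measurable ?_)
    refine StronglyMeasurable.integral_prod_left' (f := fun p : Ω × E d =>
      ∑ i ∈ Finset.range N, h * kernel η (X (grid a h (i + 1)) p.1 - p.2)) ?_
    refine Measurable.stronglyMeasurable (Finset.measurable_sum _ fun i _ => ?_)
    exact ((continuous_kernel η).measurable.comp
      (((hXm _).comp measurable_fst).sub measurable_snd)).const_mul h
  rw [lintegral_const_mul _ ((hmeas hε).fun_add (hmeas (half_pos hε))), lintegral_add_left (hmeas hε),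
    lintegral_ofReal_integral_sum_kernel hXm hhpos.le hε (fun i => grid a h (i + 1)),
    lintegral_ofReal_integral_sum_kernel hXm hhpos.le (half_pos hε) (fun i => grid a h (i + 1)),
    hNh, ← ENNReal.ofReal_add hr.le hr.le, ← ENNReal.ofReal_mul (by positivity)]
  congr 1
  ring

end GaussianLocalTime

end


/-! ### Tails of mollified local times, uniformly in space -/

noncomputable section

namespace GaussianLocalTime

theorem measure_le_of_volume_ball_mul_le {Ω : Type*} [MeasurableSpace Ω] {P : Measure Ω} {d : ℕ}
    {ρ D : ℝ} (hρ : 0 < ρ) {Q : Set Ω}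
    (h : volume (Metric.ball (0 : E d) ρ) * P Q ≤ ENNReal.ofReal D) :
    P Q ≤ ENNReal.ofReal (D / (ρ ^ d * (volume (Metric.ball (0 : E d) 1)).toReal)) := by
  have h1 : volume (Metric.ball (0 : E d) 1) ≠ ∞ := measure_ball_lt_top.ne
  have h2 : 0 < (volume (Metric.ball (0 : E d) 1)).toReal :=
    ENNReal.toReal_pos (Metric.measure_ball_pos volume 0 one_pos).ne' h1
  rw [Measure.addHaar_ball_of_pos volume 0 hρ, finrank_euclideanSpace_fin,
    ← ENNReal.ofReal_toReal h1, ← ENNReal.ofReal_mul (by positivity)] at h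
  rw [ENNReal.ofReal_div_of_pos (by positivity), ENNReal.le_div_iff_mul_le
    (Or.inl (by rw [Ne, ENNReal.ofReal_eq_zero, not_le]; positivity)) (Or.inl ENNReal.ofReal_ne_top),
    mul_comm]
  exact h

variable {Ω : Type*} [mΩ : MeasurableSpace Ω] {P : Measure Ω} [IsProbabilityMeasure P] {d : ℕ}
  {X : ℝ → Ω → E d} {T H c : ℝ}

theorem eventually_lt_abs_riemannSum {f : ℝ → ℝ} (hf : Continuous f) {a r t l : ℝ} (hr : 0 < r)
    (ht : t ∈ Icc a (a + r)) (hl : l < |∫ s in a..t, f s|) :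
    ∀ᶠ N : ℕ in atTop, ∃ k ≤ N,
      l < |∑ i ∈ Finset.range k, r / N * f (grid a (r / N) (i + 1))| := by
  obtain ⟨k, hkN, hk⟩ := exists_tendsto_riemannSum hf hr ht
  filter_upwards [hk.abs.eventually (lt_mem_nhds hl)] with N hN
  exact ⟨k N, hkN N, by simpa only [grid_succ] using hN⟩

/-- Tails of the difference of two mollified local times, uniformly in space. -/
theorem ConditionalDecay.exists_measure_mollified_sub_le (hX : ConditionalDecay P X T H c)
    (hc : 0 < c) (hXm : ∀ t, Measurable (X t)) (hXc : ∀ ω, Continuous fun t => X t ω)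
    (hX0 : ∀ ω, X 0 ω = 0) {γ : ℝ} (hH : 0 < H) (hγ0 : 0 < γ) (hγ : γ ≤ 1)
    (hHd : H * (d + γ) < 1) :
    ∃ B C : ℝ, 0 < B ∧ 0 < C ∧ ∀ a r q : ℝ, 0 ≤ a → 0 < r → a + r ≤ T → 0 < q → q ≤ 1 → ∀ j : ℕ,
      P {ω | ∃ x, ∃ t ∈ Icc a (a + r), 2 * ((j + 1) * (B * q ^ (γ / 2) * (r / (r ^ H) ^ d))) <
        |mollified (fun s => X s ω) (q * r ^ H) x a t -
          mollified (fun s => X s ω) (q * r ^ H / 2) x a t|} ≤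
        ENNReal.ofReal (C * (1 / 2) ^ j * (q ^ (1 + d * (d + 2)))⁻¹) := by
  have hHd' : H * d < 1 := by
    have : H * d ≤ H * (d + γ) := by gcongr; linarith
    linarith
  have h1 : 0 < 1 - H * d := by linarith
  have h2 : 0 < 1 - H * (d + γ) := by linarith
  have hpi := Real.pi_pos
  set c₁ : ℝ := √(Real.pi / c) ^ d / (1 - H * d) with hc₁
  set c₂ : ℝ := c ^ (-(γ / 2)) * √(Real.pi / (c / 2)) ^ d / (1 - H * (d + γ)) with hc₂
  have hc₁0 : 0 < c₁ := by positivity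
  have hc₂0 : 0 < c₂ := by positivity
  set v : ℝ := (volume (Metric.ball (0 : E d) 1)).toReal with hv
  have hv0 : 0 < v := ENNReal.toReal_pos (Metric.measure_ball_pos volume 0 one_pos).ne'
    measure_ball_lt_top.ne
  -- With M = 2 c₁ r / R^d and κ = c₂ q^γ r / R^d, the level 5 √(3 κ M) equals B q^(γ/2) r / R^d,
  -- where R = r^H is the natural space scale and q is the mollification width relative to it.
  set B : ℝ := 5 * √(6 * c₁ * c₂) with hB
  have hB0 : 0 < B := by positivity
  refine ⟨B, 2 / (B * (B / 2 ^ (d + 2)) ^ d * v), hB0, by positivity, ?_⟩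
  intro a r q ha hr har hq hq1 j
  set R := r ^ H with hR
  have hR0 : 0 < R := Real.rpow_pos_of_pos hr H
  set Γ := q ^ (γ / 2) with hΓ
  have hΓ0 : 0 < Γ := Real.rpow_pos_of_pos hq _
  have hΓq : q ≤ Γ := by
    conv_lhs => rw [← Real.rpow_one q]
    exact Real.rpow_le_rpow_of_exponent_ge hq hq1 (by linarith)
  set ε := q * R with hε
  have hε0 : 0 < ε := by positivity
  have hrS : r ^ (1 - H * d) = r / R ^ d := by
    rw [Real.rpow_sub hr, Real.rpow_one, Real.rpow_mul hr.le, Real.rpow_natCast]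
  have hrSγ : ε ^ γ * r ^ (1 - H * (d + γ)) = Γ ^ 2 * (r / R ^ d) := by
    have e1 : r ^ (1 - H * (d + γ)) = (r / R ^ d) * (R ^ γ)⁻¹ := by
      rw [← hrS, hR, ← Real.rpow_mul hr.le, ← Real.rpow_neg hr.le, ← Real.rpow_add hr]
      congr 1; ring
    have e2 : q ^ γ = Γ ^ 2 := by
      rw [hΓ, ← Real.rpow_natCast, ← Real.rpow_mul hq.le]; congr 1; push_cast; ring
    rw [e1, hε, Real.mul_rpow hq.le hR0.le, e2]
    field_simp
  set M := 2 * c₁ * (r / R ^ d) with hM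
  set κ := c₂ * Γ ^ 2 * (r / R ^ d) with hκ
  have hK : 5 * √(3 * κ * M) = B * Γ * (r / R ^ d) := by
    rw [show 3 * κ * M = (6 * c₁ * c₂) * (Γ * (r / R ^ d)) ^ 2 by rw [hκ, hM]; ring,
      Real.sqrt_mul (by positivity), Real.sqrt_sq (by positivity), hB]
    ring
  have hev := lintegral_measure_maxExceeds_le hX hc hXm hX0 ha hr har hH hγ0 hγ hHd hε0
    (κ := κ) (M := M) (by positivity) (by positivity)
    (by rw [hrS, hM, hc₁]; apply le_of_eq; ring)
    (by
      apply le_of_eq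
      calc _ = c ^ (-(γ / 2)) * √(Real.pi / (c / 2)) ^ d / (1 - H * (d + γ)) *
            (ε ^ γ * r ^ (1 - H * (d + γ))) := by ring
        _ = κ := by rw [hrSγ, hκ, hc₂]; ring) j
  rw [hK] at hev
  set B' := B * Γ * (r / R ^ d) with hB'
  have hB'0 : 0 < B' := by positivity
  -- Moving `x` by at most `ρ` changes the two mollified local times by at most `B'` altogether; the
  -- factor 2 in the threshold pays for this.
  set ρ := B' * (ε / 2) ^ (d + 1) / (2 * r) with hρ
  have hρ0 : 0 < ρ := by positivity
  have hker : ∀ ω x, Continuous fun s => kernel ε (X s ω - x) - kernel (ε / 2) (X s ω - x) := by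
    intro ω x
    have h3 := hXc ω
    have h4 := continuous_kernel (d := d) ε
    have h5 := continuous_kernel (d := d) (ε / 2)
    fun_prop
  have hdiff : ∀ ω x t, mollified (fun s => X s ω) ε x a t -
      mollified (fun s => X s ω) (ε / 2) x a t =
      ∫ s in a..t, (kernel ε (X s ω - x) - kernel (ε / 2) (X s ω - x)) := by
    intro ω x t
    have h3 := hXc ω
    have h4 := continuous_kernel (d := d) ε
    have h5 := continuous_kernel (d := d) (ε / 2)
    unfold mollified
    rw [intervalIntegral.integral_sub ((by fun_prop : Continuous _).intervalIntegrable _ _)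
      ((by fun_prop : Continuous _).intervalIntegrable _ _)]
  have key := measure_mul_volume_ball_le (P := P) (ρ := ρ) (S := fun N : ℕ =>
    {p : Ω × E d | p.1 ∈ maxExceeds (fun i ω => r / N *
      (kernel ε (X (grid a (r / N) (i + 1)) ω - p.2) -
        kernel (ε / 2) (X (grid a (r / N) (i + 1)) ω - p.2))) N ((j + 1) * B')}) ?_ hev
    (Q := {ω | ∃ x, ∃ t ∈ Icc a (a + r), 2 * ((j + 1) * B') <
        |mollified (fun s => X s ω) ε x a t - mollified (fun s => X s ω) (ε / 2) x a t|}) ?_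
  · refine (measure_le_of_volume_ball_mul_le hρ0 key).trans (ENNReal.ofReal_le_ofReal ?_)
    have e1 : ρ = (B / 2 ^ (d + 2)) * (Γ * q ^ (d + 1)) * R := by
      rw [hρ, hB', hε, div_pow, mul_pow]
      field_simp
      ring
    have e2 : B'⁻¹ * (2 * r) = 2 * R ^ d / (B * Γ) := by
      rw [hB']; field_simp
    rw [e1, e2, ← hv]
    -- As `Γ ≥ q`, dividing by the ball volume costs only a power of `q⁻¹`, which the free parameter
    -- `j` can beat geometrically.
    have e3 : q ^ (1 + d * (d + 2)) ≤ Γ * (Γ * q ^ (d + 1)) ^ d := by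
      calc q ^ (1 + d * (d + 2)) = q * (q * q ^ (d + 1)) ^ d := by
            rw [← pow_succ', ← pow_mul, ← pow_succ']
            congr 1; ring
        _ ≤ _ := by gcongr
    calc (1 / 2) ^ j * (2 * R ^ d / (B * Γ)) /
          (((B / 2 ^ (d + 2)) * (Γ * q ^ (d + 1)) * R) ^ d * v)
        = 2 / (B * (B / 2 ^ (d + 2)) ^ d * v) * (1 / 2) ^ j * (Γ * (Γ * q ^ (d + 1)) ^ d)⁻¹ := by
          rw [mul_pow _ R, mul_pow (B / 2 ^ (d + 2))]
          generalize (Γ * q ^ (d + 1)) ^ d = A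
          generalize (B / 2 ^ (d + 2)) ^ d = A'
          have : R ^ d ≠ 0 := by positivity
          field_simp
      _ ≤ _ := by gcongr
  · intro N
    have : {p : Ω × E d | p.1 ∈ maxExceeds (fun i ω => r / N *
        (kernel ε (X (grid a (r / N) (i + 1)) ω - p.2) -
          kernel (ε / 2) (X (grid a (r / N) (i + 1)) ω - p.2))) N ((j + 1) * B')} =
        ⋃ k ∈ Finset.range (N + 1), {p : Ω × E d | (j + 1) * B' < |∑ i ∈ Finset.range k, r / N *
        (kernel ε (X (grid a (r / N) (i + 1)) p.1 - p.2) -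
          kernel (ε / 2) (X (grid a (r / N) (i + 1)) p.1 - p.2))|} := by
      ext p
      simp [maxExceeds]
    rw [this]
    refine Finset.measurableSet_biUnion _ fun k _ => measurableSet_lt measurable_const ?_
    refine (Finset.measurable_sum _ fun i _ => Measurable.const_mul ?_ _).abs
    have hm : Measurable fun p : Ω × E d => X (grid a (r / N) (i + 1)) p.1 - p.2 :=
      ((hXm _).comp measurable_fst).sub measurable_snd
    exact ((continuous_kernel ε).measurable.comp hm).sub
      ((continuous_kernel (ε / 2)).measurable.comp hm)
  · rintro ω ⟨x, t, ht, hxt⟩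
    refine ⟨x, fun y hy => ?_⟩
    have l1 := abs_mollified_sub_le (hXc ω) hε0 x y ht
    have l2 := abs_mollified_sub_le (hXc ω) (half_pos hε0) x y ht
    have hxy : ‖x - y‖ ≤ ρ := by
      rw [← dist_eq_norm, dist_comm]; exact (Metric.mem_ball.1 hy).le
    have l3 : r * (ε ^ (d + 1))⁻¹ * ‖x - y‖ + r * ((ε / 2) ^ (d + 1))⁻¹ * ‖x - y‖ ≤ B' := by
      have h3 : (ε ^ (d + 1))⁻¹ ≤ ((ε / 2) ^ (d + 1))⁻¹ := by gcongr; linarith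
      calc _ ≤ r * ((ε / 2) ^ (d + 1))⁻¹ * ρ + r * ((ε / 2) ^ (d + 1))⁻¹ * ρ := by gcongr
        _ = B' := by rw [hρ]; field_simp; ring
    have hjB : B' ≤ (j + 1) * B' := le_mul_of_one_le_left hB'0.le (by
      have : (0 : ℝ) ≤ j := Nat.cast_nonneg j
      linarith)
    have l4 : (j + 1) * B' < |∫ s in a..t, (kernel ε (X s ω - y) - kernel (ε / 2) (X s ω - y))| := by
      rw [← hdiff]
      have e : mollified (fun s => X s ω) ε x a t - mollified (fun s => X s ω) (ε / 2) x a t =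
          (mollified (fun s => X s ω) ε y a t - mollified (fun s => X s ω) (ε / 2) y a t) +
          (mollified (fun s => X s ω) ε x a t - mollified (fun s => X s ω) ε y a t) -
          (mollified (fun s => X s ω) (ε / 2) x a t -
            mollified (fun s => X s ω) (ε / 2) y a t) := by ring
      rw [e] at hxt
      have l5 := hxt.trans_le ((abs_sub _ _).trans (add_le_add_left (abs_add_le _ _) _))
      linarith
    filter_upwards [eventually_lt_abs_riemannSum (hker ω y) hr ht l4] with N hN
    exact hN

/-- Tails of a mollified local time, uniformly in space. -/
theorem ConditionalDecay.exists_measure_mollified_le (hX : ConditionalDecay P X T H c)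
    (hc : 0 < c) (hXm : ∀ t, Measurable (X t)) (hXc : ∀ ω, Continuous fun t => X t ω)
    (hX0 : ∀ ω, X 0 ω = 0) (hH : 0 < H) (hHd : H * d < 1) :
    ∃ B C : ℝ, 0 < B ∧ 0 < C ∧ ∀ a r q : ℝ, 0 ≤ a → 0 < r → a + r ≤ T → 0 < q →
      ∀ N : ℕ, 1 ≤ N →
      P {ω | ∃ x, B * (N : ℝ) ^ (H * d) * (r / (r ^ H) ^ d) <
        mollified (fun s => X s ω) (q * r ^ H) x a (a + r)} ≤
        ENNReal.ofReal (C * (N * Real.exp (-N)) * (q ^ (d * (d + 1)))⁻¹) := by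
  have h1 : 0 < 1 - H * d := by linarith
  have hpi := Real.pi_pos
  set c₁ : ℝ := √(Real.pi / c) ^ d / (1 - H * d) with hc₁
  have hc₁0 : 0 < c₁ := by positivity
  set v : ℝ := (volume (Metric.ball (0 : E d) 1)).toReal with hv
  have hv0 : 0 < v := ENNReal.toReal_pos (Metric.measure_ball_pos volume 0 one_pos).ne'
    measure_ball_lt_top.ne
  -- The term `8 * c₁` is the Khasminskii threshold 4N / l = 8 N M; the extra 1 pays for passing
  -- from a point to a ball.
  refine ⟨8 * c₁ + 1, (c₁ * v)⁻¹, by positivity, by positivity, ?_⟩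
  intro a r q ha hr har hq N hN
  have hN0 : (0 : ℝ) < N := by exact_mod_cast hN
  have hN1 : (1 : ℝ) ≤ N := by exact_mod_cast hN
  set R := r ^ H with hR
  have hR0 : 0 < R := Real.rpow_pos_of_pos hr H
  set ε := q * R with hε
  have hε0 : 0 < ε := by positivity
  have hrS : r ^ (1 - H * d) = r / R ^ d := by
    rw [Real.rpow_sub hr, Real.rpow_one, Real.rpow_mul hr.le, Real.rpow_natCast]
  set A := (N : ℝ) ^ (H * d) with hA
  have hA1 : 1 ≤ A := Real.one_le_rpow hN1 (by positivity)
  -- The conditional mean over one of the `N` blocks of duration r / N. Each block is later divided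
  -- into `G` grid cells, with `G` tending to infinity and `N` fixed.
  set M := c₁ * (r / N) ^ (1 - H * d) with hM
  have hM0 : 0 < M := by positivity
  have hMeq : M = c₁ * (r / R ^ d) * (A / N) := by
    rw [hM, Real.div_rpow hr.le hN0.le, hrS, Real.rpow_sub hN0, Real.rpow_one, ← hA]
    field_simp
  set l := 1 / (2 * M) with hl
  have hl0 : 0 < l := by positivity
  set thr := 4 * N / l with hthr
  have hthr' : thr = 8 * c₁ * A * (r / R ^ d) := by
    rw [hthr, hl, hMeq]; field_simp; ring
  set ρ := ε ^ (d + 1) / R ^ d with hρ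
  have hρ0 : 0 < ρ := by positivity
  have hlim : Tendsto (fun G : ℕ => l * (r / (N * G : ℕ) * (ε ^ d)⁻¹)) atTop (𝓝 0) := by
    have h2 : Tendsto (fun G : ℕ => N * G) atTop atTop :=
      tendsto_id.const_mul_atTop' (by omega)
    have := (((tendsto_const_div_atTop_nhds_zero_nat r).comp h2).mul_const
      ((ε ^ d)⁻¹)).const_mul l
    simpa using this
  have hev : ∀ᶠ G : ℕ in atTop, ∫⁻ y, P {ω | thr < ∑ i ∈ Finset.range (N * G),
      r / (N * G : ℕ) * kernel ε (X (grid a (r / (N * G : ℕ)) (i + 1)) ω - y)} ≤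
      ENNReal.ofReal (2 * l * Real.exp (-N) * r) := by
    filter_upwards [hlim.eventually (ge_mem_nhds one_pos), eventually_ge_atTop 1] with G hβ hG
    have hG0 : (0 : ℝ) < G := by exact_mod_cast hG
    set h := r / (N * G : ℕ) with hh
    have hNG : (0 : ℝ) < (N * G : ℕ) := by push_cast; positivity
    have hhpos : 0 < h := by positivity
    have hNh : (N * G : ℕ) * h = r := by rw [hh]; field_simp
    have hGh : (G : ℝ) * h = r / N := by rw [hh]; push_cast; field_simp
    have hk : ∀ y i, BddMeas (incrementSigma X (grid a h) (i + 1))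
      fun ω => h * kernel ε (X (grid a h (i + 1)) ω - y) := fun y i =>
        (BddMeas.const h).mul (bddMeas_kernel hX0 a h hε0 y (i + 1))
    have key : ∀ y, P {ω | thr < ∑ i ∈ Finset.range (N * G),
        h * kernel ε (X (grid a h (i + 1)) ω - y)} ≤
        ENNReal.ofReal (2 * l * Real.exp (-N)) * ENNReal.ofReal (∫ ω,
          ∑ i ∈ Finset.range (N * G), h * kernel ε (X (grid a h (i + 1)) ω - y) ∂P) := by
      intro y
      have := measureReal_lt_sum_le (P := P) (n := N * G) (G := G)
        (F := incrementSigma X (grid a h))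
        (x := fun i ω => h * kernel ε (X (grid a h (i + 1)) ω - y)) (M := M) (l := l) (m := N)
        (fun _ _ hij => incrementSigma_mono X _ hij) (incrementSigma_le hXm _)
        (fun i _ => hk y i) (fun i _ ω => mul_nonneg hhpos.le (kernel_nonneg hε0 _)) hl0
        (by rw [hl]; apply le_of_eq; field_simp) ?_ ?_ hN le_rfl
      · rw [← ENNReal.ofReal_mul (by positivity), ← ofReal_measureReal]
        exact ENNReal.ofReal_le_ofReal this
      · intro i _ ω
        refine le_trans ?_ hβ
        have := kernel_le hε0 (X (grid a h (i + 1)) ω - y)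
        gcongr
      · intro k p hp hkp g hg hg0
        have hT' : a + (k + p : ℕ) * h ≤ T := by
          have : ((k + p : ℕ) : ℝ) ≤ (N * G : ℕ) := by exact_mod_cast hkp
          have : ((k + p : ℕ) : ℝ) * h ≤ r := by rw [← hNh]; gcongr
          linarith
        refine (hX.integral_mul_sum_le hc hXm hX0 ha hhpos hH hHd hT' hg hg0 hε0 y).trans ?_
        refine mul_le_mul_of_nonneg_right ?_ (integral_nonneg hg0)
        have hph : (p : ℝ) * h ≤ r / N := by
          have : (p : ℝ) ≤ G := by exact_mod_cast hp
          rw [← hGh]; gcongr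
        calc √(Real.pi / c) ^ d * ((p * h) ^ (1 - H * d) / (1 - H * d))
            ≤ √(Real.pi / c) ^ d * ((r / N) ^ (1 - H * d) / (1 - H * d)) := by gcongr
          _ = M := by rw [hM, hc₁]; ring
    refine (lintegral_mono key).trans (le_of_eq ?_)
    rw [lintegral_const_mul', lintegral_ofReal_integral_sum_kernel hXm hhpos.le hε0
      (fun i => grid a h (i + 1)), hNh, ← ENNReal.ofReal_mul (by positivity)]
    exact ENNReal.ofReal_ne_top
  have key := measure_mul_volume_ball_le (P := P) (ρ := ρ) (S := fun G : ℕ =>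
    {p : Ω × E d | thr < ∑ i ∈ Finset.range (N * G),
      r / (N * G : ℕ) * kernel ε (X (grid a (r / (N * G : ℕ)) (i + 1)) p.1 - p.2)}) ?_ hev
    (Q := {ω | ∃ x, (8 * c₁ + 1) * A * (r / R ^ d) <
      mollified (fun s => X s ω) ε x a (a + r)}) ?_
  · refine (measure_le_of_volume_ball_mul_le hρ0 key).trans (ENNReal.ofReal_le_ofReal ?_)
    have e1 : ρ = q ^ (d + 1) * R := by
      rw [hρ, hε]; field_simp; ring
    rw [e1, ← hv, mul_pow, ← pow_mul, hl, hMeq]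
    have e2 : 2 * (1 / (2 * (c₁ * (r / R ^ d) * (A / N)))) * Real.exp (-N) * r /
        (q ^ ((d + 1) * d) * R ^ d * v) =
        (c₁ * v)⁻¹ * (N * Real.exp (-N)) * (q ^ (d * (d + 1)))⁻¹ * A⁻¹ := by
      rw [mul_comm (d + 1) d]
      field_simp
    rw [e2]
    exact mul_le_of_le_one_right (by positivity) (inv_le_one_of_one_le₀ hA1)
  · intro G
    refine measurableSet_lt measurable_const (Finset.measurable_sum _ fun i _ => ?_)
    exact ((continuous_kernel ε).measurable.comp
      (((hXm _).comp measurable_fst).sub measurable_snd)).const_mul _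
  · rintro ω ⟨x, hx⟩
    refine ⟨x, fun y hy => ?_⟩
    have ht : a + r ∈ Icc a (a + r) := ⟨by linarith, le_rfl⟩
    have l1 := abs_mollified_sub_le (hXc ω) hε0 x y ht
    have hxy : ‖x - y‖ ≤ ρ := by
      rw [← dist_eq_norm, dist_comm]; exact (Metric.mem_ball.1 hy).le
    have l2 : r * (ε ^ (d + 1))⁻¹ * ‖x - y‖ ≤ r / R ^ d := by
      calc _ ≤ r * (ε ^ (d + 1))⁻¹ * ρ := by gcongr
        _ = r / R ^ d := by rw [hρ]; field_simp
    have l3 : r / R ^ d ≤ A * (r / R ^ d) := le_mul_of_one_le_left (by positivity) hA1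
    have l4 : thr < |∫ s in a..(a + r), kernel ε (X s ω - y)| := by
      refine lt_of_lt_of_le ?_ (le_abs_self _)
      change thr < mollified (fun s => X s ω) ε y a (a + r)
      have := (abs_le.1 l1).2
      rw [hthr']
      have e : (8 * c₁ + 1) * A * (r / R ^ d) =
          8 * c₁ * A * (r / R ^ d) + A * (r / R ^ d) := by ring
      linarith
    have hker : Continuous fun s => kernel ε (X s ω - y) :=
      (continuous_kernel ε).comp ((hXc ω).sub continuous_const)
    have h2 : Tendsto (fun G : ℕ => N * G) atTop atTop :=
      tendsto_id.const_mul_atTop' (by omega)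
    filter_upwards [h2.eventually (eventually_lt_abs_riemannSum hker hr ht l4)] with G hG
    obtain ⟨k, hk, hlt⟩ := hG
    refine lt_of_lt_of_le hlt ?_
    -- The Riemann sum may stop at some `k` before the end; the terms are nonnegative, so the full
    -- sum exceeds the threshold as well.
    have hnn : ∀ i, 0 ≤ r / (N * G : ℕ) *
        kernel ε (X (grid a (r / (N * G : ℕ)) (i + 1)) ω - y) := fun i =>
      mul_nonneg (by positivity) (kernel_nonneg hε0 _)
    rw [abs_of_nonneg (Finset.sum_nonneg fun i _ => hnn i)]
    exact Finset.sum_le_sum_of_subset_of_nonneg (Finset.range_mono hk) fun i _ _ => hnn i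

end GaussianLocalTime

end


noncomputable section

namespace GaussianLocalTime

variable {d : ℕ}

/-! ### The local time as a limit of mollified local times -/

theorem kernel_smul {ε : ℝ} (hε : 0 < ε) (w : E d) :
    kernel ε (ε • w) = (ε ^ d)⁻¹ * kernel 1 w := by
  have h : ‖ε • w‖ / (2 * ε) = ‖w‖ / (2 * 1) := by
    rw [norm_smul, Real.norm_of_nonneg hε.le]; field_simp
  unfold kernel
  rw [h, mul_one, mul_pow, mul_inv]
  ring

theorem integral_mul_kernel_eq {ε : ℝ} (hε : 0 < ε) (φ : E d → ℝ) (y : E d) :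
    ∫ x, φ x * kernel ε (y - x) = ∫ w, φ (y - ε • w) * kernel 1 w := by
  have h := Measure.integral_comp_smul (volume : Measure (E d))
    (fun x => φ (y - x) * kernel ε x) ε
  rw [finrank_euclideanSpace_fin, abs_of_pos (by positivity), smul_eq_mul] at h
  rw [← integral_sub_left_eq_self _ volume y]
  simp only [sub_sub_cancel]
  simp only [kernel_smul hε] at h
  have h2 : ∫ x : E d, φ (y - ε • x) * ((ε ^ d)⁻¹ * kernel 1 x) =
      (ε ^ d)⁻¹ * ∫ x : E d, φ (y - ε • x) * kernel 1 x := by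
    rw [← integral_const_mul]; congr 1; ext x; ring
  rw [h2] at h
  exact (mul_left_cancel₀ (by positivity) h).symm

theorem abs_integral_mul_kernel_le_bound {ε C : ℝ} (hε : 0 < ε) {φ : E d → ℝ}
    (hC : ∀ x, |φ x| ≤ C) (y : E d) : |∫ x, φ x * kernel ε (y - x)| ≤ C := by
  have h : Integrable (fun x : E d => C * kernel ε (y - x)) :=
    ((integrable_kernel hε).comp_sub_left y).const_mul C
  have h1 : |∫ x, φ x * kernel ε (y - x)| ≤ ∫ x, C * kernel ε (y - x) := by
    rw [← Real.norm_eq_abs]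
    refine norm_integral_le_of_norm_le h (Eventually.of_forall fun x => ?_)
    rw [Real.norm_eq_abs, abs_mul, abs_of_nonneg (kernel_nonneg hε _)]
    exact mul_le_mul_of_nonneg_right (hC x) (kernel_nonneg hε _)
  rwa [integral_const_mul, integral_sub_left_eq_self (fun x : E d => kernel ε x),
    integral_kernel hε, mul_one] at h1

theorem tendsto_integral_mul_kernel {C : ℝ} {φ : E d → ℝ} (hφ : Continuous φ)
    (hC : ∀ x, |φ x| ≤ C) {ε : ℕ → ℝ} (hε : ∀ n, 0 < ε n) (hε0 : Tendsto ε atTop (𝓝 0)) (y : E d) :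
    Tendsto (fun n => ∫ x, φ x * kernel (ε n) (y - x)) atTop (𝓝 (φ y)) := by
  simp only [integral_mul_kernel_eq (hε _)]
  have h1 : φ y = ∫ w : E d, φ y * kernel 1 w := by
    rw [integral_const_mul, integral_kernel one_pos, mul_one]
  rw [h1]
  refine tendsto_integral_of_dominated_convergence (fun w => C * kernel 1 w) ?_
    ((integrable_kernel one_pos).const_mul C) ?_ ?_
  · intro n
    have := continuous_kernel (d := d) 1
    exact (by fun_prop : Continuous _).aestronglyMeasurable
  · intro n
    refine Eventually.of_forall fun w => ?_
    rw [Real.norm_eq_abs, abs_mul, abs_of_nonneg (kernel_nonneg one_pos _)]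
    exact mul_le_mul_of_nonneg_right (hC _) (kernel_nonneg one_pos _)
  · refine Eventually.of_forall fun w => ?_
    refine Tendsto.mul_const _ ((hφ.tendsto' _ _ rfl).comp ?_)
    simpa using (hε0.smul_const w).const_sub y

theorem continuous_mollified {f : ℝ → E d} (hf : Continuous f) (ε : ℝ) :
    Continuous fun p : E d × ℝ => mollified f ε p.1 0 p.2 := by
  have h : Continuous fun q : (E d × ℝ) × ℝ => kernel ε (f q.2 - q.1.1) :=
    (continuous_kernel ε).comp (by fun_prop)
  exact intervalIntegral.continuous_parametric_intervalIntegral_of_continuous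
    (f := fun (p : E d × ℝ) s => kernel ε (f s - p.1)) h continuous_snd

theorem mollified_nonneg (f : ℝ → E d) {ε : ℝ} (hε : 0 < ε) (x : E d) {a t : ℝ} (h : a ≤ t) :
    0 ≤ mollified f ε x a t :=
  intervalIntegral.integral_nonneg h fun _ _ => kernel_nonneg hε _

theorem mollified_sub {f : ℝ → E d} (hf : Continuous f) (ε : ℝ) (x : E d) (a b : ℝ) :
    mollified f ε x 0 b - mollified f ε x 0 a = mollified f ε x a b := by
  have h : Continuous fun s => kernel ε (f s - x) := (continuous_kernel ε).comp (by fun_prop)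
  exact intervalIntegral.integral_interval_sub_left (h.intervalIntegrable _ _)
    (h.intervalIntegrable _ _)

theorem mollified_add_const (f : ℝ → E d) (ε : ℝ) (x z : E d) (a t : ℝ) :
    mollified (fun s => f s + z) ε x a t = mollified f ε (x - z) a t := by
  unfold mollified
  have h : ∀ s, f s + z - x = f s - (x - z) := fun s => by abel
  simp only [h]

theorem integral_mul_mollified {f : ℝ → E d} (hf : Continuous f) {ε : ℝ} (hε : 0 < ε)
    {φ : E d → ℝ} (hφi : Integrable φ) {t : ℝ} (ht : 0 ≤ t) :
    ∫ x, φ x * mollified f ε x 0 t = ∫ s in 0..t, ∫ x, φ x * kernel ε (f s - x) := by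
  unfold mollified
  simp only [intervalIntegral.integral_of_le ht, ← integral_const_mul]
  refine integral_integral_swap ?_
  have h1 : Integrable (fun p : E d × ℝ => φ p.1) (volume.prod (volume.restrict (Ioc 0 t))) :=
    hφi.comp_fst _
  refine h1.mul_bdd (c := (ε ^ d)⁻¹) ?_ ?_
  · exact ((continuous_kernel ε).comp (by fun_prop)).aestronglyMeasurable
  · refine Eventually.of_forall fun p => ?_
    rw [Real.norm_of_nonneg (kernel_nonneg hε _)]
    exact kernel_le hε _

/-- One of two computations of the same limit: here the mollification is moved onto the test
function and integrated along the path. The other one uses the uniform limit of the mollified local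
times; comparing them identifies the density. -/
theorem tendsto_integral_mul_mollified_path {f : ℝ → E d} (hf : Continuous f) {ε : ℕ → ℝ}
    (hε : ∀ n, 0 < ε n) (hε0 : Tendsto ε atTop (𝓝 0)) {φ : E d → ℝ} (hφ : Continuous φ)
    (hφs : HasCompactSupport φ) {t : ℝ} (ht : 0 ≤ t) :
    Tendsto (fun n => ∫ x, φ x * mollified f (ε n) x 0 t) atTop (𝓝 (∫ s in 0..t, φ (f s))) := by
  obtain ⟨C, hC⟩ := hφs.exists_bound_of_continuous hφ
  have hφi : Integrable φ := hφ.integrable_of_hasCompactSupport hφs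
  simp only [integral_mul_mollified hf (hε _) hφi ht]
  refine intervalIntegral.tendsto_integral_filter_of_dominated_convergence (fun _ => C) ?_ ?_
    (by simp) ?_
  · refine Eventually.of_forall fun n => StronglyMeasurable.aestronglyMeasurable ?_
    refine StronglyMeasurable.integral_prod_right (f := fun s x =>
      φ x * kernel (ε n) (f s - x)) ?_
    have h1 := hφ
    have h2 := continuous_kernel (d := d) (ε n)
    refine (Continuous.mul ?_ ?_).stronglyMeasurable <;> fun_prop
  · refine Eventually.of_forall fun n => Eventually.of_forall fun s _ => ?_
    exact abs_integral_mul_kernel_le_bound (hε n) hC _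
  · exact Eventually.of_forall fun s _ =>
      tendsto_integral_mul_kernel hφ hC hε hε0 _

theorem tendsto_integral_mul_mollified_limit {f : ℝ → E d} (hf : Continuous f) {ε : ℕ → ℝ} {T : ℝ}
    {L : E d → ℝ → ℝ}
    (hL : TendstoUniformlyOn (fun n (p : E d × ℝ) => mollified f (ε n) p.1 0 p.2)
      (fun p => L p.1 p.2) atTop (univ ×ˢ Icc 0 T)) {t : ℝ} (ht : t ∈ Icc 0 T)
    (hLt : Continuous fun x => L x t) {φ : E d → ℝ} (hφ : Continuous φ)
    (hφs : HasCompactSupport φ) :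
    Tendsto (fun n => ∫ x, φ x * mollified f (ε n) x 0 t) atTop (𝓝 (∫ x, φ x * L x t)) := by
  have hφL : Integrable fun x => |φ x| * (|L x t| + 1) := by
    refine Continuous.integrable_of_hasCompactSupport ?_ ?_
    · fun_prop
    · exact hφs.norm.mul_right
  refine tendsto_integral_filter_of_dominated_convergence _ ?_ ?_ hφL ?_
  · refine Eventually.of_forall fun n => Continuous.aestronglyMeasurable ?_
    have h1 := continuous_mollified hf (ε n)
    fun_prop
  · filter_upwards [Metric.tendstoUniformlyOn_iff.1 hL 1 one_pos] with n hn
    refine Eventually.of_forall fun x => ?_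
    have h1 := hn (x, t) (mk_mem_prod (mem_univ x) ht)
    rw [Real.dist_eq] at h1
    rw [norm_mul, Real.norm_eq_abs, Real.norm_eq_abs]
    refine mul_le_mul_of_nonneg_left ?_ (abs_nonneg _)
    have h2 := abs_sub_abs_le_abs_sub (mollified f (ε n) x 0 t) (L x t)
    rw [abs_sub_comm] at h2
    linarith
  · exact Eventually.of_forall fun x =>
      (hL.tendsto_at (mk_mem_prod (mem_univ x) ht)).const_mul _

/-- If the mollified local times converge uniformly, the limit is the local time. -/
theorem isContinuousLocalTime_of_tendstoUniformlyOn {f : ℝ → E d} (hf : Continuous f) {T : ℝ}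
    (hT : 0 ≤ T) {ε : ℕ → ℝ} (hε : ∀ n, 0 < ε n) (hε0 : Tendsto ε atTop (𝓝 0))
    {L : E d → ℝ → ℝ}
    (hL : TendstoUniformlyOn (fun n (p : E d × ℝ) => mollified f (ε n) p.1 0 p.2)
      (fun p => L p.1 p.2) atTop (univ ×ˢ Icc 0 T)) :
    IsContinuousLocalTime T f L := by
  have hcont : ContinuousOn (fun p : E d × ℝ => L p.1 p.2) (univ ×ˢ Icc 0 T) :=
    hL.continuousOn (Eventually.frequently
      (Eventually.of_forall fun n => (continuous_mollified hf _).continuousOn))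
  have hnn : ∀ x : E d, ∀ t ∈ Icc 0 T, 0 ≤ L x t := fun x t ht =>
    ge_of_tendsto' (hL.tendsto_at (mk_mem_prod (mem_univ x) ht)) fun n =>
      mollified_nonneg f (hε n) x ht.1
  have hdens : ∀ t ∈ Icc 0 T, occupationMeasure f (Icc 0 t) =
      volume.withDensity (fun x => ENNReal.ofReal (L x t)) := by
    intro t ht
    have hLt : Continuous fun x => L x t := by
      have : Continuous fun x : E d => (x, t) := by fun_prop
      rw [← continuousOn_univ]
      exact hcont.comp this.continuousOn fun x _ => mk_mem_prod (mem_univ x) ht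
    have : IsLocallyFiniteMeasure (volume.withDensity fun x => ENNReal.ofReal (L x t)) :=
      IsLocallyFiniteMeasure.withDensity_ofReal hLt
    have : IsFiniteMeasure (occupationMeasure f (Icc 0 t)) := by
      unfold occupationMeasure; infer_instance
    -- Both measures integrate a compactly supported continuous function to the limit of its
    -- integrals against the mollified local times.
    refine Measure.ext_of_integral_eq_on_compactlySupported fun φ => ?_
    rw [occupationMeasure, integral_map (f := φ) hf.measurable.aemeasurable
      φ.continuous.aestronglyMeasurable,
      integral_withDensity_eq_integral_toReal_smul (by fun_prop)
        (Eventually.of_forall fun _ => ENNReal.ofReal_lt_top),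
      integral_Icc_eq_integral_Ioc, ← intervalIntegral.integral_of_le ht.1]
    rw [tendsto_nhds_unique
      (tendsto_integral_mul_mollified_path (φ := φ) hf hε hε0 φ.continuous φ.hasCompactSupport ht.1)
      (tendsto_integral_mul_mollified_limit (φ := φ) hf hL ht hLt φ.continuous φ.hasCompactSupport)]
    refine integral_congr_ae (Eventually.of_forall fun x => ?_)
    simp only [smul_eq_mul]
    rw [ENNReal.toReal_ofReal (hnn x t ht), mul_comm]
  refine ⟨?_, hcont, hnn, hdens⟩
  intro B hB hBT
  have h1 : occupationMeasure f B ≤ occupationMeasure f (Icc 0 T) :=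
    Measure.map_mono (Measure.restrict_mono_set _ hBT) hf.measurable
  refine (Measure.absolutelyContinuous_of_le h1).trans ?_
  rw [hdens T ⟨hT, le_rfl⟩]
  exact withDensity_absolutelyContinuous _ _

theorem IsContinuousLocalTime.congr {T : ℝ} {f g : ℝ → E d} {L : E d → ℝ → ℝ}
    (h : IsContinuousLocalTime T f L) (hfg : ∀ t ∈ Icc 0 T, f t = g t) :
    IsContinuousLocalTime T g L := by
  have key : ∀ B : Set ℝ, MeasurableSet B → B ⊆ Icc 0 T →
      occupationMeasure g B = occupationMeasure f B := fun B hB hBT =>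
    Measure.map_congr (by
      filter_upwards [ae_restrict_mem hB] with t ht using (hfg t (hBT ht)).symm)
  refine ⟨fun B hB hBT => ?_, h.continuousOn, h.nonneg, fun t ht => ?_⟩
  · rw [key B hB hBT]; exact h.absolutelyContinuous B hB hBT
  · rw [key _ measurableSet_Icc (Icc_subset_Icc_right ht.2)]; exact h.density t ht

/-- The limit of the mollified local times along the scales `2⁻ⁿ`. -/
def limitDensity (f : ℝ → E d) (x : E d) (t : ℝ) : ℝ :=
  limUnder atTop fun n : ℕ => mollified f ((1 / 2) ^ n) x 0 t

/-- The mollified local times along the scales `2⁻ⁿ` converge uniformly. -/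
def HasLimitDensity (T : ℝ) (f : ℝ → E d) : Prop :=
  TendstoUniformlyOn (fun (n : ℕ) (p : E d × ℝ) => mollified f ((1 / 2) ^ n) p.1 0 p.2)
    (fun p => limitDensity f p.1 p.2) atTop (univ ×ˢ Icc 0 T)

/-- Telescoping over the scales and the Weierstrass M-test; the pointwise limit is then the value
chosen by `limUnder`. -/
theorem hasLimitDensity_of_eventually_le {T : ℝ} {f : ℝ → E d} {δ : ℕ → ℝ} (hδ : Summable δ)
    (h : ∀ᶠ n : ℕ in atTop, ∀ x, ∀ t ∈ Icc 0 T,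
      |mollified f ((1 / 2) ^ n) x 0 t - mollified f ((1 / 2) ^ n / 2) x 0 t| ≤ δ n) :
    HasLimitDensity T f := by
  let U : ℕ → E d × ℝ → ℝ := fun n p => mollified f ((1 / 2) ^ n) p.1 0 p.2
  have h1 := tendstoUniformlyOn_tsum_nat_eventually (f := fun n p => U (n + 1) p - U n p)
    (s := univ ×ˢ Icc 0 T) hδ (by
      filter_upwards [h] with n hn p hp
      have := hn p.1 p.2 hp.2
      rw [Real.norm_eq_abs, abs_sub_comm]
      have e : (1 / 2 : ℝ) ^ (n + 1) = (1 / 2) ^ n / 2 := by rw [pow_succ]; ring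
      simpa only [U, e] using this)
  have h2 : TendstoUniformlyOn U (fun p => U 0 p + ∑' n, (U (n + 1) p - U n p)) atTop
      (univ ×ˢ Icc 0 T) := by
    rw [Metric.tendstoUniformlyOn_iff] at h1 ⊢
    intro η hη
    filter_upwards [h1 η hη] with n hn p hp
    have := hn p hp
    rw [Finset.sum_range_sub (fun n => U n p)] at this
    rw [Real.dist_eq] at this ⊢
    convert this using 2; ring
  refine h2.congr_right fun p hp => ?_
  exact ((h2.tendsto_at hp).limUnder_eq).symm

/-- Translating a path translates its local time; with `z` the initial value this undoes the
recentring. -/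
theorem HasLimitDensity.isContinuousLocalTime {T : ℝ} (hT : 0 ≤ T) {f : ℝ → E d}
    (h : HasLimitDensity T f) (hf : Continuous f) (z : E d) :
    IsContinuousLocalTime T (fun s => f s + z) (fun x t => limitDensity f (x - z) t) := by
  refine isContinuousLocalTime_of_tendstoUniformlyOn (by fun_prop) hT
    (ε := fun n => (1 / 2) ^ n) (fun n => by positivity)
    (tendsto_pow_atTop_nhds_zero_of_lt_one (by norm_num) (by norm_num)) ?_
  simp only [mollified_add_const]
  have := h.comp (fun p : E d × ℝ => (p.1 - z, p.2))
  refine this.mono fun p hp => ?_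
  exact mk_mem_prod (mem_univ _) hp.2

theorem HasLimitDensity.tendsto_sub {T : ℝ} {f : ℝ → E d} (h : HasLimitDensity T f)
    (hf : Continuous f) (x : E d) {a b : ℝ} (ha : a ∈ Icc 0 T) (hb : b ∈ Icc 0 T) :
    Tendsto (fun n : ℕ => mollified f ((1 / 2) ^ n) x a b) atTop
      (𝓝 (limitDensity f x b - limitDensity f x a)) := by
  have h1 := h.tendsto_at (mk_mem_prod (mem_univ x) ha)
  have h2 := h.tendsto_at (mk_mem_prod (mem_univ x) hb)
  simpa only [mollified_sub hf] using h2.sub h1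

end GaussianLocalTime

end


noncomputable section

namespace GaussianLocalTime

/-! ### Existence of the local time and its tails -/

theorem exists_exponent {H : ℝ} {d : ℕ} (hH : 0 < H) (hHd : H * d < 1) :
    ∃ γ : ℝ, 0 < γ ∧ γ ≤ 1 ∧ H * (d + γ) < 1 := by
  have h : 0 < (1 - H * d) / (2 * H) := div_pos (by linarith) (by linarith)
  refine ⟨min 1 ((1 - H * d) / (2 * H)), lt_min one_pos h, min_le_left _ _, ?_⟩
  have h1 : H * min 1 ((1 - H * d) / (2 * H)) ≤ H * ((1 - H * d) / (2 * H)) := by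
    gcongr; exact min_le_right _ _
  have h2 : H * ((1 - H * d) / (2 * H)) = (1 - H * d) / 2 := by field_simp
  rw [mul_add]
  linarith

theorem summable_affine_mul_geometric (a b : ℝ) {ρ : ℝ} (h0 : 0 ≤ ρ) (h1 : ρ < 1) :
    Summable fun n : ℕ => (a * n + b) * ρ ^ n := by
  have h := summable_pow_mul_geometric_of_norm_lt_one (R := ℝ) 1 (r := ρ)
    (by rwa [Real.norm_of_nonneg h0])
  have h2 := ((h.mul_left a).add ((summable_geometric_of_lt_one h0 h1).mul_left b))
  refine h2.congr fun n => ?_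
  rw [pow_one]; ring

theorem pow_mul_exp_neg_le (p N : ℕ) : (N : ℝ) ^ p * Real.exp (-N) ≤ p.factorial := by
  have h := Real.pow_div_factorial_le_exp (N : ℝ) (Nat.cast_nonneg N) p
  rw [div_le_iff₀ (by positivity)] at h
  rw [Real.exp_neg, ← div_eq_mul_inv, div_le_iff₀ (Real.exp_pos _), mul_comm]
  exact h

theorem exp_neg_le_half_pow (N : ℕ) : Real.exp (-N) ≤ (1 / 2) ^ N := by
  rw [show (-(N : ℝ)) = N * (-1) by ring, Real.exp_nat_mul]
  refine pow_le_pow_left₀ (Real.exp_pos _).le ?_ N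
  rw [Real.exp_neg, one_div]
  have := Real.add_one_le_exp (1 : ℝ)
  exact inv_anti₀ (by norm_num) (by linarith)

theorem quarter_pow_le_exp_neg (N : ℕ) : (1 / 4 : ℝ) ^ N ≤ Real.exp (-N) := by
  rw [show (-(N : ℝ)) = N * (-1) by ring, Real.exp_nat_mul]
  refine pow_le_pow_left₀ (by norm_num) ?_ N
  rw [Real.exp_neg, one_div]
  have := Real.exp_one_lt_d9
  exact inv_anti₀ (Real.exp_pos _) (by linarith)

variable {Ω : Type*} [mΩ : MeasurableSpace Ω] {P : Measure Ω} [IsProbabilityMeasure P] {d : ℕ}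
  {X : ℝ → Ω → E d} {T H c : ℝ}

/-- The mollified local times converge uniformly, almost surely. -/
theorem ConditionalDecay.ae_hasLimitDensity (hX : ConditionalDecay P X T H c)
    (hc : 0 < c) (hXm : ∀ t, Measurable (X t)) (hXc : ∀ ω, Continuous fun t => X t ω)
    (hX0 : ∀ ω, X 0 ω = 0) (hH : 0 < H) (hHd : H * d < 1) (hT : 0 < T) :
    ∀ᵐ ω ∂P, HasLimitDensity T fun t => X t ω := by
  obtain ⟨γ, hγ0, hγ1, hγ⟩ := exists_exponent hH hHd
  obtain ⟨B, C, hB, hC, h⟩ := hX.exists_measure_mollified_sub_le hc hXm hXc hX0 hH hγ0 hγ1 hγ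
  set m := 1 + d * (d + 2) with hm
  set W := T ^ H with hW
  have hW0 : 0 < W := Real.rpow_pos_of_pos hT H
  set ρ : ℝ := (1 / 2) ^ (γ / 2) with hρ
  have hρ0 : 0 < ρ := Real.rpow_pos_of_pos (by norm_num) _
  have hρ1 : ρ < 1 := Real.rpow_lt_one (by norm_num) (by norm_num) (by positivity)
  set K := T / W ^ d with hK
  -- Chosen so that the width `q n * T ^ H` is 2⁻ⁿ.
  let q : ℕ → ℝ := fun n => (1 / 2) ^ n / W
  have hq0 : ∀ n, 0 < q n := fun n => by positivity
  have hqW : ∀ n, q n * W = (1 / 2) ^ n := fun n => by simp only [q]; field_simp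
  have hqγ : ∀ n, q n ^ (γ / 2) = ρ ^ n / W ^ (γ / 2) := fun n => by
    simp only [q]
    rw [Real.div_rpow (by positivity) hW0.le, ← Real.rpow_natCast, ← Real.rpow_mul (by norm_num),
      mul_comm, Real.rpow_mul (by norm_num), Real.rpow_natCast]
  have hq1 : ∀ᶠ n in atTop, q n ≤ 1 := by
    have h1 := tendsto_pow_atTop_nhds_zero_of_lt_one (r := (1 / 2 : ℝ)) (by norm_num) (by norm_num)
    filter_upwards [h1.eventually (ge_mem_nhds hW0)] with n hn
    exact (div_le_one hW0).2 hn
  obtain ⟨n₁, hn₁⟩ := eventually_atTop.1 hq1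
  -- The number of halvings is j = (m + 1) n: the part m n cancels the loss q^(-m), and the
  -- remaining 2⁻ⁿ is summable for Borel–Cantelli. The thresholds grow only linearly in n against
  -- the geometric factor ρⁿ.
  let δ : ℕ → ℝ := fun n => 2 * ((((m + 1) * n : ℕ) + 1) * (B * q n ^ (γ / 2) * K))
  have hδ : Summable δ := by
    have h1 := (summable_affine_mul_geometric (m + 1) 1 hρ0.le hρ1).mul_left
      (2 * (B * K / W ^ (γ / 2)))
    refine h1.congr fun n => ?_
    simp only [δ, hqγ]
    push_cast
    ring
  let S : ℕ → Set Ω := fun n => {ω | ∃ x, ∃ t ∈ Icc (0 : ℝ) (0 + T), δ n <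
    |mollified (fun s => X s ω) (q n * W) x 0 t - mollified (fun s => X s ω) (q n * W / 2) x 0 t|}
  have hS : ∀ n, P (S (n + n₁)) ≤ ENNReal.ofReal (C * W ^ m * (1 / 2) ^ (n + n₁)) := by
    intro n
    refine (h 0 T (q (n + n₁)) le_rfl hT (by simp) (hq0 _) (hn₁ _ (by omega))
      ((m + 1) * (n + n₁))).trans (ENNReal.ofReal_le_ofReal (le_of_eq ?_))
    have e : (1 / 2 : ℝ) ^ ((m + 1) * (n + n₁)) = ((1 / 2) ^ (n + n₁)) ^ m * (1 / 2) ^ (n + n₁) := by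
      rw [mul_comm, pow_mul, pow_succ]
    simp only [q]
    rw [e, div_pow ((1 / 2 : ℝ) ^ (n + n₁)) W m, inv_div]
    have : ((1 / 2 : ℝ) ^ (n + n₁)) ^ m ≠ 0 := by positivity
    field_simp
  have hsum : ∑' n, P (S (n + n₁)) ≠ ∞ := by
    refine ne_top_of_le_ne_top ?_ (ENNReal.tsum_le_tsum hS)
    refine Summable.tsum_ofReal_ne_top ?_
    exact ((summable_nat_add_iff n₁).2
      (summable_geometric_of_lt_one (by norm_num) (by norm_num))).mul_left _
  filter_upwards [ae_eventually_notMem hsum] with ω hω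
  refine hasLimitDensity_of_eventually_le hδ ?_
  obtain ⟨n₂, hn₂⟩ := eventually_atTop.1 hω
  refine eventually_atTop.2 ⟨n₂ + n₁, fun n hn x t ht => ?_⟩
  obtain ⟨i, rfl⟩ := Nat.exists_eq_add_of_le' (le_of_add_le_right hn)
  by_contra hcon
  refine hn₂ i (by omega) ⟨x, t, by simpa using ht, ?_⟩
  rw [hqW]
  exact not_le.1 hcon

/-- Tails of the local time of an interval, uniformly in space. -/
theorem ConditionalDecay.exists_measure_limitDensity_le (hX : ConditionalDecay P X T H c)
    (hc : 0 < c) (hXm : ∀ t, Measurable (X t)) (hXc : ∀ ω, Continuous fun t => X t ω)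
    (hX0 : ∀ ω, X 0 ω = 0) (hH : 0 < H) (hHd : H * d < 1) (hT : 0 < T) :
    ∃ A C : ℝ, 0 < A ∧ 0 < C ∧ ∀ a r : ℝ, 0 ≤ a → 0 < r → r ≤ 1 → a + r ≤ T → ∀ N : ℕ, 1 ≤ N →
      P {ω | ∃ x, A * (N : ℝ) ^ (H * d) * (r / (r ^ H) ^ d) <
        limitDensity (fun t => X t ω) x (a + r) - limitDensity (fun t => X t ω) x a} ≤
        ENNReal.ofReal (C * (1 / 2) ^ N) := by
  have hae := hX.ae_hasLimitDensity hc hXm hXc hX0 hH hHd hT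
  obtain ⟨γ, hγ0, hγ1, hγ⟩ := exists_exponent hH hHd
  obtain ⟨B, C, hB, hC, h⟩ := hX.exists_measure_mollified_sub_le hc hXm hXc hX0 hH hγ0 hγ1 hγ
  obtain ⟨B', C', hB', hC', h'⟩ := hX.exists_measure_mollified_le hc hXm hXc hX0 hH hHd
  set m := 1 + d * (d + 2) with hm
  set m' := d * (d + 1) with hm'
  set ρ : ℝ := (1 / 2) ^ (γ / 2) with hρ
  have hρ0 : 0 < ρ := Real.rpow_pos_of_pos (by norm_num) _
  have hρ1 : ρ < 1 := Real.rpow_lt_one (by norm_num) (by norm_num) (by positivity)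
  -- With the starting width N^(-k) relative to r^H and kγ/2 ≥ 1, the gain q^(γ/2) ≤ 1/N compensates
  -- the factor of order N in the number of halvings.
  obtain ⟨k, hk⟩ := exists_nat_ge (2 / γ)
  have hkγ : 1 ≤ k * (γ / 2) := by
    rw [div_le_iff₀ hγ0] at hk; linarith
  have hsum := summable_affine_mul_geometric (m + 1) 4 hρ0.le hρ1
  set S := ∑' n : ℕ, (((m + 1 : ℝ) * n + 4) * ρ ^ n) with hS
  have hS0 : 0 ≤ S := tsum_nonneg fun n => by positivity
  set D := C * 2 ^ m * (k * m).factorial with hD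
  set D' := C' * 2 ^ (m' + 1) * (k * m' + 1).factorial with hD'
  refine ⟨B' * 2 ^ (H * d) + 2 * B * S, D' + D * 2, by positivity, by positivity, ?_⟩
  intro a r ha hr hr1 har N hN
  have hN0 : (0 : ℝ) < N := by exact_mod_cast hN
  have hN1 : (1 : ℝ) ≤ N := by exact_mod_cast hN
  set R := r ^ H with hR
  have hR0 : 0 < R := Real.rpow_pos_of_pos hr H
  have hR1 : R ≤ 1 := Real.rpow_le_one hr.le hr1 hH.le
  set K := r / R ^ d with hK
  have hK0 : 0 < K := by positivity
  set θ : ℝ := ((N : ℝ) ^ k)⁻¹ with hθ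
  have hθ0 : 0 < θ := by positivity
  have hθ1 : θ ≤ 1 := inv_le_one_of_one_le₀ (one_le_pow₀ hN1)
  -- The starting dyadic width 2^(-(n₀ + 1)) lies between θR / 2 and θR, so the limit along 2⁻ⁿ
  -- applies to the chain that begins there.
  obtain ⟨n₀, hn₀, hn₀'⟩ := exists_nat_pow_near_of_lt_one (mul_pos hθ0 hR0)
    (mul_le_one₀ hθ1 hR0.le hR1) (one_half_pos (α := ℝ)) one_half_lt_one
  let q : ℕ → ℝ := fun i => (1 / 2) ^ (n₀ + 1 + i) / R
  have hq0 : ∀ i, 0 < q i := fun i => by positivity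
  have hqR : ∀ i, q i * R = (1 / 2) ^ (n₀ + 1 + i) := fun i => by simp only [q]; field_simp
  have hqi : ∀ i, q i = q 0 * (1 / 2) ^ i := fun i => by
    simp only [q]; rw [pow_add, add_zero]; ring
  have hqθ : q 0 ≤ θ := by
    simp only [q, add_zero]
    exact (div_le_iff₀ hR0).2 hn₀.le
  have hθq : θ / 2 ≤ q 0 := by
    simp only [q, add_zero]
    rw [le_div_iff₀ hR0, pow_succ]
    linarith
  have hq1 : ∀ i, q i ≤ 1 := fun i => by
    rw [hqi]
    exact mul_le_one₀ (hqθ.trans hθ1) (by positivity) (pow_le_one₀ (by norm_num) (by norm_num))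
  have hqγ : ∀ i, q i ^ (γ / 2) ≤ (N : ℝ)⁻¹ * ρ ^ i := fun i => by
    rw [hqi, Real.mul_rpow (hq0 0).le (by positivity)]
    have e1 : ((1 / 2 : ℝ) ^ i) ^ (γ / 2) = ρ ^ i := by
      rw [← Real.rpow_natCast, ← Real.rpow_mul (by norm_num), mul_comm,
        Real.rpow_mul (by norm_num), Real.rpow_natCast]
    rw [e1]
    refine mul_le_mul_of_nonneg_right ?_ (by positivity)
    calc q 0 ^ (γ / 2) ≤ θ ^ (γ / 2) := Real.rpow_le_rpow (hq0 0).le hqθ (by positivity)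
      _ = (N : ℝ) ^ (-(k * (γ / 2))) := by
        rw [hθ, ← Real.rpow_natCast, ← Real.rpow_neg hN0.le, ← Real.rpow_mul hN0.le]
        congr 1; ring
      _ ≤ (N : ℝ) ^ (-1 : ℝ) := Real.rpow_le_rpow_of_exponent_le hN1 (by linarith)
      _ = (N : ℝ)⁻¹ := Real.rpow_neg_one _
  have hqinv : ∀ p : ℕ, (q 0 ^ p)⁻¹ ≤ 2 ^ p * (N : ℝ) ^ (k * p) := fun p => by
    calc (q 0 ^ p)⁻¹ ≤ ((θ / 2) ^ p)⁻¹ := by gcongr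
      _ = 2 ^ p * (N : ℝ) ^ (k * p) := by
        rw [hθ, div_pow, inv_pow, pow_mul]; field_simp
  -- The term (m + 1) i absorbs the growth of q_i^(-m) and gives a summable 2⁻ⁱ. The term 3N gives
  -- 8⁻ᴺ = 4⁻ᴺ 2⁻ᴺ: the first factor absorbs the power N^(km), the second is the desired tail.
  let j : ℕ → ℕ := fun i => (m + 1) * i + 3 * N
  let thr : ℕ → ℝ := fun i => 2 * ((j i + 1) * (B * q i ^ (γ / 2) * K))
  have hthr : ∀ i, thr i ≤ 2 * B * K * (((m + 1 : ℝ) * i + 4) * ρ ^ i) := fun i => by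
    have e1 : ((j i : ℝ) + 1) * (N : ℝ)⁻¹ ≤ (m + 1 : ℝ) * i + 4 := by
      rw [← div_eq_mul_inv, div_le_iff₀ hN0]
      simp only [j]
      push_cast
      have : (0 : ℝ) ≤ (m + 1) * i := by positivity
      nlinarith
    calc thr i ≤ 2 * ((j i + 1) * (B * ((N : ℝ)⁻¹ * ρ ^ i) * K)) := by
          simp only [thr]; gcongr; exact hqγ i
      _ = 2 * B * K * (((j i + 1) * (N : ℝ)⁻¹) * ρ ^ i) := by ring
      _ ≤ _ := by gcongr
  let Q : ℕ → Set Ω := fun i => {ω | ∃ x, ∃ t ∈ Icc a (a + r), thr i <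
    |mollified (fun s => X s ω) (q i * R) x a t - mollified (fun s => X s ω) (q i * R / 2) x a t|}
  have hQ : ∀ i, P (Q i) ≤ ENNReal.ofReal (D * (1 / 2) ^ N * (1 / 2) ^ i) := by
    intro i
    refine (h a r (q i) ha hr har (hq0 i) (hq1 i) (j i)).trans (ENNReal.ofReal_le_ofReal ?_)
    have e1 : (q i ^ m)⁻¹ = (q 0 ^ m)⁻¹ * (2 ^ i) ^ m := by
      have : (1 / 2 : ℝ) ^ i = (2 ^ i)⁻¹ := by rw [one_div, inv_pow]
      rw [hqi, this, mul_pow, inv_pow, mul_inv, inv_inv]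
    have e2 : (1 / 2 : ℝ) ^ j i = (1 / 4) ^ N * (1 / 2) ^ N * (1 / 2) ^ i * ((2 ^ i) ^ m)⁻¹ := by
      simp only [j]
      have e3 : (1 / 2 : ℝ) ^ (3 * N) = (1 / 4) ^ N * (1 / 2) ^ N := by
        rw [pow_mul, ← mul_pow]; norm_num
      have e4 : (1 / 2 : ℝ) ^ ((m + 1) * i) = (1 / 2) ^ i * ((2 ^ i) ^ m)⁻¹ := by
        rw [add_mul, one_mul, pow_add, mul_comm m i, pow_mul, one_div, inv_pow, inv_pow]; ring
      rw [pow_add, e3, e4]; ring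
    have e3 : (N : ℝ) ^ (k * m) * (1 / 4) ^ N ≤ (k * m).factorial :=
      (mul_le_mul_of_nonneg_left (quarter_pow_le_exp_neg N) (by positivity)).trans
        (pow_mul_exp_neg_le _ _)
    rw [e1, e2]
    calc C * ((1 / 4) ^ N * (1 / 2) ^ N * (1 / 2) ^ i * ((2 ^ i) ^ m)⁻¹) *
          ((q 0 ^ m)⁻¹ * (2 ^ i) ^ m)
        = C * (1 / 2) ^ N * (1 / 2) ^ i * ((q 0 ^ m)⁻¹ * (1 / 4) ^ N) := by
          field_simp
      _ ≤ C * (1 / 2) ^ N * (1 / 2) ^ i * ((2 ^ m * (N : ℝ) ^ (k * m)) * (1 / 4) ^ N) := by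
          gcongr; exact hqinv m
      _ = C * (1 / 2) ^ N * (1 / 2) ^ i * 2 ^ m * ((N : ℝ) ^ (k * m) * (1 / 4) ^ N) := by ring
      _ ≤ C * (1 / 2) ^ N * (1 / 2) ^ i * 2 ^ m * (k * m).factorial := by gcongr
      _ = D * (1 / 2) ^ N * (1 / 2) ^ i := by rw [hD]; ring
  -- Khasminskii's bound is used with 2N: one factor e⁻ᴺ absorbs the power of N lost at the starting
  -- width, the other one gives 2⁻ᴺ.
  set Q' : Set Ω := {ω | ∃ x, B' * ((2 * N : ℕ) : ℝ) ^ (H * d) * K <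
    mollified (fun s => X s ω) (q 0 * R) x a (a + r)} with hQ'
  have hPQ' : P Q' ≤ ENNReal.ofReal (D' * (1 / 2) ^ N) := by
    refine (h' a r (q 0) ha hr har (hq0 0) (2 * N) (by omega)).trans (ENNReal.ofReal_le_ofReal ?_)
    have e1 : Real.exp (-((2 * N : ℕ) : ℝ)) = Real.exp (-N) * Real.exp (-N) := by
      rw [← Real.exp_add]; congr 1; push_cast; ring
    rw [e1]
    calc C' * ((2 * N : ℕ) * (Real.exp (-N) * Real.exp (-N))) * (q 0 ^ m')⁻¹
        ≤ C' * ((2 * N : ℕ) * (Real.exp (-N) * Real.exp (-N))) *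
          (2 ^ m' * (N : ℝ) ^ (k * m')) := by gcongr; exact hqinv m'
      _ = C' * 2 ^ (m' + 1) * ((N : ℝ) ^ (k * m' + 1) * Real.exp (-N)) * Real.exp (-N) := by
          push_cast; ring
      _ ≤ C' * 2 ^ (m' + 1) * (k * m' + 1).factorial * (1 / 2) ^ N := by
          gcongr
          · exact pow_mul_exp_neg_le _ _
          · exact exp_neg_le_half_pow N
  set Z : Set Ω := {ω | ¬ HasLimitDensity T fun t => X t ω} with hZ
  have hPZ : P Z = 0 := ae_iff.1 hae
  have haT : a ∈ Icc 0 T := ⟨ha, by linarith⟩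
  have harT : a + r ∈ Icc 0 T := ⟨by linarith, har⟩
  have hsub : {ω | ∃ x, (B' * 2 ^ (H * d) + 2 * B * S) * (N : ℝ) ^ (H * d) * K <
      limitDensity (fun t => X t ω) x (a + r) - limitDensity (fun t => X t ω) x a} ⊆
      (Z ∪ Q') ∪ ⋃ i, Q i := by
    rintro ω ⟨x, hx⟩
    by_contra hcon
    simp only [mem_union, mem_iUnion, not_or, not_exists] at hcon
    obtain ⟨⟨hωZ, hωQ'⟩, hωQ⟩ := hcon
    have hlim : HasLimitDensity T fun t => X t ω := not_not.1 hωZ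
    have hbase : mollified (fun s => X s ω) (q 0 * R) x a (a + r) ≤
        B' * ((2 * N : ℕ) : ℝ) ^ (H * d) * K := not_lt.1 fun hh => hωQ' ⟨x, hh⟩
    have hstep : ∀ i, mollified (fun s => X s ω) (q (i + 1) * R) x a (a + r) ≤
        mollified (fun s => X s ω) (q i * R) x a (a + r) + thr i := by
      intro i
      have h1 : |mollified (fun s => X s ω) (q i * R) x a (a + r) -
          mollified (fun s => X s ω) (q i * R / 2) x a (a + r)| ≤ thr i :=
        not_lt.1 fun hh => hωQ i ⟨x, a + r, ⟨by linarith, le_rfl⟩, hh⟩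
      have h2 : q (i + 1) * R = q i * R / 2 := by
        rw [hqR, hqR, ← add_assoc, pow_succ]; ring
      rw [h2]
      linarith [(abs_le.1 h1).1]
    have hall : ∀ i, mollified (fun s => X s ω) (q i * R) x a (a + r) ≤
        B' * ((2 * N : ℕ) : ℝ) ^ (H * d) * K + ∑ l ∈ Finset.range i, thr l := by
      intro i
      induction i with
      | zero => simpa using hbase
      | succ i ih =>
        rw [Finset.sum_range_succ]
        linarith [hstep i]
    have hthrS : ∀ i, ∑ l ∈ Finset.range i, thr l ≤ 2 * B * K * S := by
      intro i
      calc ∑ l ∈ Finset.range i, thr l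
          ≤ ∑ l ∈ Finset.range i, 2 * B * K * (((m + 1 : ℝ) * l + 4) * ρ ^ l) :=
            Finset.sum_le_sum fun l _ => hthr l
        _ = 2 * B * K * ∑ l ∈ Finset.range i, (((m + 1 : ℝ) * l + 4) * ρ ^ l) := by
            rw [Finset.mul_sum]
        _ ≤ 2 * B * K * S := by
            gcongr
            exact hsum.sum_le_tsum _ fun l _ => by positivity
    have htend := (hlim.tendsto_sub (hXc ω) x haT harT).comp
      (tendsto_add_atTop_nat (n₀ + 1))
    have hle : limitDensity (fun t => X t ω) x (a + r) - limitDensity (fun t => X t ω) x a ≤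
        B' * ((2 * N : ℕ) : ℝ) ^ (H * d) * K + 2 * B * K * S := by
      refine le_of_tendsto' htend fun i => ?_
      have h1 := hall i
      rw [hqR] at h1
      have h2 := hthrS i
      simp only [Function.comp]
      rw [add_comm i]
      linarith
    have hNH : (1 : ℝ) ≤ (N : ℝ) ^ (H * d) := Real.one_le_rpow hN1 (by positivity)
    have e1 : (((2 * N : ℕ) : ℝ)) ^ (H * d) = 2 ^ (H * d) * (N : ℝ) ^ (H * d) := by
      push_cast
      rw [Real.mul_rpow (by norm_num) hN0.le]
    rw [e1] at hle
    have e2 : 2 * B * K * S ≤ 2 * B * K * S * (N : ℝ) ^ (H * d) :=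
      le_mul_of_one_le_right (by positivity) hNH
    have e3 : (B' * 2 ^ (H * d) + 2 * B * S) * (N : ℝ) ^ (H * d) * K =
      B' * (2 ^ (H * d) * (N : ℝ) ^ (H * d)) * K + 2 * B * K * S * (N : ℝ) ^ (H * d) := by ring
    linarith
  refine (measure_mono hsub).trans ?_
  have hD0 : 0 ≤ D * (1 / 2) ^ N := by positivity
  have htot : ∑' i, P (Q i) ≤ ENNReal.ofReal (D * (1 / 2) ^ N * 2) := by
    refine (ENNReal.tsum_le_tsum hQ).trans (le_of_eq ?_)
    rw [← ENNReal.ofReal_tsum_of_nonneg (fun i => by positivity)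
      ((summable_geometric_of_lt_one (by norm_num) (by norm_num)).mul_left _), tsum_mul_left,
      tsum_geometric_two]
  calc P ((Z ∪ Q') ∪ ⋃ i, Q i) ≤ P (Z ∪ Q') + P (⋃ i, Q i) := measure_union_le _ _
    _ ≤ (P Z + P Q') + ∑' i, P (Q i) := add_le_add (measure_union_le _ _) (measure_iUnion_le _)
    _ ≤ ENNReal.ofReal (D' * (1 / 2) ^ N) + ENNReal.ofReal (D * (1 / 2) ^ N * 2) := by
        rw [hPZ, zero_add]; exact add_le_add hPQ' htot
    _ = _ := by
        rw [← ENNReal.ofReal_add (by positivity) (by positivity)]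
        congr 1; ring

end GaussianLocalTime

end


noncomputable section

namespace GaussianLocalTime

/-! ### From tails to moduli of continuity of the local time -/

theorem eventually_nhdsGT_of_dyadic {q : ℝ → Prop}
    (h : ∀ᶠ k : ℕ in atTop, ∀ r, (1 / 2 : ℝ) ^ (k + 1) < r → r ≤ (1 / 2) ^ k → q r) :
    ∀ᶠ r in 𝓝[>] (0 : ℝ), q r := by
  obtain ⟨k₀, hk₀⟩ := eventually_atTop.1 h
  have h1 : (0 : ℝ) < (1 / 2) ^ (k₀ + 1) := by positivity
  filter_upwards [Ioo_mem_nhdsGT h1] with r hr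
  have hr1 : r ≤ 1 := hr.2.le.trans (pow_le_one₀ (by norm_num) (by norm_num))
  obtain ⟨k, hk, hk'⟩ := exists_nat_pow_near_of_lt_one hr.1 hr1 (one_half_pos (α := ℝ))
    one_half_lt_one
  refine hk₀ k ?_ r hk hk'
  have := (pow_lt_pow_iff_right_of_lt_one₀ (one_half_pos (α := ℝ)) one_half_lt_one).1
    (hk.trans hr.2)
  omega

theorem div_pow_rpow_le {H b ρ r : ℝ} {d : ℕ} (hH : 0 < H) (hHd : H * d < 1) (hb : 1 ≤ 2 * b)
    (hρ : 0 < ρ) (hρr : ρ ≤ 2 * r) :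
    b * ρ / ((b * ρ) ^ H) ^ d ≤ 2 * b * r ^ (1 - H * d) := by
  have hb0 : 0 < b := by linarith
  have hr : 0 < r := by linarith
  have h1 : 0 ≤ 1 - H * d := by linarith
  have h2 : b * ρ / ((b * ρ) ^ H) ^ d = (b * ρ) ^ (1 - H * d) := by
    rw [Real.rpow_sub (by positivity), Real.rpow_one, Real.rpow_mul (by positivity),
      Real.rpow_natCast]
  rw [h2]
  calc (b * ρ) ^ (1 - H * d) ≤ (2 * b * r) ^ (1 - H * d) :=
        Real.rpow_le_rpow (by positivity) (by nlinarith) h1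
    _ = (2 * b) ^ (1 - H * d) * r ^ (1 - H * d) := Real.mul_rpow (by positivity) hr.le
    _ ≤ (2 * b) ^ (1 : ℝ) * r ^ (1 - H * d) := by
        have : 0 ≤ H * d := by positivity
        gcongr
        linarith
    _ = _ := by rw [Real.rpow_one]

theorem rpow_le_mul_rpow {x y c p : ℝ} (hx : 0 ≤ x) (hy : 0 ≤ y) (hc : 1 ≤ c) (h : x ≤ c * y)
    (hp0 : 0 ≤ p) (hp1 : p ≤ 1) : x ^ p ≤ c * y ^ p := by
  calc x ^ p ≤ (c * y) ^ p := Real.rpow_le_rpow hx h hp0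
    _ = c ^ p * y ^ p := Real.mul_rpow (by linarith) hy
    _ ≤ c ^ (1 : ℝ) * y ^ p := by gcongr
    _ = c * y ^ p := by rw [Real.rpow_one]

theorem mul_log_two_le_log_inv {r : ℝ} {k : ℕ} (hr0 : 0 < r) (hr : r ≤ (1 / 2) ^ k) :
    k * Real.log 2 ≤ Real.log r⁻¹ := by
  rw [Real.log_inv, le_neg]
  have := Real.log_le_log hr0 hr
  rwa [Real.log_pow, one_div, Real.log_inv, mul_neg] at this

variable {Ω : Type*} [mΩ : MeasurableSpace Ω] {P : Measure Ω} {d : ℕ}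
  {T H : ℝ} {L : Ω → E d → ℝ → ℝ}

/-- Exponential tails of the rescaled local time of an interval, uniformly in space. -/
def LocalTimeTails (P : Measure Ω) (T H : ℝ) (L : Ω → E d → ℝ → ℝ) : Prop :=
  ∃ A C : ℝ, 0 < A ∧ 0 < C ∧ ∀ a r : ℝ, 0 ≤ a → 0 < r → r ≤ 1 → a + r ≤ T → ∀ N : ℕ, 1 ≤ N →
    P {ω | ∃ x, A * (N : ℝ) ^ (H * d) * (r / (r ^ H) ^ d) < L ω x (a + r) - L ω x a} ≤
      ENNReal.ofReal (C * (1 / 2) ^ N)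

theorem sub_le_of_window {l : ℝ → ℝ} (hl : MonotoneOn l (Icc 0 T)) {s r a b : ℝ}
    (hs : s ∈ Icc 0 T) (hr : 0 < r) (ha : 0 ≤ a) (hb : b ≤ T) (h1 : a ≤ max (s - r) 0)
    (h2 : min (s + r) T ≤ b) :
    l (min (s + r) T) - l (max (s - r) 0) ≤ l b - l a := by
  have hm : max (s - r) 0 ∈ Icc 0 T := ⟨le_max_right _ _, max_le (by linarith [hs.2])
    (hs.1.trans hs.2)⟩
  have hM : min (s + r) T ∈ Icc 0 T := ⟨le_min (by linarith [hs.1]) (hs.1.trans hs.2),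
    min_le_right _ _⟩
  have e1 := hl ⟨ha, h1.trans hm.2⟩ hm h1
  have e2 := hl hM ⟨hM.1.trans h2, hb⟩ h2
  linarith

/-- Borel–Cantelli along r = 2⁻ᵏ for a fixed time: N of order log k makes the tail 2⁻ᴺ summable, and
log k is comparable to log log r⁻¹. -/
theorem LocalTimeTails.ae_eventually_le_loglog (hL : LocalTimeTails P T H L)
    (hmono : ∀ᵐ ω ∂P, ∀ x, MonotoneOn (L ω x) (Icc 0 T)) (hH : 0 < H) (hHd : H * d < 1)
    (hT : 0 < T) :
    ∃ C : ℝ, 0 < C ∧ ∀ s ∈ Icc 0 T, ∀ᵐ ω ∂P, ∀ᶠ r in 𝓝[>] (0 : ℝ), ∀ x,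
      L ω x (min (s + r) T) - L ω x (max (s - r) 0) ≤
        C * (r ^ (1 - H * d) * Real.log (Real.log r⁻¹) ^ (H * d)) := by
  obtain ⟨A, C, hA, hC, h⟩ := hL
  refine ⟨48 * A, by positivity, fun s hs => ?_⟩
  let ρ : ℕ → ℝ := fun k => (1 / 2) ^ k
  have hρ0 : ∀ k, 0 < ρ k := fun k => by positivity
  -- Left end of an interval of length `2 * ρ k` inside [0, T] that contains the clipped window;
  -- near `T` it is shifted to the left.
  let a : ℕ → ℝ := fun k => min (max (s - ρ k) 0) (T - 2 * ρ k)
  -- Twice an integer at least log₂ k, so that 2⁻ᴺ ≤ k⁻².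
  let N : ℕ → ℕ := fun k => 2 * (Nat.log 2 k + 1)
  have hρlim : Tendsto ρ atTop (𝓝 0) :=
    tendsto_pow_atTop_nhds_zero_of_lt_one (by norm_num) (by norm_num)
  obtain ⟨k₁, hk₁⟩ := eventually_atTop.1 ((hρlim.eventually (ge_mem_nhds (half_pos hT))).and
    (hρlim.eventually (ge_mem_nhds (one_half_pos (α := ℝ)))))
  let S : ℕ → Set Ω := fun k => {ω | ∃ x, A * (N k : ℝ) ^ (H * d) *
    (2 * ρ k / ((2 * ρ k) ^ H) ^ d) < L ω x (a k + 2 * ρ k) - L ω x (a k)}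
  have hS : ∀ k, P (S (k + k₁)) ≤ ENNReal.ofReal (C * (((k + k₁ : ℕ) : ℝ) ^ 2)⁻¹) := by
    intro k
    have hk := hk₁ (k + k₁) (by omega)
    refine (h (a (k + k₁)) (2 * ρ (k + k₁)) (le_min (le_max_right _ _) (by linarith [hk.1]))
      (by linarith [hρ0 (k + k₁)]) (by linarith [hk.2]) ?_ (N (k + k₁)) (by simp [N]; omega)).trans
      (ENNReal.ofReal_le_ofReal ?_)
    · have : a (k + k₁) ≤ T - 2 * ρ (k + k₁) := min_le_right _ _
      linarith
    · refine mul_le_mul_of_nonneg_left ?_ hC.le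
      rcases Nat.eq_zero_or_pos (k + k₁) with h0 | h0
      · have := hk.2
        simp [ρ, h0] at this
        norm_num at this
      · have h1 : ((k + k₁ : ℕ) : ℝ) ≤ 2 ^ (Nat.log 2 (k + k₁) + 1) := by
          exact_mod_cast (Nat.lt_pow_succ_log_self one_lt_two _).le
        have h2 : (0 : ℝ) < (k + k₁ : ℕ) := by exact_mod_cast h0
        simp only [N]
        rw [mul_comm, pow_mul, one_div, inv_pow, inv_pow]
        gcongr
  have hsum : ∑' k, P (S (k + k₁)) ≠ ∞ := by
    refine ne_top_of_le_ne_top ?_ (ENNReal.tsum_le_tsum hS)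
    refine Summable.tsum_ofReal_ne_top (Summable.mul_left _ ?_)
    exact (summable_nat_add_iff (f := fun n : ℕ => ((n : ℝ) ^ 2)⁻¹) k₁).2
      (Real.summable_nat_pow_inv.2 one_lt_two)
  filter_upwards [ae_eventually_notMem hsum, hmono] with ω hω hωm
  obtain ⟨k₂, hk₂⟩ := eventually_atTop.1 hω
  refine eventually_nhdsGT_of_dyadic (eventually_atTop.2 ⟨k₂ + k₁ + 4, fun k hk r hr hr' x => ?_⟩)
  obtain ⟨i, rfl⟩ := Nat.exists_eq_add_of_le' (show k₁ ≤ k by omega)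
  set k := i + k₁ with hkdef
  have hkk := hk₁ k (by omega)
  have hr0 : 0 < r := lt_of_le_of_lt (by positivity) hr
  have hbound : L ω x (a k + 2 * ρ k) - L ω x (a k) ≤ A * (N k : ℝ) ^ (H * d) *
      (2 * ρ k / ((2 * ρ k) ^ H) ^ d) := not_lt.1 fun hcon => hk₂ i (by omega) ⟨x, hcon⟩
  have hwin := sub_le_of_window (hωm x) (a := a k) (b := a k + 2 * ρ k) hs hr0
    (le_min (le_max_right _ _) (by linarith [hkk.1]))
    (by have : a k ≤ T - 2 * ρ k := min_le_right _ _
        linarith)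
    ((min_le_left _ _).trans (max_le_max (sub_le_sub_left hr' s) le_rfl)) (by
      rcases le_total (max (s - ρ k) 0) (T - 2 * ρ k) with h1 | h1
      · have e : a k = max (s - ρ k) 0 := min_eq_left h1
        have h2 : s - ρ k ≤ a k := e ▸ le_max_left _ _
        refine (min_le_left _ _).trans ?_
        have : r ≤ ρ k := hr'
        linarith
      · have e : a k = T - 2 * ρ k := min_eq_right h1
        refine (min_le_right _ _).trans ?_
        linarith)
  have hgeo : 2 * ρ k / ((2 * ρ k) ^ H) ^ d ≤ 2 * 2 * r ^ (1 - H * d) :=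
    div_pow_rpow_le hH hHd (by norm_num) (hρ0 k) (by
      simp only [ρ]; rw [pow_succ] at hr; linarith)
  have hk4 : (4 : ℝ) ≤ k := by
    have : 4 ≤ k := by omega
    exact_mod_cast this
  have hlog2 : 1 / 2 ≤ Real.log 2 := by linarith [Real.log_two_gt_d9]
  have hlogk : 2 * Real.log 2 ≤ Real.log k := by
    have := Real.log_le_log (by norm_num) hk4
    rwa [show (4 : ℝ) = 2 ^ 2 by norm_num, Real.log_pow] at this
  have hll : Real.log k / 2 ≤ Real.log (Real.log r⁻¹) := by
    have h1 := mul_log_two_le_log_inv hr0 hr'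
    have h2 : (k : ℝ) / 2 ≤ Real.log r⁻¹ := by nlinarith
    have h3 := Real.log_le_log (by linarith) h2
    rw [Real.log_div (by linarith) (by norm_num)] at h3
    linarith
  have hN : (N k : ℝ) ≤ 12 * Real.log (Real.log r⁻¹) := by
    have h1 : ((2 : ℝ) ^ Nat.log 2 k) ≤ k := by
      exact_mod_cast Nat.pow_log_le_self 2 (by omega)
    have h2 := Real.log_le_log (by positivity) h1
    rw [Real.log_pow] at h2
    have h3 : (Nat.log 2 k : ℝ) ≤ 2 * Real.log k := by
      have : (0 : ℝ) ≤ Nat.log 2 k := Nat.cast_nonneg _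
      nlinarith
    simp only [N]
    push_cast
    linarith
  have hN' : (N k : ℝ) ^ (H * d) ≤ 12 * Real.log (Real.log r⁻¹) ^ (H * d) :=
    rpow_le_mul_rpow (Nat.cast_nonneg _) (by linarith) (by norm_num) hN (by positivity) hHd.le
  have hll0 : 0 ≤ Real.log (Real.log r⁻¹) := by linarith
  calc L ω x (min (s + r) T) - L ω x (max (s - r) 0)
      ≤ A * (N k : ℝ) ^ (H * d) * (2 * ρ k / ((2 * ρ k) ^ H) ^ d) := hwin.trans hbound
    _ ≤ A * (12 * Real.log (Real.log r⁻¹) ^ (H * d)) * (2 * 2 * r ^ (1 - H * d)) := by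
        gcongr
    _ = _ := by ring

/-- For all times at once about T 2ᵏ intervals are needed at radius 2⁻ᵏ. With N = 2k the tail 4⁻ᵏ
survives the union bound, and k is comparable to log r⁻¹. -/
theorem LocalTimeTails.ae_eventually_le_log (hL : LocalTimeTails P T H L)
    (hmono : ∀ᵐ ω ∂P, ∀ x, MonotoneOn (L ω x) (Icc 0 T)) (hH : 0 < H) (hHd : H * d < 1)
    (hT : 0 < T) :
    ∃ C : ℝ, 0 < C ∧ ∀ᵐ ω ∂P, ∀ᶠ r in 𝓝[>] (0 : ℝ), ∀ s ∈ Icc 0 T, ∀ x,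
      L ω x (min (s + r) T) - L ω x (max (s - r) 0) ≤
        C * (r ^ (1 - H * d) * Real.log r⁻¹ ^ (H * d)) := by
  obtain ⟨A, C, hA, hC, h⟩ := hL
  refine ⟨24 * A, by positivity, ?_⟩
  let ρ : ℕ → ℝ := fun k => (1 / 2) ^ k
  -- A window of length at most `2 * ρ k` whose left end lies in a cell of length `ρ k` fits into an
  -- interval of length `3 * ρ k`.
  have hρ0 : ∀ k, 0 < ρ k := fun k => by positivity
  let a : ℕ → ℕ → ℝ := fun k i => min (i * ρ k) (T - 3 * ρ k)
  let n : ℕ → ℕ := fun k => ⌊T * 2 ^ k⌋₊ + 1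
  have hρlim : Tendsto ρ atTop (𝓝 0) :=
    tendsto_pow_atTop_nhds_zero_of_lt_one (by norm_num) (by norm_num)
  obtain ⟨k₁, hk₁⟩ := eventually_atTop.1
    ((hρlim.eventually (ge_mem_nhds (show 0 < T / 3 by positivity))).and
    (hρlim.eventually (ge_mem_nhds (show (0 : ℝ) < 1 / 3 by norm_num))))
  let S : ℕ → Set Ω := fun k => ⋃ i ∈ Finset.range (n k), {ω | ∃ x,
    A * ((2 * k : ℕ) : ℝ) ^ (H * d) * (3 * ρ k / ((3 * ρ k) ^ H) ^ d) <
      L ω x (a k i + 3 * ρ k) - L ω x (a k i)}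
  have hS : ∀ k, P (S (k + k₁)) ≤ ENNReal.ofReal (C * (T + 1) * (1 / 2) ^ (k + k₁)) := by
    intro k
    have hk := hk₁ (k + k₁) (by omega)
    have hkpos : 0 < k + k₁ := by
      rcases Nat.eq_zero_or_pos (k + k₁) with h0 | h0
      · have := hk.2
        simp [ρ, h0] at this
        norm_num at this
      · exact h0
    have hi : ∀ i, P {ω | ∃ x, A * ((2 * (k + k₁) : ℕ) : ℝ) ^ (H * d) *
        (3 * ρ (k + k₁) / ((3 * ρ (k + k₁)) ^ H) ^ d) <
        L ω x (a (k + k₁) i + 3 * ρ (k + k₁)) - L ω x (a (k + k₁) i)} ≤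
        ENNReal.ofReal (C * (1 / 2) ^ (2 * (k + k₁))) := by
      intro i
      refine h _ (3 * ρ (k + k₁)) (le_min (by positivity) (by linarith [hk.1]))
        (by linarith [hρ0 (k + k₁)]) (by linarith [hk.2]) ?_ (2 * (k + k₁)) (by omega)
      have : a (k + k₁) i ≤ T - 3 * ρ (k + k₁) := min_le_right _ _
      linarith
    refine (measure_biUnion_finset_le _ _).trans ((Finset.sum_le_sum fun i _ => hi i).trans ?_)
    rw [Finset.sum_const, Finset.card_range, nsmul_eq_mul, ← ENNReal.ofReal_natCast,
      ← ENNReal.ofReal_mul (by positivity)]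
    refine ENNReal.ofReal_le_ofReal ?_
    have hn : (n (k + k₁) : ℝ) ≤ (T + 1) * 2 ^ (k + k₁) := by
      have h1 := Nat.floor_le (show 0 ≤ T * 2 ^ (k + k₁) by positivity)
      have h2 : (1 : ℝ) ≤ 2 ^ (k + k₁) := one_le_pow₀ (by norm_num)
      simp only [n]
      push_cast
      linarith
    calc (n (k + k₁) : ℝ) * (C * (1 / 2) ^ (2 * (k + k₁)))
        ≤ ((T + 1) * 2 ^ (k + k₁)) * (C * (1 / 2) ^ (2 * (k + k₁))) := by gcongr
      _ = C * (T + 1) * (1 / 2) ^ (k + k₁) := by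
        rw [two_mul, pow_add (1 / 2 : ℝ), one_div, inv_pow]; field_simp
  have hsum : ∑' k, P (S (k + k₁)) ≠ ∞ := by
    refine ne_top_of_le_ne_top ?_ (ENNReal.tsum_le_tsum hS)
    refine Summable.tsum_ofReal_ne_top (Summable.mul_left _ ?_)
    exact (summable_nat_add_iff k₁).2 (summable_geometric_of_lt_one (by norm_num) (by norm_num))
  filter_upwards [ae_eventually_notMem hsum, hmono] with ω hω hωm
  obtain ⟨k₂, hk₂⟩ := eventually_atTop.1 hω
  refine eventually_nhdsGT_of_dyadic
    (eventually_atTop.2 ⟨k₂ + k₁ + 1, fun k hk r hr hr' s hs x => ?_⟩)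
  obtain ⟨i, rfl⟩ := Nat.exists_eq_add_of_le' (show k₁ ≤ k by omega)
  set k := i + k₁ with hkdef
  have hkk := hk₁ k (by omega)
  have hr0 : 0 < r := lt_of_le_of_lt (by positivity) hr
  have hρk := hρ0 k
  set u := max (s - r) 0 with hu
  have hu0 : 0 ≤ u := le_max_right _ _
  have huT : u ≤ T := max_le (by linarith [hs.2]) (hs.1.trans hs.2)
  set l := ⌊u / ρ k⌋₊ with hl
  have hlu : l * ρ k ≤ u := by
    rw [← le_div_iff₀ hρk]; exact Nat.floor_le (by positivity)
  have hul : u < (l + 1) * ρ k := by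
    rw [← div_lt_iff₀ hρk]; exact Nat.lt_floor_add_one _
  have hln : l < n k := by
    refine Nat.lt_succ_of_le (Nat.floor_le_floor ?_)
    rw [div_le_iff₀ hρk, mul_assoc, ← mul_pow]
    simpa using huT
  have hbound : L ω x (a k l + 3 * ρ k) - L ω x (a k l) ≤ A * ((2 * k : ℕ) : ℝ) ^ (H * d) *
      (3 * ρ k / ((3 * ρ k) ^ H) ^ d) := not_lt.1 fun hcon => hk₂ i (by omega) (by
        simp only [S, mem_iUnion]
        exact ⟨l, Finset.mem_range.2 hln, x, hcon⟩)
  have hwin := sub_le_of_window (hωm x) (a := a k l) (b := a k l + 3 * ρ k) hs hr0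
    (le_min (by positivity) (by linarith [hkk.1]))
    (by have : a k l ≤ T - 3 * ρ k := min_le_right _ _
        linarith)
    ((min_le_left _ _).trans hlu) (by
      rcases le_total (l * ρ k) (T - 3 * ρ k) with h1 | h1
      · have e : a k l = l * ρ k := min_eq_left h1
        have h2 : s - r ≤ u := le_max_left _ _
        refine (min_le_left _ _).trans ?_
        have : r ≤ ρ k := hr'
        rw [e]
        linarith
      · have e : a k l = T - 3 * ρ k := min_eq_right h1
        refine (min_le_right _ _).trans ?_
        linarith)
  have hgeo : 3 * ρ k / ((3 * ρ k) ^ H) ^ d ≤ 2 * 3 * r ^ (1 - H * d) :=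
    div_pow_rpow_le hH hHd (by norm_num) hρk (by
      simp only [ρ]; rw [pow_succ] at hr; linarith)
  have hk0 : (0 : ℝ) ≤ k := Nat.cast_nonneg _
  have hlog := mul_log_two_le_log_inv hr0 hr'
  have hN : ((2 * k : ℕ) : ℝ) ≤ 4 * Real.log r⁻¹ := by
    have hlog2 : 1 / 2 ≤ Real.log 2 := by linarith [Real.log_two_gt_d9]
    push_cast
    nlinarith
  have hlog0 : 0 ≤ Real.log r⁻¹ := by
    have : (0 : ℝ) ≤ ((2 * k : ℕ) : ℝ) := Nat.cast_nonneg _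
    linarith
  have hN' : ((2 * k : ℕ) : ℝ) ^ (H * d) ≤ 4 * Real.log r⁻¹ ^ (H * d) :=
    rpow_le_mul_rpow (Nat.cast_nonneg _) hlog0 (by norm_num) hN (by positivity) hHd.le
  calc L ω x (min (s + r) T) - L ω x (max (s - r) 0)
      ≤ A * ((2 * k : ℕ) : ℝ) ^ (H * d) * (3 * ρ k / ((3 * ρ k) ^ H) ^ d) := hwin.trans hbound
    _ ≤ A * (4 * Real.log r⁻¹ ^ (H * d)) * (2 * 3 * r ^ (1 - H * d)) := by
        gcongr
    _ = _ := by ring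

end GaussianLocalTime

end


noncomputable section

namespace GaussianLocalTime

/-! ### The assertions -/

variable {Ω : Type*} [mΩ : MeasurableSpace Ω] {P : Measure Ω} {d : ℕ}
  {T H : ℝ} {L : Ω → E d → ℝ → ℝ}

theorem loglogGauge_zero (d : ℕ) (H r : ℝ) : loglogGauge d H 0 r =
    ENNReal.ofReal (r ^ (1 - H * d) * Real.log (Real.log r⁻¹) ^ (H * d)) := by
  rw [loglogGauge, add_zero]

theorem logGauge_zero (d : ℕ) (H r : ℝ) : logGauge d H 0 r =
    ENNReal.ofReal (r ^ (1 - H * d) * Real.log r⁻¹ ^ (H * d)) := by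
  rw [logGauge, add_zero]

theorem ofReal_div_ofReal_le {C x g : ℝ} (hC : 0 ≤ C) (h : x ≤ C * g) :
    ENNReal.ofReal x / ENNReal.ofReal g ≤ (C.toNNReal : ℝ≥0∞) := by
  refine ENNReal.div_le_of_le_mul ?_
  change _ ≤ ENNReal.ofReal C * _
  rw [← ENNReal.ofReal_mul hC]
  exact ENNReal.ofReal_le_ofReal h

theorem LocalTimeTails.uniformLocalTimeBounds (hL : LocalTimeTails P T H L)
    (hmono : ∀ᵐ ω ∂P, ∀ x, MonotoneOn (L ω x) (Icc 0 T)) (hH : 0 < H) (hHd : H * d < 1)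
    (hT : 0 < T) : UniformLocalTimeBounds P T H 0 L := by
  obtain ⟨C₁, hC₁, h₁⟩ := hL.ae_eventually_le_loglog hmono hH hHd hT
  obtain ⟨C₂, hC₂, h₂⟩ := hL.ae_eventually_le_log hmono hH hHd hT
  refine ⟨C₁.toNNReal, C₂.toNNReal, fun s hs => ?_, ?_⟩
  · filter_upwards [h₁ s hs] with ω hω
    refine limsup_le_of_le (by isBoundedDefault) ?_
    filter_upwards [hω] with r hr
    simp only [loglogGauge_zero]
    rw [ENNReal.iSup_div]
    exact iSup_le fun x => ofReal_div_ofReal_le hC₁.le (hr x)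
  · filter_upwards [h₂] with ω hω
    refine limsup_le_of_le (by isBoundedDefault) ?_
    filter_upwards [hω] with r hr
    simp only [logGauge_zero]
    exact iSup₂_le fun s hs => iSup_le fun x => ofReal_div_ofReal_le hC₂.le (hr s hs x)

theorem UniformLocalTimeBounds.pointwiseLocalTimeBounds {α θ : ℝ}
    (h : UniformLocalTimeBounds P T α θ L) : PointwiseLocalTimeBounds P T α θ L := by
  obtain ⟨C₁, C₂, h₁, h₂⟩ := h
  refine ⟨C₁, C₂, fun t ht x => ?_, fun x => ?_⟩
  · filter_upwards [h₁ t ht] with ω hω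
    refine (limsup_le_limsup (Eventually.of_forall fun r => ?_)).trans hω
    exact ENNReal.div_le_div_right (le_iSup (fun x => windowLocalTime T (L ω) x t r) x) _
  · filter_upwards [h₂] with ω hω
    refine (limsup_le_limsup (Eventually.of_forall fun r => ?_)).trans hω
    exact iSup₂_mono fun s _ =>
      le_iSup (fun x => windowLocalTime T (L ω) x s r / logGauge d α θ r) x

/-- A path that stays in a ball during a time window has a large local time somewhere. -/
theorem IsContinuousLocalTime.le_mul_pow {f : ℝ → E d} {L : E d → ℝ → ℝ}
    (h : IsContinuousLocalTime T f L) (hf : ContinuousOn f (Icc 0 T)) {s r M ρ : ℝ}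
    (hs : s ∈ Icc 0 T) (hr : 0 < r) (hrT : r ≤ T) (hM : 0 ≤ M) (hρ : 0 ≤ ρ)
    (hLM : ∀ x, L x (min (s + r) T) - L x (max (s - r) 0) ≤ M)
    (hfρ : ∀ t ∈ Ioo (s - r) (s + r) ∩ Icc 0 T, ‖f t - f s‖ ≤ ρ) :
    r ≤ M * (ρ ^ d * (volume (Metric.closedBall (0 : E d) 1)).toReal) := by
  set u := max (s - r) 0 with hu
  set v := min (s + r) T with hv
  set b := Metric.closedBall (f s) ρ with hb
  have hbm : MeasurableSet b := Metric.isClosed_closedBall.measurableSet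
  have hu0 : 0 ≤ u := le_max_right _ _
  have huT : u ≤ T := max_le (by linarith [hs.2]) (hs.1.trans hs.2)
  have hvT : v ≤ T := min_le_right _ _
  have hv0 : 0 ≤ v := le_min (by linarith [hs.1]) (hs.1.trans hs.2)
  -- Clipping to [0, T] removes at most half of the window, as `r ≤ T`.
  have huv : r ≤ v - u := by
    rcases le_total (s - r) 0 with h1 | h1
    · have : u = 0 := max_eq_right h1
      rw [this, sub_zero]
      exact le_min (by linarith [hs.1]) hrT
    · have : u = s - r := max_eq_left h1
      have : s ≤ v := le_min (by linarith) hs.2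
      linarith
  have hocc : ∀ t ∈ Icc 0 T, occupationMeasure f (Icc 0 t) b =
      (volume.restrict (Icc 0 t)) (f ⁻¹' b) := fun t ht =>
    Measure.map_apply_of_aemeasurable
      ((hf.mono (Icc_subset_Icc_right ht.2)).aemeasurable measurableSet_Icc) hbm
  have hdens : ∀ t ∈ Icc 0 T, occupationMeasure f (Icc 0 t) b =
      ∫⁻ x in b, ENNReal.ofReal (L x t) := fun t ht => by
    rw [h.density t ht, withDensity_apply _ hbm]
  have hvm : v ∈ Icc 0 T := ⟨hv0, hvT⟩
  have hum : u ∈ Icc 0 T := ⟨hu0, huT⟩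
  have h1 : occupationMeasure f (Icc 0 u) b + ENNReal.ofReal (v - u) ≤
      occupationMeasure f (Icc 0 v) b := by
    have e : volume.restrict (Icc 0 v) = volume.restrict (Icc 0 u) + volume.restrict (Ioc u v) := by
      rw [← Icc_union_Ioc_eq_Icc hu0 (by linarith : u ≤ v)]
      refine Measure.restrict_union ?_ measurableSet_Ioc
      rw [Set.disjoint_left]
      intro x hx hx'
      exact absurd hx'.1 (not_lt.2 hx.2)
    rw [hocc u hum, hocc v hvm, e, Measure.add_apply]
    gcongr
    calc ENNReal.ofReal (v - u) = (volume.restrict (Ioc u v)) (Ioo u v) := by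
          rw [Measure.restrict_apply measurableSet_Ioo,
            inter_eq_self_of_subset_left Ioo_subset_Ioc_self, Real.volume_Ioo]
      _ ≤ (volume.restrict (Ioc u v)) (f ⁻¹' b) := by
          refine measure_mono fun t ht => ?_
          rw [mem_preimage, hb, mem_closedBall_iff_norm]
          exact hfρ t ⟨⟨(le_max_left _ _).trans_lt ht.1, ht.2.trans_le (min_le_left _ _)⟩,
            ⟨hu0.trans ht.1.le, ht.2.le.trans hvT⟩⟩
  -- The time spent in the ball during the window is the space integral of the local time increment,
  -- at most `M` times the volume.
  have h2 : occupationMeasure f (Icc 0 v) b ≤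
      occupationMeasure f (Icc 0 u) b + ENNReal.ofReal M * volume b := by
    rw [hdens v hvm, hdens u hum, ← setLIntegral_const, ← lintegral_add_right _ measurable_const]
    refine lintegral_mono fun x => ?_
    refine le_trans (ENNReal.ofReal_le_ofReal ?_) ENNReal.ofReal_add_le
    have := hLM x
    linarith
  have hfin : occupationMeasure f (Icc 0 u) b ≠ ∞ := by
    rw [hocc u hum]; exact measure_ne_top _ _
  have h3 : ENNReal.ofReal (v - u) ≤ ENNReal.ofReal M * volume b :=
    (ENNReal.add_le_add_iff_left hfin).1 (h1.trans h2)
  have hvol : volume b = ENNReal.ofReal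
      (ρ ^ d * (volume (Metric.closedBall (0 : E d) 1)).toReal) := by
    rw [hb, Measure.addHaar_closedBall' volume _ hρ, finrank_euclideanSpace_fin,
      ENNReal.ofReal_mul (by positivity), ENNReal.ofReal_toReal measure_closedBall_lt_top.ne]
  rw [hvol, ← ENNReal.ofReal_mul hM, ENNReal.ofReal_le_ofReal_iff (by positivity)] at h3
  linarith

/-- An upper bound for the local time of a window gives a lower bound for the oscillation. -/
theorem IsContinuousLocalTime.le_oscillation (hd : 0 < d) {f : ℝ → E d} {L : E d → ℝ → ℝ}
    (h : IsContinuousLocalTime T f L) (hf : ContinuousOn f (Icc 0 T)) {s r C κ l : ℝ}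
    (hs : s ∈ Icc 0 T) (hr : 0 < r) (hrT : r ≤ T) (hr1 : r ≤ 1) (hl : 1 ≤ l) (hC : 0 < C)
    (hH : 0 < H) (hκ : 0 < κ) (hκ1 : κ ≤ 1)
    (hκC : κ * (2 * (C * (volume (Metric.closedBall (0 : E d) 1)).toReal)) ≤ 1)
    (hL : ∀ x, L x (min (s + r) T) - L x (max (s - r) 0) ≤ C * (r ^ (1 - H * d) * l ^ (H * d))) :
    (κ.toNNReal : ℝ≥0∞) ≤ oscillation T f s r /
      ENNReal.ofReal (r ^ (H * d) * l ^ (-(H * (d + 0)))) := by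
  set g := r ^ (H * d) * l ^ (-(H * (d + 0))) with hg
  have hl0 : 0 < l := by linarith
  have hHd : 0 ≤ H * d := by positivity
  have hg0 : 0 < g := by positivity
  have hg1 : g ≤ 1 := mul_le_one₀ (Real.rpow_le_one hr.le hr1 hHd) (by positivity)
    (Real.rpow_le_one_of_one_le_of_nonpos hl (by simpa using hHd))
  rw [ENNReal.le_div_iff_mul_le (Or.inl (by simpa using hg0)) (Or.inl ENNReal.ofReal_ne_top)]
  change ENNReal.ofReal κ * _ ≤ _
  rw [← ENNReal.ofReal_mul hκ.le]
  by_contra! hcon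
  set V := (volume (Metric.closedBall (0 : E d) 1)).toReal with hV
  have hV0 : 0 ≤ V := ENNReal.toReal_nonneg
  have key := h.le_mul_pow hf hs hr hrT (M := C * (r ^ (1 - H * d) * l ^ (H * d)))
    (by positivity) (ρ := κ * g) (by positivity) hL (by
      intro t ht
      have h1 : ‖f t - f s‖ₑ ≤ oscillation T f s r :=
        le_iSup₂ (f := fun t (_ : t ∈ Ioo (s - r) (s + r) ∩ Icc 0 T) => ‖f t - f s‖ₑ) t ht
      have h2 := h1.trans hcon.le
      rw [← ofReal_norm] at h2
      exact (ENNReal.ofReal_le_ofReal_iff (by positivity)).1 h2)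
  -- The occupation argument involves the d-th power of the radius. As `κ * g ≤ 1`, this is at most
  -- `κ * g`, which suffices for a gauge with the exponent `H * d` instead of `H`.
  have hpow : (κ * g) ^ d ≤ κ * g :=
    pow_le_of_le_one (by positivity) (mul_le_one₀ hκ1 hg0.le hg1) hd.ne'
  have e1 : r ^ (1 - H * d) * l ^ (H * d) * g = r := by
    rw [hg, add_zero, mul_mul_mul_comm, ← Real.rpow_add hr, ← Real.rpow_add hl0]
    simp
  have : C * (r ^ (1 - H * d) * l ^ (H * d)) * ((κ * g) ^ d * V) ≤ r / 2 := by
    calc C * (r ^ (1 - H * d) * l ^ (H * d)) * ((κ * g) ^ d * V)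
        ≤ C * (r ^ (1 - H * d) * l ^ (H * d)) * ((κ * g) * V) := by gcongr
      _ = κ * (2 * (C * V)) * (r ^ (1 - H * d) * l ^ (H * d) * g) / 2 := by ring
      _ = κ * (2 * (C * V)) * r / 2 := by rw [e1]
      _ ≤ r / 2 := by
        have := mul_le_mul_of_nonneg_right hκC hr.le
        linarith
  linarith

theorem tendsto_log_inv_nhdsGT : Tendsto (fun r : ℝ => Real.log r⁻¹) (𝓝[>] 0) atTop :=
  Real.tendsto_log_atTop.comp tendsto_inv_nhdsGT_zero

theorem LocalTimeTails.oscillationBounds (hd : 0 < d) {Z : ℝ → Ω → E d}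
    (hL : LocalTimeTails P T H L)
    (hmono : ∀ᵐ ω ∂P, ∀ x, MonotoneOn (L ω x) (Icc 0 T))
    (hloc : ∀ᵐ ω ∂P, IsContinuousLocalTime T (Z · ω) (L ω))
    (hcont : ∀ᵐ ω ∂P, ContinuousOn (fun t => Z t ω) (Icc 0 T)) (hH : 0 < H) (hHd : H * d < 1)
    (hT : 0 < T) : OscillationBounds P T H 0 Z := by
  obtain ⟨C₁, hC₁, h₁⟩ := hL.ae_eventually_le_loglog hmono hH hHd hT
  obtain ⟨C₂, hC₂, h₂⟩ := hL.ae_eventually_le_log hmono hH hHd hT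
  set V := (volume (Metric.closedBall (0 : E d) 1)).toReal with hV
  have hV0 : 0 ≤ V := ENNReal.toReal_nonneg
  set C := max C₁ C₂ with hC
  have hC0 : 0 < C := lt_max_of_lt_left hC₁
  set κ := min 1 (1 / (2 * (C * V) + 1)) with hκ
  have hκ0 : 0 < κ := lt_min one_pos (by positivity)
  have hκC : κ * (2 * (C * V)) ≤ 1 := by
    have h3 : κ ≤ 1 / (2 * (C * V) + 1) := min_le_right _ _
    rw [le_div_iff₀ (by positivity)] at h3
    linarith
  have hsmall : ∀ᶠ r in 𝓝[>] (0 : ℝ), 0 < r ∧ r ≤ T ∧ r ≤ 1 := by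
    filter_upwards [Ioc_mem_nhdsGT (lt_min hT one_pos)] with r hr
    exact ⟨hr.1, hr.2.trans (min_le_left _ _), hr.2.trans (min_le_right _ _)⟩
  have hlog := tendsto_log_inv_nhdsGT.eventually (eventually_ge_atTop (1 : ℝ))
  have hloglog := (Real.tendsto_log_atTop.comp tendsto_log_inv_nhdsGT).eventually
    (eventually_ge_atTop (1 : ℝ))
  refine ⟨κ.toNNReal, Real.toNNReal_pos.2 hκ0, fun s hs => ?_, ?_⟩
  · filter_upwards [h₁ s hs, hloc, hcont] with ω hω hωL hωZ
    refine le_liminf_of_le (by isBoundedDefault) ?_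
    filter_upwards [hω, hsmall, hloglog] with r hr hr' hl
    refine hωL.le_oscillation hd hωZ hs hr'.1 hr'.2.1 hr'.2.2 hl hC0 hH hκ0 (min_le_left _ _) hκC
      fun x => (hr x).trans ?_
    have := hr'.1
    have hl' : 1 ≤ Real.log (Real.log r⁻¹) := hl
    gcongr
    exact le_max_left _ _
  · filter_upwards [h₂, hloc, hcont] with ω hω hωL hωZ
    refine le_liminf_of_le (by isBoundedDefault) ?_
    filter_upwards [hω, hsmall, hlog] with r hr hr' hl
    refine le_iInf₂ fun s hs => ?_
    refine hωL.le_oscillation hd hωZ hs hr'.1 hr'.2.1 hr'.2.2 hl hC0 hH hκ0 (min_le_left _ _) hκC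
      fun x => (hr s hs x).trans ?_
    have := hr'.1
    gcongr
    exact le_max_right _ _

theorem tendsto_rpow_mul_log_inv_rpow {p q : ℝ} (hp : 0 < p) :
    Tendsto (fun r : ℝ => r ^ p * Real.log r⁻¹ ^ q) (𝓝[>] 0) (𝓝 0) := by
  have h := (isLittleO_log_rpow_rpow_atTop q hp).tendsto_div_nhds_zero.comp
    (tendsto_inv_nhdsGT_zero (𝕜 := ℝ))
  refine h.congr' ?_
  filter_upwards [self_mem_nhdsWithin] with r hr
  have hr' : (0 : ℝ) < r := hr
  simp only [Function.comp]
  rw [Real.inv_rpow hr'.le, div_inv_eq_mul, mul_comm]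

/-- Differentiability at `s` bounds the oscillation by a multiple of r, whereas the lower bound
r^(Hd) (log r⁻¹)^(-Hd) is of larger order because Hd < 1. The version uniform in time is needed,
since `s` may depend on `ω`. -/
theorem OscillationBounds.nowhereDifferentiable {Z : ℝ → Ω → E d} (hHd : H * d < 1)
    (h : OscillationBounds P T H 0 Z) : NowhereDifferentiable P T Z := by
  obtain ⟨C, hC, -, h⟩ := h
  filter_upwards [h] with ω hω s hs hdiff
  have hC2 : ((C / 2 : ℝ≥0) : ℝ≥0∞) < C := by exact_mod_cast half_lt_self hC
  have h1 := eventually_lt_of_lt_liminf (hC2.trans_le hω) (by isBoundedDefault)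
  obtain ⟨K, hK⟩ := hdiff.isBigO_sub.bound
  obtain ⟨δ, hδ, hball⟩ := Metric.mem_nhdsWithin_iff.1 hK
  set K' := max K 0 with hK'
  have h2 := ((tendsto_rpow_mul_log_inv_rpow (p := 1 - H * d) (q := H * d) (by linarith)).const_mul
    (K' + 1)).eventually_lt_const (u := ((C / 2 : ℝ≥0) : ℝ)) (by
      rw [mul_zero]; exact_mod_cast half_pos hC)
  have h3 : ∀ᶠ r in 𝓝[>] (0 : ℝ), r ∈ Ioo 0 δ := Ioo_mem_nhdsGT hδ
  obtain ⟨r, h1, h2, hr, hl⟩ := (h1.and (h2.and (h3.and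
    (tendsto_log_inv_nhdsGT.eventually (eventually_gt_atTop (0 : ℝ)))))).exists
  have hr0 : 0 < r := hr.1
  have h3 : oscillation T (Z · ω) s r ≤ ENNReal.ofReal (K' * r) := by
    refine iSup₂_le fun t ht => ?_
    rw [← ofReal_norm]
    refine ENNReal.ofReal_le_ofReal ?_
    have hts : |t - s| < r := by rw [abs_lt]; constructor <;> linarith [ht.1.1, ht.1.2]
    have h4 : ‖Z t ω - Z s ω‖ ≤ K * ‖t - s‖ := hball ⟨by
      rw [Metric.mem_ball, Real.dist_eq]; exact hts.trans hr.2, ht.2⟩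
    refine h4.trans ?_
    calc K * ‖t - s‖ ≤ K' * ‖t - s‖ := by gcongr; exact le_max_left _ _
      _ ≤ K' * r := by gcongr; exact hts.le
  have h5 : ((C / 2 : ℝ≥0) : ℝ≥0∞) < oscillation T (Z · ω) s r / logOscGauge d H 0 r :=
    h1.trans_le (iInf₂_le s hs)
  set g := r ^ (H * d) * Real.log r⁻¹ ^ (-(H * (d + 0))) with hg
  have hg0 : 0 < g := by positivity
  have h6 := h5.le.trans (ENNReal.div_le_div_right h3 _)
  have h7 : logOscGauge d H 0 r = ENNReal.ofReal g := rfl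
  rw [h7, ← ENNReal.ofReal_div_of_pos hg0, ← ENNReal.ofReal_coe_nnreal,
    ENNReal.ofReal_le_ofReal_iff (by positivity), le_div_iff₀ hg0] at h6
  have e1 : r ^ (1 - H * d) * Real.log r⁻¹ ^ (H * d) * g = r := by
    rw [hg, add_zero, mul_mul_mul_comm, ← Real.rpow_add hr0, ← Real.rpow_add hl]
    simp
  have h8 := mul_lt_mul_of_pos_right h2 hg0
  have h9 : (K' + 1) * (r ^ (1 - H * d) * Real.log r⁻¹ ^ (H * d)) * g = (K' + 1) * r := by
    rw [mul_assoc, e1]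
  linarith

end GaussianLocalTime

end


noncomputable section

namespace GaussianLocalTime

/-! ### Moments of the increments -/

/-- The inequality y ≤ e^y at y = x² / (2p), raised to the power p / 2; it produces the growth
p^(p/2) of Gaussian moments. -/
theorem rpow_le_mul_exp_sq {x p : ℝ} (hx : 0 ≤ x) (hp : 0 < p) :
    x ^ p ≤ (2 * p) ^ (p / 2) * Real.exp (x ^ 2 / 4) := by
  have h1 : x ^ 2 / (2 * p) ≤ Real.exp (x ^ 2 / (2 * p)) :=
    (le_add_of_nonneg_right zero_le_one).trans (Real.add_one_le_exp _)
  have h2 : x ^ 2 ≤ 2 * p * Real.exp (x ^ 2 / (2 * p)) := by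
    rw [div_le_iff₀ (by positivity)] at h1; linarith
  calc x ^ p = (x ^ 2) ^ (p / 2) := by
        rw [← Real.rpow_natCast, ← Real.rpow_mul hx]; congr 1; push_cast; ring
    _ ≤ (2 * p * Real.exp (x ^ 2 / (2 * p))) ^ (p / 2) :=
        Real.rpow_le_rpow (by positivity) h2 (by positivity)
    _ = (2 * p) ^ (p / 2) * Real.exp (x ^ 2 / 4) := by
        rw [Real.mul_rpow (by positivity) (Real.exp_pos _).le, ← Real.exp_mul]
        congr 2; field_simp; ring

/-- The exponential at most halves the quadratic exponent of the density, so the integral is at most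
√2. A degenerate law is a Dirac mass and is treated separately. -/
theorem lintegral_exp_sq_gaussianReal_le {v : ℝ≥0} {S : ℝ} (hv : v ≤ S) :
    ∫⁻ x, ENNReal.ofReal (Real.exp (x ^ 2 / (4 * S))) ∂gaussianReal 0 v ≤ 2 := by
  rcases eq_or_ne v 0 with rfl | hv0
  · rw [gaussianReal_zero_var, lintegral_dirac]
    simp
  have hv' : (0 : ℝ) < v := by exact_mod_cast pos_iff_ne_zero.2 hv0
  have hpi := Real.pi_pos
  have hm : Measurable fun x : ℝ => ENNReal.ofReal (Real.exp (x ^ 2 / (4 * S))) := by fun_prop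
  rw [gaussianReal_of_var_ne_zero _ hv0,
    lintegral_withDensity_eq_lintegral_mul _ (measurable_gaussianPDF _ _) hm]
  have hb : 0 < 1 / (4 * (v : ℝ)) := by positivity
  have h1 : ∀ x : ℝ, (gaussianPDF 0 v * fun x : ℝ => ENNReal.ofReal (Real.exp (x ^ 2 / (4 * S)))) x
      ≤ ENNReal.ofReal ((√(2 * Real.pi * v))⁻¹ * Real.exp (-(1 / (4 * (v : ℝ))) * x ^ 2)) := by
    intro x
    rw [Pi.mul_apply, gaussianPDF, ← ENNReal.ofReal_mul (gaussianPDFReal_nonneg _ _ _),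
      gaussianPDFReal, mul_assoc, ← Real.exp_add]
    refine ENNReal.ofReal_le_ofReal ?_
    gcongr
    have h2 : x ^ 2 / (4 * S) ≤ x ^ 2 / (4 * v) := by gcongr
    have h3 : -(x - 0) ^ 2 / (2 * (v : ℝ)) = -(2 * (x ^ 2 / (4 * v))) := by
      rw [sub_zero]; field_simp; ring
    have h4 : -(1 / (4 * (v : ℝ))) * x ^ 2 = -(x ^ 2 / (4 * v)) := by ring
    rw [h3, h4]
    linarith
  refine (lintegral_mono h1).trans ?_
  rw [← ofReal_integral_eq_lintegral_ofReal ((_root_.integrable_exp_neg_mul_sq hb).const_mul _)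
    (Eventually.of_forall fun x => by positivity), integral_const_mul, integral_gaussian]
  rw [← ENNReal.ofReal_ofNat 2]
  refine ENNReal.ofReal_le_ofReal ?_
  rw [inv_mul_le_iff₀ (by positivity), Real.sqrt_le_left (by positivity), mul_pow,
    Real.sq_sqrt (by positivity)]
  field_simp
  norm_num

variable {Ω : Type*} [mΩ : MeasurableSpace Ω] {P : Measure Ω} {d : ℕ}

theorem lintegral_rpow_le_of_hasGaussianLaw {Y : Ω → ℝ} (hY : HasGaussianLaw Y P)
    (hY0 : ∫ ω, Y ω ∂P = 0) {σ : ℝ} (hσ : 0 < σ) (hYσ : ∫ ω, Y ω ^ 2 ∂P ≤ σ ^ 2) {p : ℝ}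
    (hp : 0 < p) :
    ∫⁻ ω, ‖Y ω‖ₑ ^ p ∂P ≤ ENNReal.ofReal (2 * (σ ^ p * (2 * p) ^ (p / 2))) := by
  have hYm : AEMeasurable Y P := hY.aemeasurable
  have hprob := hY.isProbabilityMeasure
  have hvar : Var[Y; P] ≤ σ ^ 2 := by
    rwa [variance_of_integral_eq_zero hYm hY0]
  have h1 : ∀ ω, ‖Y ω‖ₑ ^ p ≤ ENNReal.ofReal (σ ^ p * (2 * p) ^ (p / 2)) *
      ENNReal.ofReal (Real.exp (Y ω ^ 2 / (4 * σ ^ 2))) := by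
    intro ω
    rw [← ofReal_norm, ENNReal.ofReal_rpow_of_nonneg (norm_nonneg _) hp.le,
      ← ENNReal.ofReal_mul (by positivity)]
    refine ENNReal.ofReal_le_ofReal ?_
    have h2 := rpow_le_mul_exp_sq (x := ‖Y ω‖ / σ) (by positivity) hp
    rw [Real.div_rpow (norm_nonneg _) hσ.le, div_le_iff₀ (by positivity), div_pow,
      Real.norm_eq_abs, sq_abs] at h2
    rw [Real.norm_eq_abs]
    refine h2.trans (le_of_eq ?_)
    rw [div_div, mul_comm (σ ^ 2) 4]
    ring
  refine (lintegral_mono h1).trans ?_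
  rw [lintegral_const_mul' _ _ ENNReal.ofReal_ne_top, mul_comm 2 (_ * _),
    ENNReal.ofReal_mul (p := _ * _) (by positivity), ENNReal.ofReal_ofNat]
  gcongr
  have h3 := lintegral_exp_sq_gaussianReal_le (v := Var[Y; P].toNNReal) (S := σ ^ 2)
    (by rw [Real.coe_toNNReal _ (variance_nonneg _ _)]; exact hvar)
  rw [← hY0, ← hY.map_eq_gaussianReal, lintegral_map' (by fun_prop) hYm] at h3
  exact h3

theorem exists_norm_le_mul_abs (hd : 0 < d) (x : E d) : ∃ l, ‖x‖ ≤ d * |x l| := by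
  have : Nonempty (Fin d) := ⟨⟨0, hd⟩⟩
  obtain ⟨l, -, hl⟩ := Finset.exists_max_image Finset.univ (fun l => |x l|) Finset.univ_nonempty
  have hd1 : (1 : ℝ) ≤ d := by exact_mod_cast hd
  refine ⟨l, abs_le_of_sq_le_sq' ?_ (by positivity) |>.2⟩
  rw [EuclideanSpace.norm_sq_eq]
  calc ∑ i, ‖x i‖ ^ 2 ≤ ∑ _i : Fin d, |x l| ^ 2 := Finset.sum_le_sum fun i hi => by
        rw [Real.norm_eq_abs]
        have := hl i hi
        gcongr
    _ = d * |x l| ^ 2 := by simp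
    _ ≤ d ^ 2 * |x l| ^ 2 := by gcongr; exact le_self_pow₀ hd1 two_ne_zero
    _ = _ := by ring

theorem enorm_rpow_le_sum (hd : 0 < d) (x : E d) {p : ℝ} (hp : 0 < p) :
    ‖x‖ₑ ^ p ≤ (d : ℝ≥0∞) ^ p * ∑ l, ‖x l‖ₑ ^ p := by
  obtain ⟨l, hl⟩ := exists_norm_le_mul_abs hd x
  have h1 : ‖x‖ₑ ≤ d * ‖x l‖ₑ := by
    rw [← ofReal_norm, ← ofReal_norm, ← ENNReal.ofReal_natCast, ← ENNReal.ofReal_mul (by positivity)]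
    exact ENNReal.ofReal_le_ofReal hl
  calc ‖x‖ₑ ^ p ≤ (d * ‖x l‖ₑ) ^ p := ENNReal.rpow_le_rpow h1 hp.le
    _ = (d : ℝ≥0∞) ^ p * ‖x l‖ₑ ^ p := ENNReal.mul_rpow_of_nonneg _ _ hp.le
    _ ≤ _ := by
      gcongr
      exact Finset.single_le_sum (f := fun l => ‖x l‖ₑ ^ p) (fun _ _ => zero_le)
        (Finset.mem_univ l)

variable {T H : ℝ} {Z : ℝ → Ω → E d}

theorem IsCenteredGaussian.hasGaussianLaw_sub_coord (hG : IsCenteredGaussian P T Z) {s t : ℝ}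
    (hs : s ∈ Icc 0 T) (ht : t ∈ Icc 0 T) (l : Fin d) :
    HasGaussianLaw (fun ω => Z t ω l - Z s ω l) P := by
  have h := hG.gaussian.hasGaussianLaw_fun_sub (s := ⟨t, ht⟩) (t := ⟨s, hs⟩)
  exact h.map_fun (EuclideanSpace.proj l : E d →L[ℝ] ℝ)

theorem IsCenteredGaussian.integrable (hG : IsCenteredGaussian P T Z) {t : ℝ}
    (ht : t ∈ Icc 0 T) : Integrable (Z t) P :=
  (hG.gaussian.hasGaussianLaw_eval ⟨t, ht⟩).integrable

theorem IsCenteredGaussian.integral_coord (hG : IsCenteredGaussian P T Z) {t : ℝ}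
    (ht : t ∈ Icc 0 T) (l : Fin d) : ∫ ω, Z t ω l ∂P = 0 := by
  have h := (EuclideanSpace.proj l : E d →L[ℝ] ℝ).integral_comp_comm (hG.integrable ht)
  rw [hG.centered t ht, map_zero] at h
  exact h

theorem IsCenteredGaussian.integral_sub_coord (hG : IsCenteredGaussian P T Z) {s t : ℝ}
    (hs : s ∈ Icc 0 T) (ht : t ∈ Icc 0 T) (l : Fin d) : ∫ ω, (Z t ω l - Z s ω l) ∂P = 0 := by
  have h1 : ∀ t ∈ Icc 0 T, Integrable (fun ω => Z t ω l) P := fun t ht =>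
    (EuclideanSpace.proj l : E d →L[ℝ] ℝ).integrable_comp (hG.integrable ht)
  rw [integral_sub (h1 t ht) (h1 s hs), hG.integral_coord ht, hG.integral_coord hs, sub_zero]

theorem IncrementVarianceBounds.incrementMomentBounds (hd : 0 < d) (hT : 0 < T)
    (hG : IsCenteredGaussian P T Z) (hV : IncrementVarianceBounds P T H Z) :
    IncrementMomentBounds P T H (1 / 2) Z := by
  obtain ⟨Cm, Cp, hCm, hVb⟩ := hV
  have hCp : 0 < Cp := by
    have h := hVb 0 ⟨le_rfl, hT.le⟩ T ⟨hT.le, le_rfl⟩ ⟨0, hd⟩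
    have h1 : 0 < |T - 0| ^ (2 * H) := Real.rpow_pos_of_pos (by simpa using hT.ne') _
    exact (pos_iff_pos_of_mul_pos ((mul_pos hCm h1).trans_le (h.1.trans h.2))).2 h1
  have hd1 : (1 : ℝ) ≤ d := by exact_mod_cast hd
  -- One `d` compares the Euclidean norm with the largest coordinate. The factor `2 * d` comes from
  -- the Gaussian moment bound and the sum over coordinates, and is at most its own p-th power
  -- because `p ≥ 1`.
  refine ⟨2 * d * d * √Cp * √2, by positivity, fun p hp s t hs hst ht => ?_⟩
  have hp0 : 0 < p := by linarith
  rcases hst.eq_or_lt with rfl | hlt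
  · simp [hp0]
  have hsI : s ∈ Icc 0 T := ⟨hs, by linarith⟩
  have htI : t ∈ Icc 0 T := ⟨by linarith, ht⟩
  have hab : 0 < |t - s| := abs_pos.2 (by linarith)
  set σ := √Cp * |t - s| ^ H with hσ
  have hσ0 : 0 < σ := by positivity
  have hσ2 : σ ^ 2 = Cp * |t - s| ^ (2 * H) := by
    rw [hσ, mul_pow, Real.sq_sqrt hCp.le, mul_comm 2 H, Real.rpow_mul hab.le, Real.rpow_two]
  have h1 : ∀ l, ∫⁻ ω, ‖Z t ω l - Z s ω l‖ₑ ^ p ∂P ≤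
      ENNReal.ofReal (2 * (σ ^ p * (2 * p) ^ (p / 2))) := fun l =>
    lintegral_rpow_le_of_hasGaussianLaw (hG.hasGaussianLaw_sub_coord hsI htI l)
      (hG.integral_sub_coord hsI htI l) hσ0 (hσ2 ▸ (hVb s hsI t htI l).2) hp0
  calc ∫⁻ ω, ‖Z t ω - Z s ω‖ₑ ^ p ∂P
      ≤ ∫⁻ ω, (d : ℝ≥0∞) ^ p * ∑ l, ‖Z t ω l - Z s ω l‖ₑ ^ p ∂P :=
        lintegral_mono fun ω => enorm_rpow_le_sum hd _ hp0
    _ = (d : ℝ≥0∞) ^ p * ∑ l, ∫⁻ ω, ‖Z t ω l - Z s ω l‖ₑ ^ p ∂P := by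
        rw [lintegral_const_mul' _ _ (by simp [hp0.le]), lintegral_finsetSum']
        intro l _
        exact ((hG.hasGaussianLaw_sub_coord hsI htI l).aemeasurable.enorm).pow_const _
    _ ≤ (d : ℝ≥0∞) ^ p * ∑ _l : Fin d, ENNReal.ofReal (2 * (σ ^ p * (2 * p) ^ (p / 2))) := by
        gcongr with l; exact h1 l
    _ = ENNReal.ofReal ((d : ℝ) ^ p * (d * (2 * (σ ^ p * (2 * p) ^ (p / 2))))) := by
        rw [Finset.sum_const, Finset.card_univ, Fintype.card_fin, nsmul_eq_mul,
          ← ENNReal.ofReal_natCast, ENNReal.ofReal_rpow_of_nonneg (by positivity) hp0.le,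
          ← ENNReal.ofReal_mul (by positivity), ← ENNReal.ofReal_mul (by positivity)]
    _ ≤ _ := by
        refine ENNReal.ofReal_le_ofReal ?_
        have e1 : (2 * d : ℝ) ≤ (2 * d) ^ p := Real.self_le_rpow_of_one_le (by linarith) hp
        have e2 : σ ^ p = √Cp ^ p * |t - s| ^ (p * H) := by
          rw [hσ, Real.mul_rpow (by positivity) (by positivity), ← Real.rpow_mul hab.le, mul_comm p]
        have e3 : (2 * p) ^ (p / 2) = √2 ^ p * p ^ (p * (1 / 2)) := by
          rw [Real.mul_rpow (by norm_num) hp0.le, Real.sqrt_eq_rpow, ← Real.rpow_mul (by norm_num)]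
          congr 2 <;> ring
        have e4 : (2 * d * d * √Cp * √2 : ℝ) ^ p = (2 * d) ^ p * d ^ p * √Cp ^ p * √2 ^ p := by
          rw [Real.mul_rpow (by positivity) (by positivity), Real.mul_rpow (by positivity)
            (by positivity), Real.mul_rpow (by positivity) (by positivity)]
        rw [e2, e3, e4]
        calc (d : ℝ) ^ p * (d * (2 * (√Cp ^ p * |t - s| ^ (p * H) * (√2 ^ p * p ^ (p * (1 / 2))))))
            = (2 * d) * (d ^ p * √Cp ^ p * √2 ^ p * p ^ (p * (1 / 2)) * |t - s| ^ (p * H)) := by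
              ring
          _ ≤ (2 * d) ^ p * (d ^ p * √Cp ^ p * √2 ^ p * p ^ (p * (1 / 2)) * |t - s| ^ (p * H)) := by
              gcongr
          _ = _ := by ring

end GaussianLocalTime

end


/-! ### The assertions for locally nondeterministic processes -/

noncomputable section

namespace GaussianLocalTime

variable {Ω : Type*} [mΩ : MeasurableSpace Ω] {P : Measure Ω} [IsProbabilityMeasure P] {d : ℕ}
  {T H : ℝ} {Z : ℝ → Ω → E d}

/-- All assertions hold for a locally nondeterministic Gaussian process. -/
theorem localTimeAssertions_of_locallyNondeterministic (hd : 0 < d) (hH : 0 < H)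
    (hHd : H * d < 1) (hT : 0 < T)
    (hcont : ∀ᵐ ω ∂P, ContinuousOn (fun t => Z t ω) (Icc 0 T)) (hG : IsCenteredGaussian P T Z)
    (hV : IncrementVarianceBounds P T H Z) (hLND : LocallyNondeterministic P T Z) :
    LocalTimeAssertions P T H 0 (1 / 2) Z := by
  obtain ⟨X, hXm, hXc, hX0, hXZ⟩ := exists_continuous_modification hT
    (fun t ht => (hG.gaussian.hasGaussianLaw_eval ⟨t, ht⟩).aemeasurable) hcont
  obtain ⟨c, hc, hX⟩ := conditionalDecay_of_locallyNondeterministic hd hG hV hLND hXm hX0 hXZ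
  -- The analysis concerns the process recentred at 0; the local time of `Z` is obtained by
  -- translating by the initial value.
  let L : Ω → E d → ℝ → ℝ := fun ω x t => limitDensity (fun s => X s ω) (x - Z 0 ω) t
  have hlim := hX.ae_hasLimitDensity hc hXm hXc hX0 hH hHd hT
  have hloc : ∀ᵐ ω ∂P, IsContinuousLocalTime T (Z · ω) (L ω) := by
    filter_upwards [hlim, hXZ] with ω hω hωZ
    refine (hω.isContinuousLocalTime hT.le (hXc ω) (Z 0 ω)).congr fun t ht => ?_
    rw [hωZ t ht, sub_add_cancel]
  have hmono : ∀ᵐ ω ∂P, ∀ x, MonotoneOn (L ω x) (Icc 0 T) := by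
    filter_upwards [hlim] with ω hω x a ha b hb hab
    refine sub_nonneg.1 (ge_of_tendsto' (hω.tendsto_sub (hXc ω) (x - Z 0 ω) ha hb) fun n => ?_)
    exact mollified_nonneg _ (by positivity) _ hab
  have htails : LocalTimeTails P T H L := by
    obtain ⟨A, C, hA, hC, h⟩ := hX.exists_measure_limitDensity_le hc hXm hXc hX0 hH hHd hT
    refine ⟨A, C, hA, hC, fun a r ha hr hr1 har N hN => ?_⟩
    refine (measure_mono ?_).trans (h a r ha hr hr1 har N hN)
    rintro ω ⟨x, hx⟩
    exact ⟨x - Z 0 ω, hx⟩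
  have hunif := htails.uniformLocalTimeBounds hmono hH hHd hT
  have hosc := htails.oscillationBounds hd hmono hloc hcont hH hHd hT
  exact ⟨hV.incrementMomentBounds hd hT hG, ⟨L, hloc, hunif, hunif.pointwiseLocalTimeBounds⟩,
    hosc, hosc.nowhereDifferentiable hHd⟩

end GaussianLocalTime

end


/-! ### Fractional Brownian motion satisfies the hypotheses -/

noncomputable section

namespace GaussianLocalTime

/-! ### The spectral representation of fractional Brownian motion -/

theorem integrable_of_abs_rpow_le {f : ℝ → ℝ} (hf : AEStronglyMeasurable f) {p q C : ℝ}
    (hp : -1 < p) (hq : q < -1) (h1 : ∀ x, 0 < |x| → |x| ≤ 1 → ‖f x‖ ≤ C * |x| ^ p)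
    (h2 : ∀ x, 1 < |x| → ‖f x‖ ≤ C * |x| ^ q) : Integrable f := by
  have key : ∀ g : ℝ → ℝ, AEStronglyMeasurable g (volume.restrict (Ioi 0)) →
      (∀ x, 0 < x → x ≤ 1 → ‖g x‖ ≤ C * x ^ p) → (∀ x, 1 < x → ‖g x‖ ≤ C * x ^ q) →
      IntegrableOn g (Ioi 0) := by
    intro g hg hg1 hg2
    rw [← Ioc_union_Ioi_eq_Ioi zero_le_one]
    refine IntegrableOn.union ?_ ?_
    · have h3 : IntegrableOn (fun x : ℝ => C * x ^ p) (Ioc 0 1) :=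
        ((intervalIntegrable_iff_integrableOn_Ioc_of_le zero_le_one).1
          (intervalIntegral.intervalIntegrable_rpow' hp)).const_mul C
      refine Integrable.mono' h3 (hg.mono_measure (Measure.restrict_mono_set _ Ioc_subset_Ioi_self))
        ?_
      filter_upwards [ae_restrict_mem measurableSet_Ioc] with x hx using hg1 x hx.1 hx.2
    · have h3 : IntegrableOn (fun x : ℝ => C * x ^ q) (Ioi 1) :=
        (integrableOn_Ioi_rpow_of_lt hq one_pos).const_mul C
      refine Integrable.mono' h3 (hg.mono_measure
        (Measure.restrict_mono_set _ (Ioi_subset_Ioi zero_le_one))) ?_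
      filter_upwards [ae_restrict_mem measurableSet_Ioi] with x hx using hg2 x hx
  have hneg := Measure.measurePreserving_neg (volume : Measure ℝ)
  have hpos : IntegrableOn f (Ioi 0) := by
    refine key f hf.restrict (fun x hx hx1 => ?_) (fun x hx => ?_)
    · have h3 := h1 x
      rw [abs_of_pos hx] at h3
      exact h3 hx hx1
    · have h3 := h2 x
      rw [abs_of_pos (one_pos.trans hx)] at h3
      exact h3 hx
  have hng : IntegrableOn (fun x => f (-x)) (Ioi 0) := by
    refine key _ (hf.comp_measurePreserving hneg).restrict (fun x hx hx1 => ?_) (fun x hx => ?_)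
    · have h3 := h1 (-x)
      rw [abs_neg, abs_of_pos hx] at h3
      exact h3 hx hx1
    · have h3 := h2 (-x)
      rw [abs_neg, abs_of_pos (one_pos.trans hx)] at h3
      exact h3 hx
  have hng' : IntegrableOn f (Iio 0) := by
    have := (hneg.integrableOn_comp_preimage (MeasurableEquiv.neg ℝ).measurableEmbedding
      (f := f) (s := Iio 0)).1 (by simpa [Function.comp_def] using hng)
    exact this
  rw [← integrableOn_univ, ← Iic_union_Ioi (a := (0 : ℝ))]
  exact ((integrableOn_Iic_iff_integrableOn_Iio (by simp)).2 hng').union hpos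

/-- The integrand of the spectral representation of `|t| ^ (2H)`. -/
def spectralKernel (H t x : ℝ) : ℝ := (1 - Real.cos (2 * Real.pi * t * x)) * |x| ^ (-1 - 2 * H)

theorem spectralKernel_nonneg (H t x : ℝ) : 0 ≤ spectralKernel H t x :=
  mul_nonneg (sub_nonneg.2 (Real.cos_le_one _)) (by positivity)

variable {H : ℝ}

/-- At 0 the factor 1 - cos vanishes quadratically, leaving the exponent 1 - 2H > -1; at infinity it
is bounded and the exponent is -1 - 2H < -1. -/
theorem integrable_spectralKernel (hH : 0 < H) (hH1 : H < 1) (t : ℝ) :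
    Integrable (spectralKernel H t) := by
  refine integrable_of_abs_rpow_le (p := 1 - 2 * H) (q := -1 - 2 * H)
    (C := 2 + (2 * Real.pi * t) ^ 2) ?_ (by linarith) (by linarith) ?_ ?_
  · refine Measurable.aestronglyMeasurable ?_
    unfold spectralKernel
    fun_prop
  · intro x hx _
    rw [Real.norm_of_nonneg (spectralKernel_nonneg _ _ _)]
    have h1 := Real.one_sub_sq_div_two_le_cos (x := 2 * Real.pi * t * x)
    have h2 : |x| ^ (1 - 2 * H) = |x| ^ 2 * |x| ^ (-1 - 2 * H) := by
      rw [← Real.rpow_natCast, ← Real.rpow_add hx]; congr 1; push_cast; ring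
    rw [h2, ← mul_assoc, spectralKernel]
    refine mul_le_mul_of_nonneg_right ?_ (by positivity)
    rw [sq_abs]
    nlinarith [sq_nonneg x, sq_nonneg (2 * Real.pi * t * x)]
  · intro x hx
    rw [Real.norm_of_nonneg (spectralKernel_nonneg _ _ _), spectralKernel]
    refine mul_le_mul_of_nonneg_right ?_ (by positivity)
    nlinarith [Real.neg_one_le_cos (2 * Real.pi * t * x), sq_nonneg (2 * Real.pi * t)]

/-- By scaling, |t|^(2H) is, up to a constant, an integral of 1 - cos against |x|^(-1-2H). -/
theorem integral_spectralKernel (hH : 0 < H) (t : ℝ) :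
    ∫ x, spectralKernel H t x = |t| ^ (2 * H) * ∫ x, spectralKernel H 1 x := by
  rcases eq_or_ne t 0 with rfl | ht
  · have : (2 * H) ≠ 0 := by positivity
    simp [spectralKernel, Real.zero_rpow this]
  have ht' : 0 < |t| := abs_pos.2 ht
  have h1 : ∀ x, spectralKernel H t x = |t| ^ (1 + 2 * H) * spectralKernel H 1 (t * x) := by
    intro x
    have : |x| ^ (-1 - 2 * H) = |t| ^ (1 + 2 * H) * |t * x| ^ (-1 - 2 * H) := by
      rw [abs_mul, Real.mul_rpow (abs_nonneg _) (abs_nonneg _), ← mul_assoc, ← Real.rpow_add ht']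
      simp
    rw [spectralKernel, spectralKernel, this, mul_one, ← mul_assoc (2 * Real.pi) t x]
    ring
  simp only [h1]
  rw [integral_const_mul, Measure.integral_comp_mul_left (spectralKernel H 1) t, smul_eq_mul,
    ← mul_assoc, abs_inv, Real.rpow_add ht', Real.rpow_one]
  field_simp

theorem integral_spectralKernel_pos (hH : 0 < H) (hH1 : H < 1) :
    0 < ∫ x, spectralKernel H 1 x := by
  rw [integral_pos_iff_support_of_nonneg (fun x => spectralKernel_nonneg H 1 x)
    (integrable_spectralKernel hH hH1 1)]
  have h1 : Ioo (0 : ℝ) (1 / 2) ⊆ Function.support (spectralKernel H 1) := by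
    intro x hx
    have hpi := Real.pi_pos
    have h2 : Real.cos (2 * Real.pi * 1 * x) < Real.cos 0 := by
      refine Real.strictAntiOn_cos ⟨le_rfl, hpi.le⟩ ⟨?_, ?_⟩ ?_
      · have := hx.1; positivity
      · nlinarith [hx.2]
      · have := hx.1; positivity
    rw [Real.cos_zero] at h2
    exact (mul_pos (sub_pos.2 h2) (Real.rpow_pos_of_pos (abs_pos.2 hx.1.ne') _)).ne'
  refine lt_of_lt_of_le ?_ (measure_mono h1)
  rw [Real.volume_Ioo]
  simp

/-- Covariances of the increments of a process with stationary increments of variance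
`|t| ^ (2H)`. -/
def incrementCov (H a b a' b' : ℝ) : ℝ :=
  (|b - a'| ^ (2 * H) + |a - b'| ^ (2 * H) - |b - b'| ^ (2 * H) - |a - a'| ^ (2 * H)) / 2

/-- The spectral density of a combination of increments. -/
def spectralSq {m : ℕ} (x : Fin m → ℝ) (t : Fin (m + 1) → ℝ) (y : ℝ) : ℝ :=
  (∑ i, x i * (Real.cos (2 * Real.pi * t i.succ * y) -
    Real.cos (2 * Real.pi * t i.castSucc * y))) ^ 2 +
  (∑ i, x i * (Real.sin (2 * Real.pi * t i.succ * y) -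
    Real.sin (2 * Real.pi * t i.castSucc * y))) ^ 2

/-- Products of cosines and of sines combine to cosines of time differences. The signs of the four
terms sum to zero, so each cosine may be replaced by 1 - cos with the opposite sign. -/
theorem spectralSq_mul_eq {m : ℕ} (x : Fin m → ℝ) (t : Fin (m + 1) → ℝ) (y : ℝ) :
    spectralSq x t y * |y| ^ (-1 - 2 * H) = ∑ i, ∑ j, x i * x j *
      (spectralKernel H (t i.succ - t j.castSucc) y + spectralKernel H (t i.castSucc - t j.succ) y -
        spectralKernel H (t i.succ - t j.succ) y -
        spectralKernel H (t i.castSucc - t j.castSucc) y) := by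
  rw [spectralSq, sq, sq, Finset.sum_mul_sum, Finset.sum_mul_sum, ← Finset.sum_add_distrib,
    Finset.sum_mul]
  refine Finset.sum_congr rfl fun i _ => ?_
  rw [← Finset.sum_add_distrib, Finset.sum_mul]
  refine Finset.sum_congr rfl fun j _ => ?_
  simp only [spectralKernel, mul_sub, sub_mul, Real.cos_sub]
  ring

theorem integrable_spectralSq {m : ℕ} (hH : 0 < H) (hH1 : H < 1) (x : Fin m → ℝ)
    (t : Fin (m + 1) → ℝ) : Integrable fun y => spectralSq x t y * |y| ^ (-1 - 2 * H) := by
  simp only [spectralSq_mul_eq]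
  have h := integrable_spectralKernel hH hH1
  exact integrable_finsetSum _ fun i _ => integrable_finsetSum _ fun j _ =>
    ((((h _).add (h _)).sub (h _)).sub (h _)).const_mul _

/-- The covariance form of the increments becomes the integral of a manifestly nonnegative density.
-/
theorem integral_spectralSq {m : ℕ} (hH : 0 < H) (hH1 : H < 1) (x : Fin m → ℝ)
    (t : Fin (m + 1) → ℝ) : ∫ y, spectralSq x t y * |y| ^ (-1 - 2 * H) =
      2 * (∫ y, spectralKernel H 1 y) * ∑ i, ∑ j, x i * x j *
        incrementCov H (t i.castSucc) (t i.succ) (t j.castSucc) (t j.succ) := by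
  simp only [spectralSq_mul_eq]
  have h := integrable_spectralKernel hH hH1
  have hi : ∀ i j : Fin m, Integrable fun y => x i * x j *
      (spectralKernel H (t i.succ - t j.castSucc) y + spectralKernel H (t i.castSucc - t j.succ) y -
        spectralKernel H (t i.succ - t j.succ) y -
        spectralKernel H (t i.castSucc - t j.castSucc) y) := fun i j =>
    ((((h _).add (h _)).sub (h _)).sub (h _)).const_mul _
  rw [integral_finsetSum _ fun i _ => integrable_finsetSum _ fun j _ => hi i j, Finset.mul_sum]
  refine Finset.sum_congr rfl fun i _ => ?_
  rw [integral_finsetSum _ fun j _ => hi i j, Finset.mul_sum]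
  refine Finset.sum_congr rfl fun j _ => ?_
  rw [integral_const_mul, integral_sub, integral_sub, integral_add (h _) (h _),
    integral_spectralKernel hH, integral_spectralKernel hH (t i.castSucc - t j.succ),
    integral_spectralKernel hH (t i.succ - t j.succ),
    integral_spectralKernel hH (t i.castSucc - t j.castSucc), incrementCov]
  · ring
  · exact (h _).add (h _)
  · exact h _
  · exact ((h _).add (h _)).sub (h _)
  · exact h _

end GaussianLocalTime

end


noncomputable section

namespace GaussianLocalTime

/-! ### Local nondeterminism through a smooth test function -/

open scoped FourierTransform ContDiff in
/-- A smooth bump in `(0, 1)` as the Fourier transform of a rapidly decreasing function. -/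
theorem exists_bump_fourier : ∃ (φ : ℝ → ℝ) (g : ℝ → ℂ) (C : ℝ), Continuous φ ∧ Continuous g ∧
    Integrable g ∧ (∀ u, φ u ≠ 0 → u ∈ Ioo (0 : ℝ) 1) ∧ 0 < ∫ u in (0 : ℝ)..1, φ u ∧
    (∀ u, (φ u : ℂ) = ∫ v : ℝ, Complex.exp ((-2 * Real.pi * v * Complex.I) * u) * g v) ∧
    (∀ v, ‖g v‖ ≤ C) ∧ ∀ v, |v| ^ 2 * ‖g v‖ ≤ C := by
  let f : ContDiffBump (1 / 2 : ℝ) := ⟨1 / 8, 1 / 4, by norm_num, by norm_num⟩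
  have hsupp : ∀ u, f u ≠ 0 → u ∈ Ioo (0 : ℝ) 1 := by
    intro u hu
    have h1 : u ∈ Function.support f := hu
    rw [f.support_eq, Metric.mem_ball, Real.dist_eq, abs_lt] at h1
    have h2 : f.rOut = 1 / 4 := rfl
    rw [h2] at h1
    constructor <;> linarith [h1.1, h1.2]
  have hcs : HasCompactSupport fun u => (f u : ℂ) := f.hasCompactSupport.comp_left Complex.ofReal_zero
  have hcd : ContDiff ℝ ∞ fun u => (f u : ℂ) := Complex.ofRealCLM.contDiff.comp f.contDiff
  let φ : SchwartzMap ℝ ℂ := hcs.toSchwartzMap hcd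
  -- The inverse transform of a Schwartz function is Schwartz, which gives continuity, integrability
  -- and the two bounds on `g` at once.
  let g : SchwartzMap ℝ ℂ := 𝓕⁻ φ
  have hg : (𝓕 g : SchwartzMap ℝ ℂ) = φ := FourierTransform.fourier_fourierInv_eq φ
  refine ⟨f, g, max (SchwartzMap.seminorm ℝ 0 0 g) (SchwartzMap.seminorm ℝ 2 0 g), f.continuous,
    g.continuous, g.integrable, hsupp, ?_, fun u => ?_, fun v => ?_, fun v => ?_⟩
  · have h1 : ∫ u in (0 : ℝ)..1, f u = ∫ u, f u := by
      rw [intervalIntegral.integral_of_le zero_le_one]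
      refine setIntegral_eq_integral_of_forall_compl_eq_zero fun u hu => ?_
      by_contra hne
      exact hu (Ioo_subset_Ioc_self (hsupp u hne))
    rw [h1]
    exact f.integral_pos
  · have h1 : (f u : ℂ) = φ u := rfl
    rw [h1, ← hg, SchwartzMap.fourier_coe, Real.fourier_real_eq_integral_exp_smul]
    refine integral_congr_ae (Eventually.of_forall fun v => ?_)
    simp only [smul_eq_mul]
    congr 2
    push_cast
    ring
  · have := g.norm_pow_mul_le_seminorm ℝ 0 v
    rw [pow_zero, one_mul] at this
    exact this.trans (le_max_left _ _)
  · exact (g.norm_pow_mul_le_seminorm ℝ 2 v).trans (le_max_right _ _)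

theorem integral_fourier_eq {φ : ℝ → ℝ} {g : ℝ → ℂ} (hgi : Integrable g)
    (hφg : ∀ u, (φ u : ℂ) = ∫ v : ℝ, Complex.exp ((-2 * Real.pi * v * Complex.I) * u) * g v)
    {a b : ℝ} (hab : a ≤ b) :
    ((∫ u in a..b, φ u : ℝ) : ℂ) =
      ∫ v : ℝ, (∫ u in a..b, Complex.exp ((-2 * Real.pi * v * Complex.I) * u)) * g v := by
  rw [← intervalIntegral.integral_ofReal]
  simp only [hφg, intervalIntegral.integral_of_le hab, ← integral_mul_const]
  refine integral_integral_swap ?_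
  have h1 : Integrable (fun p : ℝ × ℝ => g p.2) ((volume.restrict (Ioc a b)).prod volume) :=
    hgi.comp_snd _
  refine h1.bdd_mul (c := 1) ?_ ?_
  · exact (by fun_prop : Continuous _).aestronglyMeasurable
  · refine Eventually.of_forall fun p => ?_
    rw [Complex.norm_exp]
    simp

theorem integral_cexp_eq {v : ℝ} (hv : v ≠ 0) (a b : ℝ) :
    ∫ u in a..b, Complex.exp ((-2 * Real.pi * v * Complex.I) * u) =
      (((Real.cos (2 * Real.pi * b * v) - Real.cos (2 * Real.pi * a * v) : ℝ) : ℂ) -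
        ((Real.sin (2 * Real.pi * b * v) - Real.sin (2 * Real.pi * a * v) : ℝ) : ℂ) * Complex.I) /
        (-2 * Real.pi * v * Complex.I) := by
  have hpi : (Real.pi : ℂ) ≠ 0 := by exact_mod_cast Real.pi_ne_zero
  have hv' : (v : ℂ) ≠ 0 := by exact_mod_cast hv
  have hc : (-2 * Real.pi * v * Complex.I : ℂ) ≠ 0 := by simp [hpi, hv']
  have h : ∀ u : ℝ, Complex.exp ((-2 * Real.pi * v * Complex.I) * u) =
      Real.cos (2 * Real.pi * u * v) - Real.sin (2 * Real.pi * u * v) * Complex.I := by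
    intro u
    rw [show (-2 * Real.pi * v * Complex.I : ℂ) * u = ((-(2 * Real.pi * u * v) : ℝ) : ℂ) * Complex.I
      by push_cast; ring, Complex.exp_mul_I, ← Complex.ofReal_cos, ← Complex.ofReal_sin,
      Real.cos_neg, Real.sin_neg]
    push_cast
    ring
  rw [integral_exp_mul_complex hc, h, h]
  congr 1
  push_cast
  ring

/-- The left side is the modulus of the Fourier transform of the step function equal to `x i`
between consecutive times, so `spectralSq` is its square up to the factor (2π v)². -/
theorem norm_sum_integral_cexp {m : ℕ} (x : Fin m → ℝ) (t : Fin (m + 1) → ℝ) {v : ℝ} (hv : v ≠ 0) :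
    ‖∑ i, (x i : ℂ) * ∫ u in t i.castSucc..t i.succ,
      Complex.exp ((-2 * Real.pi * v * Complex.I) * u)‖ =
      √(spectralSq x t v) / (2 * Real.pi * |v|) := by
  simp only [integral_cexp_eq hv, ← mul_div_assoc, ← Finset.sum_div]
  have hpi := Real.pi_pos
  rw [norm_div]
  congr 1
  · have h : (∑ i, (x i : ℂ) * (((Real.cos (2 * Real.pi * t i.succ * v) -
        Real.cos (2 * Real.pi * t i.castSucc * v) : ℝ) : ℂ) -
        ((Real.sin (2 * Real.pi * t i.succ * v) -
        Real.sin (2 * Real.pi * t i.castSucc * v) : ℝ) : ℂ) * Complex.I)) =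
        ⟨∑ i, x i * (Real.cos (2 * Real.pi * t i.succ * v) -
        Real.cos (2 * Real.pi * t i.castSucc * v)), -∑ i, x i * (Real.sin (2 * Real.pi * t i.succ * v)
        - Real.sin (2 * Real.pi * t i.castSucc * v))⟩ := by
      rw [Complex.mk_eq_add_mul_I]
      push_cast
      simp only [mul_sub, Finset.sum_sub_distrib, ← mul_assoc, ← Finset.sum_mul]
      ring
    rw [h, Complex.norm_def, Complex.normSq_mk, spectralSq]
    congr 1
    ring
  · simp [abs_of_pos hpi]

/-- Strong local nondeterminism of fractional Brownian motion on the unit interval. -/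
theorem exists_le_sum_incrementCov_unit {H : ℝ} (hH : 0 < H) (hH1 : H < 1) :
    ∃ c : ℝ, 0 < c ∧ ∀ (m : ℕ) (x : Fin m → ℝ) (t : Fin (m + 1) → ℝ), StrictMono t →
      ∀ k : Fin m, t k.castSucc = 0 → t k.succ = 1 →
      c * x k ^ 2 ≤ ∑ i, ∑ j, x i * x j *
        incrementCov H (t i.castSucc) (t i.succ) (t j.castSucc) (t j.succ) := by
  obtain ⟨φ, g, C, hφc, hgc, hgi, hsupp, hI, hφg, hC0, hC2⟩ := exists_bump_fourier
  have hpi := Real.pi_pos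
  set I := ∫ u in (0 : ℝ)..1, φ u with hIdef
  have hC : 0 ≤ C := (norm_nonneg _).trans (hC0 0)
  -- The dual weight in Cauchy–Schwarz. It is integrable at 0 since 2H - 1 > -1, and at infinity by
  -- the decay |g v| ≤ C |v|⁻².
  have hKi : Integrable fun v : ℝ => ‖g v‖ ^ 2 * |v| ^ (2 * H - 1) := by
    refine integrable_of_abs_rpow_le (p := 2 * H - 1) (q := 2 * H - 5) (C := C ^ 2) ?_
      (by linarith) (by linarith) ?_ ?_
    · exact Measurable.aestronglyMeasurable (by have := hgc.measurable; fun_prop)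
    · intro v hv _
      rw [Real.norm_of_nonneg (by positivity)]
      gcongr
      exact hC0 v
    · intro v hv
      have hv0 : 0 < |v| := one_pos.trans hv
      rw [Real.norm_of_nonneg (by positivity)]
      have h1 : |v| ^ (2 * H - 1) = (|v| ^ 2) ^ 2 * |v| ^ (2 * H - 5) := by
        rw [← pow_mul, ← Real.rpow_natCast, ← Real.rpow_add hv0]; congr 1; push_cast; ring
      rw [h1, ← mul_assoc, ← mul_pow, mul_comm ‖g v‖]
      gcongr
      exact hC2 v
  set K := ∫ v : ℝ, ‖g v‖ ^ 2 * |v| ^ (2 * H - 1) with hK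
  have hK0 : 0 ≤ K := integral_nonneg fun v => by positivity
  set S := ∫ y, spectralKernel H 1 y with hS
  have hS0 : 0 < S := integral_spectralKernel_pos hH hH1
  refine ⟨4 * Real.pi ^ 2 * I ^ 2 / (K + 1) / (2 * S), by positivity, ?_⟩
  intro m x t ht k hk0 hk1
  set V := ∑ i, ∑ j, x i * x j *
    incrementCov H (t i.castSucc) (t i.succ) (t j.castSucc) (t j.succ) with hV
  have hQ := integral_spectralSq hH hH1 x t
  rw [← hS, ← hV] at hQ
  have hQi := integrable_spectralSq hH hH1 x t
  have hle : ∀ i : Fin m, t i.castSucc ≤ t i.succ := fun i => (ht i.castSucc_lt_succ).le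
  -- testing against the bump
  have htest : x k * I = ∑ i, x i * ∫ u in t i.castSucc..t i.succ, φ u := by
    rw [Finset.sum_eq_single k, hk0, hk1]
    · intro i _ hik
      have h0 : ∀ u ∈ uIoc (t i.castSucc) (t i.succ), φ u = 0 := by
        intro u hu
        rw [uIoc_of_le (hle i)] at hu
        by_contra hne
        have hu' := hsupp u hne
        rcases lt_or_gt_of_ne hik with h | h
        · have h1 : t i.succ ≤ t k.castSucc := ht.monotone (by
            rw [Fin.le_def]; simpa using h)
          linarith [hu.2, hu'.1]
        · have h1 : t k.succ ≤ t i.castSucc := ht.monotone (by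
            rw [Fin.le_def]; simpa using h)
          linarith [hu.1, hu'.2]
      have h3 : ∫ u in t i.castSucc..t i.succ, φ u = 0 := by
        rw [intervalIntegral.integral_of_le (hle i), ← uIoc_of_le (hle i)]
        exact setIntegral_eq_zero_of_forall_eq_zero h0
      rw [h3, mul_zero]
    · intro h; exact absurd (Finset.mem_univ k) h
  have hint : ∀ i, Integrable fun v : ℝ => (x i : ℂ) *
      ((∫ u in t i.castSucc..t i.succ, Complex.exp ((-2 * Real.pi * v * Complex.I) * u)) * g v) := by
    intro i
    refine Integrable.const_mul ?_ _
    refine hgi.bdd_mul (c := |t i.succ - t i.castSucc|) ?_ ?_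
    · refine Continuous.aestronglyMeasurable ?_
      exact intervalIntegral.continuous_parametric_intervalIntegral_of_continuous' (f := fun v u : ℝ =>
        Complex.exp ((-2 * Real.pi * v * Complex.I) * u)) (by fun_prop) _ _
    · refine Eventually.of_forall fun v => ?_
      have := intervalIntegral.norm_integral_le_of_norm_le_const (C := 1) (a := t i.castSucc)
        (b := t i.succ) (f := fun u : ℝ => Complex.exp ((-2 * Real.pi * v * Complex.I) * u))
        (fun u _ => by rw [Complex.norm_exp]; simp)
      rwa [one_mul] at this
  have htest' : ((x k * I : ℝ) : ℂ) = ∫ v : ℝ, (∑ i, (x i : ℂ) *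
      ∫ u in t i.castSucc..t i.succ, Complex.exp ((-2 * Real.pi * v * Complex.I) * u)) * g v := by
    rw [htest]
    push_cast
    simp only [integral_fourier_eq hgi hφg (hle _), Finset.sum_mul, mul_assoc]
    rw [integral_finsetSum _ fun i _ => by simpa only [mul_assoc] using hint i]
    refine Finset.sum_congr rfl fun i _ => ?_
    rw [← integral_const_mul]
  -- Cauchy–Schwarz in the form 2AB ≤ ηA² + B²/η, with A = |g v| |v|^(H - 1/2) and B the root of the
  -- spectral density times |v|^(-H - 1/2).
  have hmain : ∀ η : ℝ, 0 < η → 4 * Real.pi * (|x k| * I) ≤ η * K + η⁻¹ * (2 * S * V) := by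
    intro η hη
    have hb : Integrable fun v : ℝ => (4 * Real.pi)⁻¹ * (η * (‖g v‖ ^ 2 * |v| ^ (2 * H - 1)) +
        η⁻¹ * (spectralSq x t v * |v| ^ (-1 - 2 * H))) :=
      ((hKi.const_mul η).add (hQi.const_mul η⁻¹)).const_mul _
    have h1 : ‖((x k * I : ℝ) : ℂ)‖ ≤ ∫ v : ℝ, (4 * Real.pi)⁻¹ * (η * (‖g v‖ ^ 2 * |v| ^ (2 * H - 1)) +
        η⁻¹ * (spectralSq x t v * |v| ^ (-1 - 2 * H))) := by
      rw [htest']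
      refine norm_integral_le_of_norm_le hb ?_
      filter_upwards [Measure.ae_ne volume (0 : ℝ)] with v hv
      have hv0 : 0 < |v| := abs_pos.2 hv
      rw [norm_mul, norm_sum_integral_cexp x t hv]
      set q := spectralSq x t v with hq
      have hq0 : 0 ≤ q := by rw [hq, spectralSq]; positivity
      set w := |v| ^ (H - 1 / 2) with hw
      have hw0 : 0 < w := Real.rpow_pos_of_pos hv0 _
      have e1 : |v| ^ (2 * H - 1) = w ^ 2 := by
        rw [hw, ← Real.rpow_natCast, ← Real.rpow_mul hv0.le]; congr 1; push_cast; ring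
      have e2 : |v| ^ (-1 - 2 * H) = (w * |v|)⁻¹ ^ 2 := by
        rw [inv_pow, mul_pow, ← e1, ← Real.rpow_two, ← Real.rpow_add hv0, ← Real.rpow_neg hv0.le]
        congr 1; ring
      rw [e1, e2]
      have h2 : 2 * (‖g v‖ * w) * (√q * (w * |v|)⁻¹) ≤
          η * (‖g v‖ * w) ^ 2 + η⁻¹ * (√q * (w * |v|)⁻¹) ^ 2 := by
        have h3 := sq_nonneg (η * (‖g v‖ * w) - √q * (w * |v|)⁻¹)
        have h4 : η * (‖g v‖ * w) ^ 2 + η⁻¹ * (√q * (w * |v|)⁻¹) ^ 2 -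
            2 * (‖g v‖ * w) * (√q * (w * |v|)⁻¹) =
            η⁻¹ * (η * (‖g v‖ * w) - √q * (w * |v|)⁻¹) ^ 2 := by
          field_simp
          ring
        have h5 : 0 ≤ η⁻¹ * (η * (‖g v‖ * w) - √q * (w * |v|)⁻¹) ^ 2 := by positivity
        linarith
      rw [mul_pow, mul_pow, Real.sq_sqrt hq0] at h2
      calc √q / (2 * Real.pi * |v|) * ‖g v‖
          = (4 * Real.pi)⁻¹ * (2 * (‖g v‖ * w) * (√q * (w * |v|)⁻¹)) := by
            field_simp; ring
        _ ≤ _ := by gcongr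
    rw [integral_const_mul, integral_add (hKi.const_mul η) (hQi.const_mul η⁻¹), integral_const_mul,
      integral_const_mul, hQ, Complex.norm_real, Real.norm_eq_abs, abs_mul, abs_of_pos hI] at h1
    rw [← div_eq_inv_mul, le_div_iff₀ (by positivity)] at h1
    linarith
  have hV0 : 0 ≤ V := by
    have : 0 ≤ 2 * S * V := by
      rw [← hQ]
      exact integral_nonneg fun v => mul_nonneg (by rw [spectralSq]; positivity) (by positivity)
    exact nonneg_of_mul_nonneg_right this (by positivity)
  rcases eq_or_ne (x k) 0 with h0 | h0
  · simpa [h0] using hV0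
  have hx : 0 < |x k| := abs_pos.2 h0
  -- With this `η` the term with `K` uses up at most half of the left side; `K + 1` in place of `K`
  -- avoids a possible division by zero.
  have h1 := hmain (2 * Real.pi * (|x k| * I) / (K + 1)) (by positivity)
  have h2 : 2 * Real.pi * (|x k| * I) / (K + 1) * K ≤ 2 * Real.pi * (|x k| * I) := by
    rw [div_mul_eq_mul_div, div_le_iff₀ (by positivity)]
    gcongr
    linarith
  have h3 : 2 * Real.pi * (|x k| * I) ≤ (2 * Real.pi * (|x k| * I) / (K + 1))⁻¹ * (2 * S * V) := by
    linarith
  rw [inv_mul_eq_div, le_div_iff₀ (by positivity)] at h3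
  rw [div_mul_eq_mul_div, div_le_iff₀ (by positivity)]
  calc 4 * Real.pi ^ 2 * I ^ 2 / (K + 1) * x k ^ 2
      = 2 * Real.pi * (|x k| * I) * (2 * Real.pi * (|x k| * I) / (K + 1)) := by
        rw [← sq_abs (x k)]; ring
    _ ≤ 2 * S * V := h3
    _ = _ := by ring

/-- Self-similarity and stationarity of increments, valid because `incrementCov` involves time
differences only. -/
theorem incrementCov_scale {H Δ τ : ℝ} (hΔ : 0 < Δ) (a b a' b' : ℝ) :
    incrementCov H a b a' b' = Δ ^ (2 * H) *
      incrementCov H ((a - τ) / Δ) ((b - τ) / Δ) ((a' - τ) / Δ) ((b' - τ) / Δ) := by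
  have h : ∀ p q : ℝ, |p - q| ^ (2 * H) =
      Δ ^ (2 * H) * |(p - τ) / Δ - (q - τ) / Δ| ^ (2 * H) := by
    intro p q
    rw [← Real.mul_rpow hΔ.le (abs_nonneg _), ← sub_div, abs_div, abs_of_pos hΔ,
      mul_div_cancel₀ _ hΔ.ne', sub_sub_sub_cancel_right]
  unfold incrementCov
  rw [h b a', h a b', h b b', h a a']
  ring

/-- An affine change of time maps the k-th interval to [0, 1]. Earlier times may become negative,
which is why the unit case imposes no sign condition on the times. -/
theorem exists_le_sum_incrementCov {H : ℝ} (hH : 0 < H) (hH1 : H < 1) :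
    ∃ c : ℝ, 0 < c ∧ ∀ (m : ℕ) (x : Fin m → ℝ) (t : Fin (m + 1) → ℝ), StrictMono t →
      ∀ k : Fin m, c * (x k ^ 2 * (t k.succ - t k.castSucc) ^ (2 * H)) ≤ ∑ i, ∑ j, x i * x j *
        incrementCov H (t i.castSucc) (t i.succ) (t j.castSucc) (t j.succ) := by
  obtain ⟨c, hc, h⟩ := exists_le_sum_incrementCov_unit hH hH1
  refine ⟨c, hc, fun m x t ht k => ?_⟩
  set τ := t k.castSucc with hτ
  set Δ := t k.succ - τ with hΔdef
  have hΔ : 0 < Δ := sub_pos.2 (ht k.castSucc_lt_succ)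
  have h1 := h m x (fun i => (t i - τ) / Δ) (fun i j hij => by
    have := ht hij
    simp only
    gcongr) k (by simp [hτ]) (by rw [← hΔdef]; exact div_self hΔ.ne')
  have h2 : 0 < Δ ^ (2 * H) := Real.rpow_pos_of_pos hΔ _
  calc c * (x k ^ 2 * Δ ^ (2 * H)) = Δ ^ (2 * H) * (c * x k ^ 2) := by ring
    _ ≤ _ := mul_le_mul_of_nonneg_left h1 h2.le
    _ = _ := by
      rw [Finset.mul_sum]
      refine Finset.sum_congr rfl fun i _ => ?_
      rw [Finset.mul_sum]
      refine Finset.sum_congr rfl fun j _ => ?_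
      rw [incrementCov_scale (H := H) (τ := τ) hΔ (t i.castSucc)]
      ring

end GaussianLocalTime

end


noncomputable section

namespace GaussianLocalTime

/-! ### Fractional Brownian motion -/

variable {Ω : Type*} [mΩ : MeasurableSpace Ω] {P : Measure Ω} {d : ℕ}
  {T H : ℝ} {Z : ℝ → Ω → E d}

theorem IsCenteredGaussian.memLp_coord (hG : IsCenteredGaussian P T Z) {t : ℝ}
    (ht : t ∈ Icc 0 T) (l : Fin d) : MemLp (fun ω => Z t ω l) 2 P :=
  ((hG.gaussian.hasGaussianLaw_eval ⟨t, ht⟩).map_fun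
    (EuclideanSpace.proj l : E d →L[ℝ] ℝ)).memLp_two

theorem IsFractionalBrownianMotion.integral_mul_increments (hZ : IsFractionalBrownianMotion P T H Z)
    {a b a' b' : ℝ} (ha : a ∈ Icc 0 T) (hb : b ∈ Icc 0 T) (ha' : a' ∈ Icc 0 T)
    (hb' : b' ∈ Icc 0 T) (i j : Fin d) :
    ∫ ω, (Z b ω i - Z a ω i) * (Z b' ω j - Z a' ω j) ∂P =
      if i = j then incrementCov H a b a' b' else 0 := by
  have hi : ∀ s ∈ Icc 0 T, ∀ t ∈ Icc 0 T, Integrable (fun ω => Z s ω i * Z t ω j) P :=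
    fun s hs t ht => (hZ.memLp_coord hs i).integrable_mul (hZ.memLp_coord ht j)
  have h1 : ∀ ω, (Z b ω i - Z a ω i) * (Z b' ω j - Z a' ω j) =
      Z b ω i * Z b' ω j - Z b ω i * Z a' ω j - (Z a ω i * Z b' ω j - Z a ω i * Z a' ω j) :=
    fun ω => by ring
  simp only [h1]
  have hsub : ∀ s ∈ Icc 0 T, Integrable
      (fun ω => Z s ω i * Z b' ω j - Z s ω i * Z a' ω j) P :=
    fun s hs => (hi s hs b' hb').sub (hi s hs a' ha')
  rw [integral_sub (hsub b hb) (hsub a ha),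
    integral_sub (hi b hb b' hb') (hi b hb a' ha'), integral_sub (hi a ha b' hb') (hi a ha a' ha'),
    hZ.covariance b hb b' hb', hZ.covariance b hb a' ha', hZ.covariance a ha b' hb',
    hZ.covariance a ha a' ha']
  split_ifs
  · rw [incrementCov, abs_sub_comm b a', abs_sub_comm a b', abs_sub_comm b b', abs_sub_comm a a']
    ring
  · simp

theorem incrementCov_self {H : ℝ} (hH : 0 < H) (a b : ℝ) :
    incrementCov H a b a b = |b - a| ^ (2 * H) := by
  have : 2 * H ≠ 0 := by positivity
  simp [incrementCov, Real.zero_rpow this, abs_sub_comm a b]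

theorem IsFractionalBrownianMotion.integral_sq_increment (hZ : IsFractionalBrownianMotion P T H Z)
    (hH : 0 < H) {s t : ℝ} (hs : s ∈ Icc 0 T) (ht : t ∈ Icc 0 T) (l : Fin d) :
    ∫ ω, (Z t ω l - Z s ω l) ^ 2 ∂P = |t - s| ^ (2 * H) := by
  simp only [sq]
  rw [hZ.integral_mul_increments hs ht hs ht, if_pos rfl, incrementCov_self hH]

theorem IsFractionalBrownianMotion.incrementVarianceBounds
    (hZ : IsFractionalBrownianMotion P T H Z) (hH : 0 < H) : IncrementVarianceBounds P T H Z :=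
  ⟨1, 1, one_pos, fun s hs t ht l => by
    rw [hZ.integral_sq_increment hH hs ht, one_mul]
    exact ⟨le_rfl, le_rfl⟩⟩

/-- Different coordinates are uncorrelated, so the variance is a sum of scalar forms, one for each
coordinate. All of them are nonnegative, and the one for `l` already satisfies the bound. -/
theorem IsFractionalBrownianMotion.locallyNondeterministic
    (hZ : IsFractionalBrownianMotion P T H Z) (hH : 0 < H) (hH1 : H < 1) :
    LocallyNondeterministic P T Z := by
  obtain ⟨c, hc, h⟩ := exists_le_sum_incrementCov hH hH1
  refine ⟨c, hc, fun m ξ t ht ht0 htT k l => ?_⟩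
  have htI : ∀ i, t i ∈ Icc 0 T := fun i =>
    ⟨ht0 ▸ ht.monotone (Fin.zero_le i), (ht.monotone (Fin.le_last i)).trans htT⟩
  let D : Fin m × Fin d → Ω → ℝ := fun p ω => Z (t p.1.succ) ω p.2 - Z (t p.1.castSucc) ω p.2
  have hDD : ∀ p p', Integrable (fun ω => D p ω * D p' ω) P := fun p p' =>
    ((hZ.memLp_coord (htI _) _).sub (hZ.memLp_coord (htI _) _)).integrable_mul
      ((hZ.memLp_coord (htI _) _).sub (hZ.memLp_coord (htI _) _))
  have h1 : ∀ ω, (∑ j : Fin m, inner ℝ (ξ j) (Z (t j.succ) ω - Z (t j.castSucc) ω)) ^ 2 =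
      ∑ p : Fin m × Fin d, ∑ p' : Fin m × Fin d, (ξ p.1 p.2 * ξ p'.1 p'.2) * (D p ω * D p' ω) := by
    intro ω
    have h2 : ∑ j : Fin m, inner ℝ (ξ j) (Z (t j.succ) ω - Z (t j.castSucc) ω) =
        ∑ p : Fin m × Fin d, ξ p.1 p.2 * D p ω := by
      rw [Fintype.sum_prod_type]
      refine Finset.sum_congr rfl fun j _ => ?_
      rw [PiLp.inner_apply]
      refine Finset.sum_congr rfl fun i _ => ?_
      simp [D, mul_comm]
    rw [h2, sq, Finset.sum_mul_sum]
    refine Finset.sum_congr rfl fun p _ => Finset.sum_congr rfl fun p' _ => ?_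
    ring
  let Q : Fin d → ℝ := fun i => ∑ j : Fin m, ∑ j' : Fin m, ξ j i * ξ j' i *
    incrementCov H (t j.castSucc) (t j.succ) (t j'.castSucc) (t j'.succ)
  have h3 : ∫ ω, (∑ j : Fin m, inner ℝ (ξ j) (Z (t j.succ) ω - Z (t j.castSucc) ω)) ^ 2 ∂P =
      ∑ i, Q i := by
    simp only [h1]
    rw [integral_finsetSum _ fun p _ => integrable_finsetSum _ fun p' _ => (hDD p p').const_mul _]
    simp only [fun p => integral_finsetSum Finset.univ fun p' (_ : p' ∈ Finset.univ) =>
      (hDD p p').const_mul (ξ p.1 p.2 * ξ p'.1 p'.2), integral_const_mul]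
    have h4 : ∀ p p', ∫ ω, D p ω * D p' ω ∂P = if p.2 = p'.2 then
        incrementCov H (t p.1.castSucc) (t p.1.succ) (t p'.1.castSucc) (t p'.1.succ) else 0 :=
      fun p p' => hZ.integral_mul_increments (htI _) (htI _) (htI _) (htI _) _ _
    simp only [h4, Fintype.sum_prod_type, mul_ite, mul_zero, Finset.sum_ite_eq,
      Finset.mem_univ, if_true, Q]
    exact Finset.sum_comm
  rw [h3, hZ.integral_sq_increment hH (htI _) (htI _),
    abs_of_pos (sub_pos.2 (ht k.castSucc_lt_succ))]
  have h5 : ∀ i, c * (ξ k i ^ 2 * (t k.succ - t k.castSucc) ^ (2 * H)) ≤ Q i := fun i =>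
    h m (fun j => ξ j i) t ht k
  have hpos : 0 < t k.succ - t k.castSucc := sub_pos.2 (ht k.castSucc_lt_succ)
  exact (h5 l).trans (Finset.single_le_sum (fun i _ => le_trans (by positivity) (h5 i))
    (Finset.mem_univ l))

end GaussianLocalTime

end
theorem mainTheorem5 {Ω : Type*} [MeasurableSpace Ω] (P : Measure Ω) [IsProbabilityMeasure P]
    (d : ℕ) (hd : 0 < d) (H : ℝ) (hH : H ∈ Ioo (0 : ℝ) (1 / d)) (T : ℝ) (hT : 0 < T)
    (Z : ℝ → Ω → GaussianLocalTime.E d)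
    (hcont : ∀ᵐ ω ∂P, ContinuousOn (fun t => Z t ω) (Icc 0 T)) :
    (GaussianLocalTime.IsCenteredGaussian P T Z →
      GaussianLocalTime.IncrementVarianceBounds P T H Z →
      GaussianLocalTime.LocallyNondeterministic P T Z →
      GaussianLocalTime.LocalTimeAssertions P T H 0 (1 / 2) Z) ∧
    (GaussianLocalTime.IsFractionalBrownianMotion P T H Z →
      (GaussianLocalTime.IncrementVarianceBounds P T H Z ∧
        GaussianLocalTime.LocallyNondeterministic P T Z) ∧
      GaussianLocalTime.LocalTimeAssertions P T H 0 (1 / 2) Z) := by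
  have hd' : (0 : ℝ) < d := by exact_mod_cast hd
  have hd1 : (1 : ℝ) ≤ d := by exact_mod_cast hd
  have hHd : H * d < 1 := (lt_div_iff₀ hd').1 hH.2
  have hH1 : H < 1 := hH.2.trans_le ((div_le_one hd').2 hd1)
  have hmain := fun hG hV hL =>
    GaussianLocalTime.localTimeAssertions_of_locallyNondeterministic (P := P) (Z := Z)
      hd hH.1 hHd hT hcont hG hV hL
  refine ⟨hmain, fun hZ => ?_⟩
  have hV := hZ.incrementVarianceBounds hH.1
  have hL := hZ.locallyNondeterministic hH.1 hH1
  exact ⟨⟨hV, hL⟩, hmain hZ.toIsCenteredGaussian hV hL⟩
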